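/- Conventions. Let $0\le p\le d$ with $d\ge 2$, let $E^{p,d-p}$ be $\mathbb R^d$ with the quadratic form $q(x)=x_1^2+\dots+x_p^2-x_{p+1}^2-\dots-x_d^2$, and call an affine map of $E^{p,d-p}$ an isometry if its linear part preserves $q$, and a similarity if its linear part is a positive multiple of a linear isometry of $q$. A similarity pseudo-Euclidean manifold (of signature $(p,d-p)$) is a Hausdorff manifold $M$ with a maximal atlas of charts with values in $E^{p,d-p}$ whose changes of charts are locally restrictions of similarities. A smooth affine connection $\nabla$ on $M$, with Christoffel symbols given by $\nabla_XY=\partial_XY+\Gamma(X,Y)$ in charts, is stiff for a given family of such charts if in these charts $\Gamma$ is symmetric, the geodesics of $\nabla$ are contained in straight lines, and the first order infinitesimal holonomies (the curvature endomorphisms $R(u,v)$) are infinitesimal isometries, i.e. skew-symmetric with respect to $q$. A stiff pair $(M,\nabla)$ is a similarity pseudo-Euclidean manifold with a connection that is stiff for its maximal atlas. It is an isometry stiff pair if the maximal atlas contains a family of charts that covers $M$, whose changes of charts are locally restrictions of isometries, and for which $\nabla$ is stiff. The connection is flat if its curvature tensor vanishes identically. For $\lambda\in\{-1,0,1\}$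 and a sign $\nu\in\{+,-\}$, the canonical model $\mathcal S^{\nu}_{\lambda}(p,d-p)$ is the set of $x\in E^{p,d-p}$ at which $\psi(x)=q(x)+\lambda$ has sign $\nu$ (intersected with $\{x_1>0\}$ if $\nu=+$, $p=1$, $\lambda\le 0$, and with $\{x_d>0\}$ if $\nu=-$, $d-p=1$, $\lambda\ge 0$), with the connection $\Gamma(u,v)=a(v)u+a(u)v$, $a=-d\psi/\psi$. The pair $(M,\nabla)$ is modelled on $\mathcal S^{\nu}_{\lambda}(p,d-p)$ if $M$ is covered by charts of its maximal atlas that take values in the model and map $\nabla$ to the connection of the model. Theorem. Let $(M,\nabla)$ be a stiff pair of signature $(p,d-p)$, with $M$ connected (non-empty) and compact, and $\nabla$ not flat. Then $(M,\nabla)$ is not an isometry stiff pair. There is exactly one pair $(\lambda,\nu)\in\{-1,0,1\}\times\{+,-\}$ such that $(M,\nabla)$ is modelled on the canonical model $\mathcal S^{\nu}_{\lambda}(p,d-p)$, and: 1. $\lambda=0$; 2. $M$ carries a smooth nowhere-vanishing global vector field; 3. $(M,\nabla)$ is not geodesically complete, i.e. some geodesic defined on an open interval does not extend to a geodesic defined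 on all of $\mathbb R$; 4. there is no globally defined volume form (smooth nowhere-vanishing $d$-form) $\omega$ on $M$ that is preserved by $\nabla$, i.e. such that $\nabla\omega=0$. -/

import Mathlib

open Set Filter Topology Bundle
open scoped Manifold ContDiff

noncomputable section

namespace StiffPair

/-! ### Pseudo-Euclidean space, similarities and isometries -/

/-- The underlying space of the pseudo-Euclidean space `E^{p,d-p}`. The signature is recorded by
the quadratic form `q p` below; the Euclidean norm only serves as a source of topology. -/
abbrev E (d : ℕ) : Type := EuclideanSpace ℝ (Fin d)

/-- The sign `ε_i`: `+1` for the first `p` coordinates and `-1` for the remaining ones. -/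
def eps (p : ℕ) {d : ℕ} (i : Fin d) : ℝ := if i.val < p then 1 else -1

/-- The scalar product `x · y = ∑ ε_i x_i y_i` of signature `(p, d - p)`. -/
def sprod (p : ℕ) {d : ℕ} (x y : E d) : ℝ := ∑ i, eps p i * (x i * y i)

/-- The quadratic form `q(x) = x_1² + ⋯ + x_p² - x_{p+1}² - ⋯ - x_d²`. -/
def q (p : ℕ) {d : ℕ} (x : E d) : ℝ := sprod p x x

/-- Affine similarities: a homothety composed with a linear isometry of `q`, and a translation. -/
def IsSimilarity (p : ℕ) {d : ℕ} (f : E d → E d) : Prop :=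
  ∃ (A : E d ≃ₗ[ℝ] E d) (s : ℝ) (b : E d),
    0 < s ∧ (∀ v, q p (A v) = q p v) ∧ ∀ x, f x = s • A x + b

/-- Affine isometries of `q`. -/
def IsIsometry (p : ℕ) {d : ℕ} (f : E d → E d) : Prop :=
  ∃ (A : E d ≃ₗ[ℝ] E d) (b : E d), (∀ v, q p (A v) = q p v) ∧ ∀ x, f x = A x + b

theorem isSimilarity_id (p : ℕ) {d : ℕ} : IsSimilarity p (id : E d → E d) :=
  ⟨LinearEquiv.refl ℝ _, 1, 0, one_pos, fun _ => rfl, fun x => by simp⟩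

theorem isIsometry_id (p : ℕ) {d : ℕ} : IsIsometry p (id : E d → E d) :=
  ⟨LinearEquiv.refl ℝ _, 0, fun _ => rfl, fun x => by simp⟩

theorem IsSimilarity.comp {p d : ℕ} {f g : E d → E d}
    (hg : IsSimilarity p g) (hf : IsSimilarity p f) : IsSimilarity p (g ∘ f) := by
  obtain ⟨A, s, b, hs, hA, hf⟩ := hf
  obtain ⟨B, t, c, ht, hB, hg⟩ := hg
  refine ⟨A.trans B, t * s, t • B b + c, mul_pos ht hs, fun v => ?_, fun x => ?_⟩
  · simp [hB, hA]
  · simp [hf, hg, mul_smul, add_assoc]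

theorem IsIsometry.comp {p d : ℕ} {f g : E d → E d}
    (hg : IsIsometry p g) (hf : IsIsometry p f) : IsIsometry p (g ∘ f) := by
  obtain ⟨A, b, hA, hf⟩ := hf
  obtain ⟨B, c, hB, hg⟩ := hg
  refine ⟨A.trans B, B b + c, fun v => ?_, fun x => ?_⟩
  · simp [hB, hA]
  · simp [hf, hg, add_assoc]

theorem IsSimilarity.continuous {p d : ℕ} {f : E d → E d} (hf : IsSimilarity p f) :
    Continuous f := by
  obtain ⟨A, s, b, -, -, hf⟩ := hf
  have hA : Continuous fun x => A x := A.toLinearMap.continuous_of_finiteDimensional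
  rw [show f = fun x => s • A x + b from funext hf]
  exact (hA.const_smul s).add continuous_const

theorem IsIsometry.continuous {p d : ℕ} {f : E d → E d} (hf : IsIsometry p f) :
    Continuous f := by
  obtain ⟨A, b, -, hf⟩ := hf
  have hA : Continuous fun x => A x := A.toLinearMap.continuous_of_finiteDimensional
  rw [show f = fun x => A x + b from funext hf]
  exact hA.add continuous_const

/-- The pregroupoid of the maps that locally coincide with a member of a set `S` of continuous
maps stable under composition. -/
def locallyIn {d : ℕ} (S : Set (E d → E d)) (hid : id ∈ S)
    (hcomp : ∀ {f g}, g ∈ S → f ∈ S → g ∘ f ∈ S) (hcont : ∀ {f}, f ∈ S → Continuous f) :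
    Pregroupoid (E d) where
  property f U := ∀ x ∈ U, ∃ g ∈ S, f =ᶠ[𝓝 x] g
  comp {f g u v} hf hg _ _ _ x hx := by
    obtain ⟨f₀, hf₀, hff⟩ := hf x hx.1
    obtain ⟨g₀, hg₀, hgg⟩ := hg (f x) hx.2
    refine ⟨g₀ ∘ f₀, hcomp hg₀ hf₀, ?_⟩
    have hc : Tendsto f (𝓝 x) (𝓝 (f x)) := ((hcont hf₀).continuousAt.congr hff.symm)
    filter_upwards [hff, hc.eventually hgg] with y h1 h2
    rw [Function.comp_apply, h2, h1, Function.comp_apply]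
  id_mem x _ := ⟨id, hid, EventuallyEq.rfl⟩
  locality {f u} _ h x hx := by
    obtain ⟨v, _, hxv, hv⟩ := h x hx
    exact hv x ⟨hx, hxv⟩
  congr {f g u} hu hfg hf x hx := by
    obtain ⟨f₀, hf₀, hff⟩ := hf x hx
    refine ⟨f₀, hf₀, ?_⟩
    filter_upwards [hff, hu.mem_nhds hx] with y h1 h2
    rw [hfg y h2, h1]

/-- The groupoid of local similarities of `E^{p,d-p}`. A *similarity pseudo-Euclidean manifold* of
signature `(p, d - p)` is a manifold modelled on `E d` with this structure groupoid. -/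
def similarityGroupoid (p d : ℕ) : StructureGroupoid (E d) :=
  (locallyIn {f | IsSimilarity p f} (isSimilarity_id p) (fun hg hf => IsSimilarity.comp hg hf)
    (fun hf => IsSimilarity.continuous hf)).groupoid

/-- The groupoid of local isometries of `E^{p,d-p}`. -/
def isometryGroupoid (p d : ℕ) : StructureGroupoid (E d) :=
  (locallyIn {f | IsIsometry p f} (isIsometry_id p) (fun hg hf => IsIsometry.comp hg hf)
    (fun hf => IsIsometry.continuous hf)).groupoid

/-! ### Affine connections: Christoffel symbols, curvature, geodesics, volume forms -/

variable {d : ℕ} {M : Type*} [TopologicalSpace M] [ChartedSpace (E d) M]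

/-- An affine connection on `M`: a covariant derivative on the tangent bundle. Its value
`conn Y x v` is `(∇_v Y)(x)`. -/
abbrev Connection (d : ℕ) (M : Type*) [TopologicalSpace M] [ChartedSpace (E d) M]
    [IsManifold (𝓡 d) ∞ M] :=
  CovariantDerivative (𝓡 d) (E d) (TangentSpace (𝓡 d) : M → Type _)

/-- The vector field on the domain of the chart `φ` that is constant equal to `v` in the chart. -/
def chartField (φ : OpenPartialHomeomorph M (E d)) (v : E d) (x : M) : TangentSpace (𝓡 d) x :=
  (mfderiv (𝓡 d) (𝓡 d) φ x).inverse v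

variable [IsManifold (𝓡 d) ∞ M]

/-- The Christoffel symbol `Γ(u, v)` of the connection in the chart `φ`, at the point `y` of the
image of the chart, so that `∇_X Y = ∂_X Y + Γ(X, Y)` in the chart. -/
def christoffel (conn : Connection d M) (φ : OpenPartialHomeomorph M (E d)) (y u v : E d) : E d :=
  mfderiv (𝓡 d) (𝓡 d) φ (φ.symm y)
    (conn (chartField φ v) (φ.symm y) (chartField φ u (φ.symm y)))

/-- The curvature `R(u, v) w` in the chart `φ` at the point `y` of its image, that is
`(∂_u Γ)(v, w) - (∂_v Γ)(u, w) + Γ(u, Γ(v, w)) - Γ(v, Γ(u, w))`. The first order infinitesimal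
holonomy around a small rectangle directed by `(u, v)` is the endomorphism `-R(u, v)`. -/
def curvature (conn : Connection d M) (φ : OpenPartialHomeomorph M (E d)) (y u v w : E d) : E d :=
  let Γ := christoffel conn φ
  fderiv ℝ (fun z => Γ z v w) y u - fderiv ℝ (fun z => Γ z u w) y v
    + Γ y u (Γ y v w) - Γ y v (Γ y u w)

/-- The connection is flat: its curvature tensor vanishes identically. -/
def IsFlat (conn : Connection d M) : Prop :=
  ∀ φ ∈ IsManifold.maximalAtlas (𝓡 d) ∞ M, ∀ y ∈ φ.target, ∀ u v w,
    curvature conn φ y u v w = 0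

/-- `γ` is a geodesic on the set of times `J` (in practice an open interval): it is of class `C²`
and satisfies `γ'' = -Γ(γ', γ')` in every chart. -/
def IsGeodesicOn (conn : Connection d M) (γ : ℝ → M) (J : Set ℝ) : Prop :=
  ContMDiffOn 𝓘(ℝ, ℝ) (𝓡 d) 2 γ J ∧
  ∀ φ ∈ IsManifold.maximalAtlas (𝓡 d) ∞ M, ∀ t ∈ J, γ t ∈ φ.source →
    deriv (deriv fun s => φ (γ s)) t =
      -christoffel conn φ (φ (γ t)) (deriv (fun s => φ (γ s)) t) (deriv (fun s => φ (γ s)) t)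

/-- Geodesic completeness: every geodesic defined on an open interval extends to a geodesic
parameterized from `-∞` to `+∞`. -/
def IsGeodesicallyComplete (conn : Connection d M) : Prop :=
  ∀ (J : Set ℝ) (γ : ℝ → M), IsOpen J → J.OrdConnected → J.Nonempty → IsGeodesicOn conn γ J →
    ∃ γ' : ℝ → M, IsGeodesicOn conn γ' univ ∧ EqOn γ γ' J

/-- A volume form on `M`: a smooth nowhere vanishing differential form of top degree. Smoothness
means that its value on any `d` smooth vector fields is a smooth function. -/
def IsVolumeForm (vol : Π x : M, TangentSpace (𝓡 d) x [⋀^Fin d]→L[ℝ] ℝ) : Prop :=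
  (∀ x, vol x ≠ 0) ∧
  ∀ X : Fin d → Π x : M, TangentSpace (𝓡 d) x,
    (∀ i, ContMDiff (𝓡 d) (𝓡 d).tangent ∞ fun x => (⟨x, X i x⟩ : TangentBundle (𝓡 d) M)) →
      ContMDiff (𝓡 d) 𝓘(ℝ, ℝ) ∞ fun x => vol x fun i => X i x

/-- The form `vol` of top degree is preserved by the connection, i.e. `∇ vol = 0`: for all smooth
vector fields `X_1, …, X_d` and every tangent vector `v`,
`v(vol(X_1, …, X_d)) = ∑ i, vol(X_1, …, ∇_v X_i, …, X_d)`. -/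
def Preserves (conn : Connection d M)
    (vol : Π x : M, TangentSpace (𝓡 d) x [⋀^Fin d]→L[ℝ] ℝ) : Prop :=
  ∀ X : Fin d → Π x : M, TangentSpace (𝓡 d) x,
    (∀ i, ContMDiff (𝓡 d) (𝓡 d).tangent ∞ fun x => (⟨x, X i x⟩ : TangentBundle (𝓡 d) M)) →
      ∀ (x : M) (v : TangentSpace (𝓡 d) x),
        mfderiv (𝓡 d) 𝓘(ℝ, ℝ) (fun y => vol y fun i => X i y) x v =
          ∑ i, vol x (Function.update (fun j => X j x) i (conn (X i) x v))

/-! ### Stiff pairs -/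

/-- The smooth connection `conn` is stiff for the pseudo-Euclidean charts belonging to `𝒜`:
it is symmetric, its geodesics are (contained in) straight lines in the charts, and its first
order infinitesimal holonomies are infinitesimal isometries of `q` in the charts. -/
structure IsStiff (p : ℕ) (𝒜 : Set (OpenPartialHomeomorph M (E d))) (conn : Connection d M) :
    Prop where
  smooth : CovariantDerivative.ContMDiffCovariantDerivative conn ∞
  symmetric : ∀ φ ∈ 𝒜, ∀ y ∈ φ.target, ∀ u v, christoffel conn φ y u v = christoffel conn φ y v u
  straight : ∀ φ ∈ 𝒜, ∀ (J : Set ℝ) (γ : ℝ → M), IsOpen J → J.OrdConnected →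
    IsGeodesicOn conn γ J → MapsTo γ J φ.source →
      ∃ a v : E d, ∀ t ∈ J, ∃ s : ℝ, φ (γ t) = a + s • v
  holonomy : ∀ φ ∈ 𝒜, ∀ y ∈ φ.target, ∀ u v w w',
    sprod p (curvature conn φ y u v w) w' + sprod p w (curvature conn φ y u v w') = 0

/-- `(M, ∇)` is a stiff pair: `M` is a similarity pseudo-Euclidean manifold of signature
`(p, d - p)` and `∇` is stiff for this structure. -/
def IsStiffPair (p : ℕ) (conn : Connection d M) : Prop :=
  HasGroupoid M (similarityGroupoid p d) ∧
    IsStiff p ((similarityGroupoid p d).maximalAtlas M) conn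

/-- `(M, ∇)` is an isometry stiff pair: the similarity structure of `M` contains an atlas whose
changes of charts are isometries, and `∇` is stiff for it. -/
def IsIsometryStiffPair (p : ℕ) (conn : Connection d M) : Prop :=
  ∃ 𝒜 ⊆ (similarityGroupoid p d).maximalAtlas M,
    (∀ x : M, ∃ φ ∈ 𝒜, x ∈ φ.source) ∧
    (∀ φ ∈ 𝒜, ∀ φ' ∈ 𝒜, φ.symm ≫ₕ φ' ∈ isometryGroupoid p d) ∧
    IsStiff p 𝒜 conn

/-! ### Canonical models -/

/-- The potential `ψ(x) = q(x) + l` of the canonical models. -/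
def potential (p : ℕ) {d : ℕ} (l : ℝ) (x : E d) : ℝ := q p x + l

/-- The Christoffel symbol `Γ(u, v) = a(v) u + a(u) v`, with `a = -dψ/ψ`, of the projectively
flattened connection of potential `ψ`. -/
def potentialChristoffel {d : ℕ} (ψ : E d → ℝ) (y u v : E d) : E d :=
  (-(fderiv ℝ ψ y v) / ψ y) • u + (-(fderiv ℝ ψ y u) / ψ y) • v

/-- The domain of the canonical model `S_l^ν(p, d - p)`: the set where `ψ = q + l` has sign `ν`,
restricted to `x_1 > 0` if `ν = +`, `p = 1`, `l ≤ 0`, and to `x_d > 0` if `ν = -`, `d - p = 1`,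
`l ≥ 0`. -/
def modelDomain (p d : ℕ) (l : ℝ) (ν : ℤˣ) : Set (E d) :=
  {x | 0 < ((ν : ℤ) : ℝ) * potential p l x ∧
    (ν = 1 → p = 1 → l ≤ 0 → ∀ i : Fin d, i.val = 0 → 0 < x i) ∧
    (ν = -1 → p + 1 = d → 0 ≤ l → ∀ i : Fin d, i.val + 1 = d → 0 < x i)}

/-- `(M, ∇)` is modelled on the canonical model `S_l^ν(p, d - p)`: the similarity structure of `M`
is generated by charts (i.e. it contains a covering family of charts) each of which takes values
in the model and maps `∇` to the connection of the model. -/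
def IsModelledOn (p : ℕ) (conn : Connection d M) (l : ℝ) (ν : ℤˣ) : Prop :=
  ∃ 𝓕 ⊆ (similarityGroupoid p d).maximalAtlas M,
    (∀ x : M, ∃ φ ∈ 𝓕, x ∈ φ.source) ∧
    ∀ φ ∈ 𝓕, φ.target ⊆ modelDomain p d l ν ∧
      ∀ y ∈ φ.target, ∀ u v,
        christoffel conn φ y u v = potentialChristoffel (potential p l) y u v

end StiffPair

end

/-! In a stiff chart, straight geodesics and symmetry force `Γ(u,v) = a(v)u + a(u)v` for a 1-form
`a`. The curvature then depends only on `B = Da - a⊗a`, and skewness of the holonomy in dimension at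
least 2 forces `B = b q` (`bilin_eq_smul_sprod`). Differentiating `Da = a⊗a + b q` once more gives
`db = b a`. This overdetermined system integrates explicitly (`IsProjData.locPot_eq`): near `y₀`
there is a quadratic polynomial `ψ` with quadratic part `-(b(y₀)/2) q`, `ψ(y₀) = 1`, `ψ a = -dψ` and
`ψ b = b(y₀)`. So the zeros of `b` form a clopen set, which is empty when the connection is not
flat. Completing the square in `ψ` and rescaling gives charts in a canonical model.

Changes of model charts fix the centre of `ψ`, hence are linear, `x ↦ s A x`, with `λ' = s² λ` and
the sign preserved (`IsModelChart.exists_trn`). By connectedness the model is unique.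

The obstruction to isometric changes of charts is `false_of_isometric_changes`. If all ratios `s`
are 1, then `b` is a global continuous function on a compact manifold. At an extremum `a = 0`, so `b
= b₀ / (1 - (b₀/2) q(y - y₀))` nearby: a maximum forces `q ≤ 0` and a minimum forces `q ≥ 0`, which
is absurd since `q` is non-degenerate. This excludes isometry stiff pairs, and also `λ ≠ 0`, because
`λ = s² λ` then gives `s = 1`.

For `λ = 0` the changes of charts are linear and `q` has no zeros on the model. The Euler field `y ↦
y` is therefore global and nowhere zero. A geodesic launched along it satisfies `c' = 3c²` for the
logarithmic radial velocity `c`, and blows up. If `f` is the coefficient of a parallel volume form,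
`f⁴ q^(2d)` is a global continuous function whose radial logarithmic derivative is a nonzero
constant, so it cannot have a maximum. -/

set_option linter.unusedSectionVars false
noncomputable section
namespace StiffPair

/-! ### Algebra of the scalar product -/

section ProjBilin
variable {V : Type*} [NormedAddCommGroup V] [NormedSpace ℝ V]

/-- The bilinear map `(u, v) ↦ a v • u + a u • v`. -/
@[irreducible] def projBilin (a : V →L[ℝ] ℝ) : V →L[ℝ] V →L[ℝ] V :=
  (a.smulRight (ContinuousLinearMap.id ℝ V)).flip + a.smulRight (ContinuousLinearMap.id ℝ V)

theorem projBilin_apply (a : V →L[ℝ] ℝ) (u v : V) :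
    projBilin a u v = a v • u + a u • v := by
  simp [projBilin]

end ProjBilin

section Algebra

variable {d : ℕ}

/-- The standard basis vectors of `E d`. -/
abbrev ee (i : Fin d) : E d := EuclideanSpace.single i (1 : ℝ)

theorem sum_coord (x : E d) : x = ∑ i, x i • ee i := by
  have h := (EuclideanSpace.basisFun (Fin d) ℝ).sum_repr x
  simpa using h.symm

theorem ee_apply (i j : Fin d) : ee i j = if j = i then (1 : ℝ) else 0 := by
  simp [ee]

theorem ee_ne_zero (i : Fin d) : ee i ≠ 0 := fun h => by
  have := congrArg (fun x : E d => x i) h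
  simp at this

/-- The scalar product as a continuous bilinear form. -/
def sform (p : ℕ) {d : ℕ} : E d →L[ℝ] E d →L[ℝ] ℝ :=
  ∑ i, eps p i • (EuclideanSpace.proj i : E d →L[ℝ] ℝ).smulRight
    (EuclideanSpace.proj i : E d →L[ℝ] ℝ)

theorem sform_apply (p : ℕ) (x y : E d) : sform p x y = sprod p x y := by
  simp [sform, sprod]

theorem eps_ne_zero (p : ℕ) (i : Fin d) : eps p i ≠ 0 := by
  unfold eps; split_ifs <;> norm_num

theorem eps_mul_self (p : ℕ) (i : Fin d) : eps p i * eps p i = 1 := by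
  unfold eps; split_ifs <;> norm_num

theorem sprod_comm (p : ℕ) (x y : E d) : sprod p x y = sprod p y x := by
  simp [sprod, mul_comm]

theorem sprod_add_left (p : ℕ) (x y z : E d) :
    sprod p (x + y) z = sprod p x z + sprod p y z := by
  simp [← sform_apply]

theorem sprod_add_right (p : ℕ) (x y z : E d) :
    sprod p x (y + z) = sprod p x y + sprod p x z := by
  simp [← sform_apply]

theorem sprod_smul_left (p : ℕ) (c : ℝ) (x z : E d) :
    sprod p (c • x) z = c * sprod p x z := by
  simp [← sform_apply]

theorem sprod_smul_right (p : ℕ) (c : ℝ) (x z : E d) :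
    sprod p x (c • z) = c * sprod p x z := by
  simp [← sform_apply]

theorem sprod_ee (p : ℕ) (x : E d) (i : Fin d) : sprod p x (ee i) = eps p i * x i := by
  simp [sprod]

theorem sprod_zero_right (p : ℕ) (x : E d) : sprod p x 0 = 0 := by
  simp [← sform_apply]

theorem q_ee (p : ℕ) (i : Fin d) : q p (ee i) = eps p i := by
  simp [q, sprod_ee]

theorem q_zero (p : ℕ) : q p (0 : E d) = 0 := by simp [q, sprod]

theorem q_smul (p : ℕ) (c : ℝ) (x : E d) : q p (c • x) = c ^ 2 * q p x := by
  simp only [q, sprod_smul_left, sprod_smul_right]; ring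

theorem q_add (p : ℕ) (x y : E d) : q p (x + y) = q p x + 2 * sprod p x y + q p y := by
  simp only [q, sprod_add_left, sprod_add_right, sprod_comm p y x]; ring

theorem ext_sprod (p : ℕ) {x y : E d} (h : ∀ w, sprod p x w = sprod p y w) : x = y := by
  ext i
  have := h (ee i)
  rw [sprod_ee, sprod_ee] at this
  exact mul_left_cancel₀ (eps_ne_zero p i) this

theorem sprod_map {p : ℕ} {A : E d ≃ₗ[ℝ] E d} (hA : ∀ v, q p (A v) = q p v) (u v : E d) :
    sprod p (A u) (A v) = sprod p u v := by
  have h := hA (u + v)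
  rw [map_add, q_add, q_add, hA, hA] at h
  linarith

theorem hasFDerivAt_q (p : ℕ) (x : E d) : HasFDerivAt (q p) (2 • sform p x) x := by
  have h : HasFDerivAt (fun y => sform p y y) _ x :=
    (sform (d := d) p).hasFDerivAt.clm_apply (hasFDerivAt_id x)
  have e : (fun y => sform p y y) = (q p : E d → ℝ) := by ext y; rw [sform_apply, q]
  rw [e] at h
  refine h.congr_fderiv (ContinuousLinearMap.ext fun v => ?_)
  simp [sform_apply, sprod_comm p v x, two_mul]

theorem continuous_q (p : ℕ) : Continuous (q p : E d → ℝ) :=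
  continuous_iff_continuousAt.2 fun x => (hasFDerivAt_q p x).continuousAt

theorem exists_two_indices (hd : 2 ≤ d) : ∃ i j : Fin d, i ≠ j :=
  ⟨⟨0, by omega⟩, ⟨1, by omega⟩, by simp⟩

theorem bilin_eq_sum (B : E d →L[ℝ] E d →L[ℝ] ℝ) (u w : E d) :
    B u w = ∑ i, ∑ j, u i * w j * B (ee i) (ee j) := by
  conv_lhs => rw [sum_coord u, sum_coord w]
  simp only [map_sum, map_smul, sum_apply, smul_apply,
    smul_eq_mul, Finset.mul_sum]
  rw [Finset.sum_comm]
  exact Finset.sum_congr rfl fun i _ => Finset.sum_congr rfl fun j _ => by ring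

/-- A bilinear form whose associated projective curvature is skew-symmetric is a multiple of the
scalar product. -/
theorem bilin_eq_smul_sprod (p : ℕ) (hd : 2 ≤ d) (B : E d →L[ℝ] E d →L[ℝ] ℝ)
    (h : ∀ u v w, B u w * sprod p v w - B v w * sprod p u w + (B u v - B v u) * sprod p w w = 0) :
    ∃ β : ℝ, ∀ u w, B u w = β * sprod p u w := by
  -- Testing on `(e_j, e_i, e_i)` gives `2 B(e_j,e_i) = B(e_i,e_j)`; together with the same relation
  -- for `i` and `j` exchanged, this makes both entries zero.
  have off : ∀ i j : Fin d, i ≠ j → B (ee i) (ee j) = 0 := by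
    have key : ∀ i j : Fin d, i ≠ j → 2 * B (ee j) (ee i) = B (ee i) (ee j) := by
      intro i j hij
      have := h (ee j) (ee i) (ee i)
      simp only [sprod_ee, ee_apply, if_true, if_neg hij, mul_one, mul_zero, sub_zero] at this
      have h2 : (2 * B (ee j) (ee i) - B (ee i) (ee j)) * eps p i = 0 := by linarith
      have := (mul_eq_zero.1 h2).resolve_right (eps_ne_zero p i)
      linarith
    intro i j hij
    linarith [key i j hij, key j i hij.symm]
  -- The mixed vector `e_i + e_j` links the two diagonal entries, so all ratios `B(e_i,e_i) / ε_i`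
  -- agree.
  have diag : ∀ i j : Fin d, i ≠ j →
      B (ee i) (ee i) * eps p j = B (ee j) (ee j) * eps p i := by
    intro i j hij
    have := h (ee i) (ee j) (ee i + ee j)
    simp only [sprod_add_right, sprod_ee, ee_apply, if_true, if_neg hij, if_neg hij.symm, mul_one,
      mul_zero, map_add, off i j hij, off j i hij.symm] at this
    linarith
  let i0 : Fin d := ⟨0, by omega⟩
  refine ⟨B (ee i0) (ee i0) * eps p i0, fun u w => ?_⟩
  have hdiag : ∀ i, B (ee i) (ee i) = B (ee i0) (ee i0) * eps p i0 * eps p i := by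
    intro i
    by_cases hi : i = i0
    · subst hi; rw [mul_assoc, eps_mul_self, mul_one]
    · have := diag i i0 hi
      calc B (ee i) (ee i) = B (ee i) (ee i) * eps p i0 * eps p i0 := by
            rw [mul_assoc, eps_mul_self, mul_one]
        _ = _ := by rw [this]; ring
  rw [bilin_eq_sum, sprod, Finset.mul_sum]
  refine Finset.sum_congr rfl fun i _ => ?_
  rw [Finset.sum_eq_single i]
  · rw [hdiag]; ring
  · intro j _ hj; rw [off i j hj.symm, mul_zero]
  · simp

/-- The linear form `a` such that `G u v = a v • u + a u • v`, for projectively flat `G`. -/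
def projForm : (E d →L[ℝ] E d →L[ℝ] E d) →L[ℝ] E d →L[ℝ] ℝ :=
  -- If `G` has the projective form then `G e_i e_i = 2 a(e_i) e_i`, whence the factor 1/2. The
  -- recipe is linear in `G`, so `a` inherits the smoothness of the Christoffel symbols.
  ∑ i, (((2 : ℝ)⁻¹ • (EuclideanSpace.proj i : E d →L[ℝ] ℝ) ∘L
    (ContinuousLinearMap.apply ℝ (E d) (ee i)) ∘L
    (ContinuousLinearMap.apply ℝ (E d →L[ℝ] E d) (ee i))).smulRight
      (EuclideanSpace.proj i : E d →L[ℝ] ℝ))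

theorem projForm_apply_ee (G : E d →L[ℝ] E d →L[ℝ] E d) (i : Fin d) :
    projForm G (ee i) = G (ee i) (ee i) i / 2 := by
  simp [projForm]
  ring

theorem ext_bilin {F : Type*} [NormedAddCommGroup F] [NormedSpace ℝ F]
    {G H : E d →L[ℝ] E d →L[ℝ] F} (h : ∀ i j, G (ee i) (ee j) = H (ee i) (ee j)) : G = H := by
  ext u v
  rw [sum_coord u, sum_coord v]
  simp [map_sum, h]

/-- The difference `T` of the two sides is symmetric, satisfies `T(u,u) ∥ u`, and vanishes on the
pairs `(e_i, e_i)`. Polarising along `e_i + e_j` and `e_i - e_j` makes `T(e_i,e_j)` proportional to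
both vectors, hence zero. -/
theorem eq_projBilin (G : E d →L[ℝ] E d →L[ℝ] E d) (hG : ∀ u v, G u v = G v u)
    (h : ∀ u, ∃ c : ℝ, G u u = c • u) : G = projBilin (projForm G) := by
  have hS : ∀ u, ∃ c : ℝ, (G - projBilin (projForm G)) u u = c • u := by
    intro u
    obtain ⟨c, hc⟩ := h u
    refine ⟨c - 2 * projForm G u, ?_⟩
    simp only [sub_apply, hc, projBilin_apply]
    module
  have hdiag : ∀ i, (G - projBilin (projForm G)) (ee i) (ee i) = 0 := by
    intro i
    obtain ⟨c, hc⟩ := h (ee i)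
    simp only [sub_apply, projBilin_apply, projForm_apply_ee, hc]
    simp [← add_smul]
  have hsymm : ∀ u v, (G - projBilin (projForm G)) u v = (G - projBilin (projForm G)) v u := by
    intro u v
    simp only [sub_apply, projBilin_apply, hG u v]
    abel
  generalize hT : G - projBilin (projForm G) = T at *
  have : T = 0 := by
    refine ext_bilin fun i j => ?_
    by_cases hij : i = j
    · subst hij; simpa using hdiag i
    obtain ⟨c, hc⟩ := hS (ee i + ee j)
    obtain ⟨c', hc'⟩ := hS (ee i - ee j)
    simp only [map_add, map_sub, add_apply, sub_apply,
      hdiag, hsymm (ee j) (ee i)] at hc hc'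
    have h1 : (2 : ℝ) • T (ee i) (ee j) = c • (ee i + ee j) := by
      rw [← hc]; module
    have h2 : (-2 : ℝ) • T (ee i) (ee j) = c' • (ee i - ee j) := by
      rw [← hc']; module
    have e1 := congrArg (fun x : E d => x i) h1
    have e2 := congrArg (fun x : E d => x j) h1
    have e3 := congrArg (fun x : E d => x i) h2
    have e4 := congrArg (fun x : E d => x j) h2
    simp [hij, Ne.symm hij] at e1 e2 e3 e4
    have hc0 : c = 0 := by linarith
    rw [hc0, zero_smul] at h1
    simpa using h1
  rw [← sub_eq_zero, hT, this]

/-- Take determinants in `Nᵀ J N = J`, where `J` is the invertible Gram matrix of `q`. -/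
theorem det_sq_of_isometry {p : ℕ} {A : E d ≃ₗ[ℝ] E d} (hA : ∀ v, q p (A v) = q p v) :
    LinearMap.det (A : E d →ₗ[ℝ] E d) ^ 2 = 1 := by
  let b := (EuclideanSpace.basisFun (Fin d) ℝ).toBasis
  let N := LinearMap.toMatrix b b (A : E d →ₗ[ℝ] E d)
  let J : Matrix (Fin d) (Fin d) ℝ := Matrix.diagonal (eps p)
  have hN : ∀ i j, N i j = A (ee j) i := by
    intro i j; simp [N, b, LinearMap.toMatrix_apply]
  have h : N.transpose * J * N = J := by
    ext i j
    have := sprod_map hA (ee i) (ee j)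
    rw [sprod_ee, sprod] at this
    rw [Matrix.mul_apply]
    simp only [J, Matrix.mul_diagonal, Matrix.transpose_apply, hN, Matrix.diagonal_apply]
    rw [ee_apply] at this
    calc _ = ∑ x, eps p x * (A (ee i) x * A (ee j) x) := by
          refine Finset.sum_congr rfl fun k _ => by ring
      _ = _ := this
      _ = _ := by
          by_cases hij : i = j
          · subst hij; simp
          · simp [hij, Ne.symm hij]
  have hJ : J.det ≠ 0 := by
    simp only [J, Matrix.det_diagonal]
    exact Finset.prod_ne_zero_iff.2 fun i _ => eps_ne_zero p i
  have h2 := congrArg Matrix.det h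
  rw [Matrix.det_mul, Matrix.det_mul, Matrix.det_transpose] at h2
  have h3 : N.det = LinearMap.det (A : E d →ₗ[ℝ] E d) := LinearMap.det_toMatrix b _
  rw [← h3]
  have : (N.det ^ 2 - 1) * J.det = 0 := by linear_combination h2
  have := (mul_eq_zero.1 this).resolve_right hJ
  linarith

end Algebra


/-! ### Connections in charts -/

section Charts

variable {d : ℕ} {M : Type*} [TopologicalSpace M] [ChartedSpace (E d) M] [IsManifold (𝓡 d) ∞ M]
variable {φ φ' : OpenPartialHomeomorph M (E d)}

theorem mem_maximalAtlas_one (hφ : φ ∈ IsManifold.maximalAtlas (𝓡 d) ∞ M) :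
    φ ∈ IsManifold.maximalAtlas (𝓡 d) 1 M :=
  IsManifold.maximalAtlas_subset_of_le (by simp) hφ

theorem chart_mdifferentiable (hφ : φ ∈ IsManifold.maximalAtlas (𝓡 d) ∞ M) :
    φ.MDifferentiable (𝓡 d) (𝓡 d) :=
  ⟨fun _ hx => (mdifferentiableAt_of_mem_maximalAtlas (mem_maximalAtlas_one hφ)
      hx).mdifferentiableWithinAt,
    fun _ hx => (mdifferentiableAt_symm_of_mem_maximalAtlas (mem_maximalAtlas_one hφ)
      hx).mdifferentiableWithinAt⟩

theorem chart_isInvertible (hφ : φ ∈ IsManifold.maximalAtlas (𝓡 d) ∞ M) {x : M}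
    (hx : x ∈ φ.source) : (mfderiv (𝓡 d) (𝓡 d) φ x).IsInvertible :=
  ⟨(chart_mdifferentiable hφ).mfderiv hx, rfl⟩

theorem chart_symm_isInvertible (hφ : φ ∈ IsManifold.maximalAtlas (𝓡 d) ∞ M) {y : E d}
    (hy : y ∈ φ.target) : (mfderiv (𝓡 d) (𝓡 d) φ.symm y).IsInvertible :=
  ⟨(chart_mdifferentiable hφ).symm.mfderiv hy, rfl⟩

/-- The differential of a chart, with values in `E d`. -/
def chartD (φ : OpenPartialHomeomorph M (E d)) (x : M) : TangentSpace (𝓡 d) x →L[ℝ] E d :=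
  mfderiv (𝓡 d) (𝓡 d) φ x

/-- The vector field which is equal to `W` in the chart `φ`. -/
def pullField (φ : OpenPartialHomeomorph M (E d)) (W : E d → E d) (x : M) :
    TangentSpace (𝓡 d) x :=
  chartField φ (W (φ x)) x

theorem chartField_eq_inverse (v : E d) (x : M) :
    chartField φ v x = (chartD φ x).inverse v := rfl

theorem chartD_chartField (hφ : φ ∈ IsManifold.maximalAtlas (𝓡 d) ∞ M) {x : M}
    (hx : x ∈ φ.source) (v : E d) : chartD φ x (chartField φ v x) = v :=
  (chart_isInvertible hφ hx).self_apply_inverse v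

theorem chartField_chartD (hφ : φ ∈ IsManifold.maximalAtlas (𝓡 d) ∞ M) {x : M}
    (hx : x ∈ φ.source) (v : TangentSpace (𝓡 d) x) : chartField φ (chartD φ x v) x = v :=
  (chart_isInvertible hφ hx).inverse_apply_self v

theorem contMDiffAt_pullField (hφ : φ ∈ IsManifold.maximalAtlas (𝓡 d) ∞ M) {W : E d → E d}
    {x : M} (hx : x ∈ φ.source) (hW : ContDiffAt ℝ ∞ W (φ x)) :
    ContMDiffAt (𝓡 d) (𝓡 d).tangent ∞
      (fun y => (⟨y, pullField φ W y⟩ : TangentBundle (𝓡 d) M)) x := by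
  have h1 : ContMDiffAt (𝓡 d) (𝓡 d).tangent ∞
      (fun y => (⟨y, W y⟩ : TangentBundle (𝓡 d) (E d))) (φ x) :=
    contMDiffAt_vectorSpace_iff_contDiffAt.2 hW
  exact h1.mpullback_vectorField_preimage (contMDiffAt_of_mem_maximalAtlas hφ hx)
    (chart_isInvertible hφ hx) (by simp)

theorem chartD_eq_inverse_symm (hφ : φ ∈ IsManifold.maximalAtlas (𝓡 d) ∞ M) {y : E d}
    (hy : y ∈ φ.target) (v : TangentSpace (𝓡 d) (φ.symm y)) :
    chartD φ (φ.symm y) v = (mfderiv (𝓡 d) (𝓡 d) φ.symm y).inverse v := by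
  have h := (chart_mdifferentiable hφ).comp_symm_deriv hy
  obtain ⟨w, rfl⟩ : ∃ w, mfderiv (𝓡 d) (𝓡 d) φ.symm y w = v :=
    ((chart_mdifferentiable hφ).symm.mfderiv_surjective hy) v
  have h3 : chartD φ (φ.symm y) (mfderiv (𝓡 d) (𝓡 d) φ.symm y w) = w :=
    congrArg (fun L => L w) h
  rw [h3, (chart_symm_isInvertible hφ hy).inverse_apply_self]

theorem contDiffAt_chartD (hφ : φ ∈ IsManifold.maximalAtlas (𝓡 d) ∞ M)
    {X : Π x : M, TangentSpace (𝓡 d) x} {y : E d} (hy : y ∈ φ.target)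
    (hX : ContMDiffAt (𝓡 d) (𝓡 d).tangent ∞
      (fun x => (⟨x, X x⟩ : TangentBundle (𝓡 d) M)) (φ.symm y)) :
    ContDiffAt ℝ ∞ (fun z => chartD φ (φ.symm z) (X (φ.symm z))) y := by
  have h1 := hX.mpullback_vectorField_preimage (contMDiffAt_symm_of_mem_maximalAtlas hφ hy)
    (chart_symm_isInvertible hφ hy) (m := ∞) (by simp)
  have h2 := contMDiffAt_vectorSpace_iff_contDiffAt.1 h1
  refine h2.congr_of_eventuallyEq ?_
  filter_upwards [φ.open_target.mem_nhds hy] with z hz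
  exact chartD_eq_inverse_symm hφ hz _

/-- A bump function cuts the field off. Smoothness of the connection and the properties of volume
forms are tested on global fields, so coordinate fields must be extended before they can be used. -/
theorem exists_smooth_extension [T2Space M] (hφ : φ ∈ IsManifold.maximalAtlas (𝓡 d) ∞ M)
    {W : E d → E d} (hW : ContDiff ℝ ∞ W) {x : M} (hx : x ∈ φ.source) :
    ∃ X : Π x : M, TangentSpace (𝓡 d) x,
      ContMDiff (𝓡 d) (𝓡 d).tangent ∞ (fun x => (⟨x, X x⟩ : TangentBundle (𝓡 d) M)) ∧
      ∀ᶠ y in 𝓝 x, X y = pullField φ W y := by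
  obtain ⟨f, hf⟩ := (SmoothBumpFunction.nhds_basis_tsupport (I := 𝓡 d) x).mem_iff.1
    (φ.open_source.mem_nhds hx)
  refine ⟨fun y => f y • pullField φ W y, ?_, ?_⟩
  · intro y
    by_cases hy : y ∈ tsupport f
    · exact f.contMDiffAt.smul_section (contMDiffAt_pullField hφ (hf.2 hy) hW.contDiffAt)
    · have h0 : ∀ᶠ z in 𝓝 y, f z = 0 := by
        filter_upwards [(isClosed_tsupport f).isOpen_compl.mem_nhds hy] with z hz
        exact image_eq_zero_of_notMem_tsupport hz
      have := contMDiffAt_zeroSection ℝ (TangentSpace (𝓡 d) : M → Type _)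
        (IB := 𝓡 d) (F := E d) (n := ∞) (x := y)
      refine this.congr_of_eventuallyEq ?_
      filter_upwards [h0] with z hz
      simp [zeroSection, hz]
  · filter_upwards [f.eventuallyEq_one] with y hy
    simp [hy]

/-- The Christoffel symbol at the image of a point. -/
theorem christoffel_apply (conn : Connection d M) {x : M} (hx : x ∈ φ.source) (u v : E d) :
    christoffel conn φ (φ x) u v = chartD φ x (conn (chartField φ v) x (chartField φ u x)) := by
  let F : M → E d := fun x => chartD φ x (conn (chartField φ v) x (chartField φ u x))
  exact congrArg F (φ.left_inv hx)

end Charts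
section Charts2

variable {d : ℕ} {M : Type*} [TopologicalSpace M] [ChartedSpace (E d) M] [IsManifold (𝓡 d) ∞ M]
variable {φ φ' : OpenPartialHomeomorph M (E d)}

/-- Differentiability is carried along in the induction because additivity of the connection
requires it of the partial sum. -/
theorem conn_sum_smul (conn : Connection d M) {ι : Type*} (s : Finset ι)
    (σ : ι → Π x : M, TangentSpace (𝓡 d) x) (g : ι → M → ℝ) (x : M)
    (hσ : ∀ i, MDifferentiableAt (𝓡 d) (𝓡 d).tangent
      (fun y => (⟨y, σ i y⟩ : TangentBundle (𝓡 d) M)) x)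
    (hg : ∀ i, MDifferentiableAt (𝓡 d) 𝓘(ℝ, ℝ) (g i) x) (w : TangentSpace (𝓡 d) x) :
    MDifferentiableAt (𝓡 d) (𝓡 d).tangent
      (fun y => (⟨y, ∑ i ∈ s, g i y • σ i y⟩ : TangentBundle (𝓡 d) M)) x ∧
    conn (fun y => ∑ i ∈ s, g i y • σ i y) x w =
      ∑ i ∈ s, (g i x • conn (σ i) x w + mvfderiv (𝓡 d) (g i) x w • σ i x) := by
  classical
  induction s using Finset.induction_on with
  | empty =>
    refine ⟨?_, ?_⟩
    · simpa using! mdifferentiableAt_zeroSection (𝕜 := ℝ) (IB := 𝓡 d) (F := E d)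
        (E := (TangentSpace (𝓡 d) : M → Type _)) (x := x)
    · have h := conn.zero
      have : (fun y : M => ∑ i ∈ (∅ : Finset ι), g i y • σ i y) = 0 := by ext y; simp
      rw [this, h]; simp
  | insert i s hi ih =>
    have h1 : MDifferentiableAt (𝓡 d) (𝓡 d).tangent
      (fun y => (⟨y, g i y • σ i y⟩ : TangentBundle (𝓡 d) M)) x := (hg i).smul_section (hσ i)
    have e : (fun y => ∑ j ∈ insert i s, g j y • σ j y) =
        g i • σ i + fun y => ∑ j ∈ s, g j y • σ j y := by
      ext y; simp [Finset.sum_insert hi]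
    refine ⟨?_, ?_⟩
    · have := mdifferentiableAt_add_section h1 ih.1
      refine this.congr_of_eventuallyEq (Eventually.of_forall fun y => ?_)
      simp [Finset.sum_insert hi]
    · have h2 := conn.isCovariantDerivativeOnUniv.add (σ := g i • σ i) h1 ih.1
      rw [e, h2, conn.isCovariantDerivativeOnUniv.leibniz (hσ i) (hg i), Finset.sum_insert hi,
        ← ih.2]
      rfl

theorem mdifferentiableAt_chart (hφ : φ ∈ IsManifold.maximalAtlas (𝓡 d) ∞ M) {x : M}
    (hx : x ∈ φ.source) : MDifferentiableAt (𝓡 d) (𝓡 d) φ x :=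
  mdifferentiableAt_of_mem_maximalAtlas (mem_maximalAtlas_one hφ) hx

theorem mvfderiv_comp_chart (hφ : φ ∈ IsManifold.maximalAtlas (𝓡 d) ∞ M) {x : M}
    (hx : x ∈ φ.source) {f : E d → ℝ} (hf : DifferentiableAt ℝ f (φ x))
    (w : TangentSpace (𝓡 d) x) :
    MDifferentiableAt (𝓡 d) 𝓘(ℝ, ℝ) (fun y => f (φ y)) x ∧
    mvfderiv (𝓡 d) (fun y => f (φ y)) x w = fderiv ℝ f (φ x) (chartD φ x w) := by
  have h1 : HasMFDerivAt (𝓡 d) 𝓘(ℝ, ℝ) (fun y => f (φ y)) x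
      ((fderiv ℝ f (φ x)).comp (chartD φ x)) :=
    HasMFDerivAt.comp x (hf.hasFDerivAt.hasMFDerivAt) (mdifferentiableAt_chart hφ hx).hasMFDerivAt
  refine ⟨h1.mdifferentiableAt, ?_⟩
  rw [mvfderiv, h1.mfderiv]
  rfl

theorem mdifferentiableAt_pullField (hφ : φ ∈ IsManifold.maximalAtlas (𝓡 d) ∞ M)
    {W : E d → E d} {x : M} (hx : x ∈ φ.source) (hW : ContDiffAt ℝ ∞ W (φ x)) :
    MDifferentiableAt (𝓡 d) (𝓡 d).tangent
      (fun y => (⟨y, pullField φ W y⟩ : TangentBundle (𝓡 d) M)) x :=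
  (contMDiffAt_pullField hφ hx hW).mdifferentiableAt (by simp)

theorem mdifferentiableAt_chartField (hφ : φ ∈ IsManifold.maximalAtlas (𝓡 d) ∞ M)
    {x : M} (hx : x ∈ φ.source) (v : E d) :
    MDifferentiableAt (𝓡 d) (𝓡 d).tangent
      (fun y => (⟨y, chartField φ v y⟩ : TangentBundle (𝓡 d) M)) x :=
  mdifferentiableAt_pullField (W := fun _ => v) hφ hx contDiffAt_const

theorem chartField_sum (x : M) {ι : Type*} (s : Finset ι) (c : ι → ℝ) (v : ι → E d) :
    chartField φ (∑ i ∈ s, c i • v i) x = ∑ i ∈ s, c i • chartField φ (v i) x := by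
  simp only [chartField_eq_inverse, map_sum, map_smul]

theorem chartD_conn_pullField_sum (conn : Connection d M)
    (hφ : φ ∈ IsManifold.maximalAtlas (𝓡 d) ∞ M) {W : E d → E d} {x : M} (hx : x ∈ φ.source)
    (hW : DifferentiableAt ℝ W (φ x)) (w : TangentSpace (𝓡 d) x) :
    chartD φ x (conn (pullField φ W) x w) = fderiv ℝ W (φ x) (chartD φ x w) +
      ∑ i, W (φ x) i • chartD φ x (conn (chartField φ (ee i)) x w) := by
  have e : pullField φ W = fun y => ∑ i, W (φ y) i • chartField φ (ee i) y := by
    ext1 y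
    rw [pullField]
    conv_lhs => rw [sum_coord (W (φ y))]
    rw [chartField_sum]
  have hWi : ∀ i, HasFDerivAt (fun y => W y i)
      ((EuclideanSpace.proj i : E d →L[ℝ] ℝ).comp (fderiv ℝ W (φ x))) (φ x) := fun i =>
    (EuclideanSpace.proj i : E d →L[ℝ] ℝ).hasFDerivAt.comp (φ x) hW.hasFDerivAt
  rw [e, (conn_sum_smul conn Finset.univ (fun i => chartField φ (ee i)) (fun i y => W (φ y) i) x
    (fun i => mdifferentiableAt_chartField hφ hx _)
    (fun i => (mvfderiv_comp_chart hφ hx (hWi i).differentiableAt w).1) w).2]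
  simp only [map_sum, map_add, map_smul, Finset.sum_add_distrib]
  rw [add_comm]
  congr 1
  conv_rhs => rw [sum_coord (fderiv ℝ W (φ x) (chartD φ x w))]
  refine Finset.sum_congr rfl fun i _ => ?_
  rw [(mvfderiv_comp_chart hφ hx (hWi i).differentiableAt w).2, chartD_chartField hφ hx,
    (hWi i).fderiv]
  rfl

theorem chartD_conn_chartField_sum (conn : Connection d M)
    (hφ : φ ∈ IsManifold.maximalAtlas (𝓡 d) ∞ M) {x : M} (hx : x ∈ φ.source) (v : E d)
    (w : TangentSpace (𝓡 d) x) :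
    chartD φ x (conn (chartField φ v) x w) =
      ∑ i, v i • chartD φ x (conn (chartField φ (ee i)) x w) := by
  have h := chartD_conn_pullField_sum conn hφ (W := fun _ => v) hx (differentiableAt_const v) w
  rw [fderiv_const_apply, zero_apply, zero_add] at h
  exact h

/-- The expression of `∇_u W` in a chart. -/
theorem chartD_conn_pullField (conn : Connection d M)
    (hφ : φ ∈ IsManifold.maximalAtlas (𝓡 d) ∞ M) {W : E d → E d} {x : M} (hx : x ∈ φ.source)
    (hW : DifferentiableAt ℝ W (φ x)) (w : TangentSpace (𝓡 d) x) :
    chartD φ x (conn (pullField φ W) x w) = fderiv ℝ W (φ x) (chartD φ x w) +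
      christoffel conn φ (φ x) (chartD φ x w) (W (φ x)) := by
  rw [chartD_conn_pullField_sum conn hφ hx hW, christoffel_apply conn hx, chartField_chartD hφ hx,
    chartD_conn_chartField_sum conn hφ hx]

/-- The Christoffel symbol as a bilinear map. -/
@[irreducible] def christoffelMap (conn : Connection d M) (φ : OpenPartialHomeomorph M (E d)) (y : E d) :
    E d →L[ℝ] E d →L[ℝ] E d :=
  ∑ i, ∑ j, (EuclideanSpace.proj i : E d →L[ℝ] ℝ).smulRight
    ((EuclideanSpace.proj j : E d →L[ℝ] ℝ).smulRight (christoffel conn φ y (ee i) (ee j)))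

/-- Linearity in `u` is built into a covariant derivative; linearity in `v` is the Leibniz rule with
constant coefficients. -/
theorem christoffelMap_apply (conn : Connection d M)
    (hφ : φ ∈ IsManifold.maximalAtlas (𝓡 d) ∞ M) {y : E d} (hy : y ∈ φ.target) (u v : E d) :
    christoffelMap conn φ y u v = christoffel conn φ y u v := by
  have hx := φ.map_target hy
  have h := christoffel_apply conn hx (φ := φ)
  rw [φ.right_inv hy] at h
  simp only [christoffelMap, sum_apply, ContinuousLinearMap.smulRight_apply, smul_apply]
  rw [h, chartD_conn_chartField_sum conn hφ hx]
  rw [sum_coord u, chartField_sum, Finset.sum_comm]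
  refine Finset.sum_congr rfl fun j _ => ?_
  rw [map_sum, map_sum, Finset.smul_sum]
  refine Finset.sum_congr rfl fun i _ => ?_
  rw [map_smul, map_smul, h, ← sum_coord u, smul_comm]
  rfl

theorem eventually_mem_source (φ : OpenPartialHomeomorph M (E d)) {y : E d} (hy : y ∈ φ.target) :
    ∀ᶠ z in 𝓝 y, z ∈ φ.target := φ.open_target.mem_nhds hy

theorem contDiffAt_christoffel [T2Space M] (conn : Connection d M)
    (hc : CovariantDerivative.ContMDiffCovariantDerivative conn ∞)
    (hφ : φ ∈ IsManifold.maximalAtlas (𝓡 d) ∞ M) {y : E d} (hy : y ∈ φ.target) (u v : E d) :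
    ContDiffAt ℝ ∞ (fun z => christoffel conn φ z u v) y := by
  have hx := φ.map_target hy
  obtain ⟨X, hX, hXe⟩ := exists_smooth_extension hφ (W := fun _ => v) contDiff_const hx
  have h1 := hc.contMDiff.contMDiff (σ := X) (by simpa using hX.contMDiffOn)
  have h2 := (h1.contMDiffAt (x := φ.symm y) univ_mem)
  have h3 : ContMDiffAt (𝓡 d) (𝓡 d).tangent ∞
      (fun x => (⟨x, chartField φ u x⟩ : TangentBundle (𝓡 d) M)) (φ.symm y) :=
    contMDiffAt_pullField (W := fun _ => u) hφ hx contDiffAt_const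
  have h4 := h2.clm_bundle_apply h3
  refine (contDiffAt_chartD hφ hy h4).congr_of_eventuallyEq ?_
  have hcont : Tendsto φ.symm (𝓝 y) (𝓝 (φ.symm y)) := φ.continuousAt_symm hy
  filter_upwards [hcont.eventually hXe.eventually_nhds, eventually_mem_source φ hy] with z hz hzt
  have hxz := φ.map_target hzt
  -- Locality of the connection: the global extension agrees with the coordinate field near the
  -- point.
  have : conn X (φ.symm z) = conn (chartField φ v) (φ.symm z) :=
    conn.isCovariantDerivativeOnUniv.congr_of_eventuallyEq
      ((hX.contMDiffAt).mdifferentiableAt (by simp))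
      (mdifferentiableAt_chartField hφ hxz v) univ_mem hz
  show christoffel conn φ z u v = chartD φ (φ.symm z) (conn X (φ.symm z) _)
  rw [this]
  rfl

theorem contDiffAt_christoffelMap [T2Space M] (conn : Connection d M)
    (hc : CovariantDerivative.ContMDiffCovariantDerivative conn ∞)
    (hφ : φ ∈ IsManifold.maximalAtlas (𝓡 d) ∞ M) {y : E d} (hy : y ∈ φ.target) :
    ContDiffAt ℝ ∞ (christoffelMap conn φ) y := by
  unfold christoffelMap
  refine ContDiffAt.sum fun i _ => ContDiffAt.sum fun j _ => ?_
  exact contDiffAt_const.smulRight (contDiffAt_const.smulRight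
    (contDiffAt_christoffel conn hc hφ hy _ _))

/-! ### Changes of charts -/

/-- The change of charts. -/
def trn (φ φ' : OpenPartialHomeomorph M (E d)) (z : E d) : E d := φ' (φ.symm z)

theorem contDiffAt_trn (hφ : φ ∈ IsManifold.maximalAtlas (𝓡 d) ∞ M)
    (hφ' : φ' ∈ IsManifold.maximalAtlas (𝓡 d) ∞ M) {x : M} (hx : x ∈ φ.source)
    (hx' : x ∈ φ'.source) : ContDiffAt ℝ ∞ (trn φ φ') (φ x) := by
  have h1 := contMDiffAt_symm_of_mem_maximalAtlas hφ (φ.map_source hx)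
  have h2 : ContMDiffAt (𝓡 d) (𝓡 d) ∞ φ' (φ.symm (φ x)) := by
    rw [φ.left_inv hx]; exact contMDiffAt_of_mem_maximalAtlas hφ' hx'
  exact (h2.comp (φ x) h1).contDiffAt

theorem chartD_trn (hφ : φ ∈ IsManifold.maximalAtlas (𝓡 d) ∞ M)
    (hφ' : φ' ∈ IsManifold.maximalAtlas (𝓡 d) ∞ M) {x : M} (hx : x ∈ φ.source)
    (hx' : x ∈ φ'.source) (w : TangentSpace (𝓡 d) x) :
    chartD φ' x w = fderiv ℝ (trn φ φ') (φ x) (chartD φ x w) := by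
  have h1 : HasMFDerivAt (𝓡 d) (𝓡 d) (fun y => trn φ φ' (φ y)) x
      ((fderiv ℝ (trn φ φ') (φ x)).comp (chartD φ x)) :=
    HasMFDerivAt.comp (g := trn φ φ') (f := φ) x
      (((contDiffAt_trn hφ hφ' hx hx').differentiableAt (by simp)).hasFDerivAt.hasMFDerivAt)
      (mdifferentiableAt_chart hφ hx).hasMFDerivAt
  have h2 : φ' =ᶠ[𝓝 x] fun y => trn φ φ' (φ y) := by
    filter_upwards [φ.open_source.mem_nhds hx] with y hy
    rw [trn, φ.left_inv hy]
  have h3 := (h1.congr_of_eventuallyEq h2).mfderiv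
  exact congrArg (fun L => L w) h3

theorem trn_isInvertible (hφ : φ ∈ IsManifold.maximalAtlas (𝓡 d) ∞ M)
    (hφ' : φ' ∈ IsManifold.maximalAtlas (𝓡 d) ∞ M) {x : M} (hx : x ∈ φ.source)
    (hx' : x ∈ φ'.source) : (fderiv ℝ (trn φ φ') (φ x)).IsInvertible := by
  obtain ⟨e, he⟩ := chart_isInvertible hφ hx
  obtain ⟨e', he'⟩ := chart_isInvertible hφ' hx'
  refine ⟨e.symm.trans e', ?_⟩
  ext1 w
  have h1 : chartD φ' x (e.symm w) = _ := chartD_trn hφ hφ' hx hx' (e.symm w)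
  have h2 : chartD φ x (e.symm w) = w := by
    show mfderiv (𝓡 d) (𝓡 d) φ x (e.symm w) = w
    rw [← he]; exact e.apply_symm_apply w
  rw [h2] at h1
  rw [← h1]
  show e' (e.symm w) = mfderiv (𝓡 d) (𝓡 d) φ' x (e.symm w)
  rw [← he']; rfl

theorem chartField_trn (hφ : φ ∈ IsManifold.maximalAtlas (𝓡 d) ∞ M)
    (hφ' : φ' ∈ IsManifold.maximalAtlas (𝓡 d) ∞ M) {x : M} (hx : x ∈ φ.source)
    (hx' : x ∈ φ'.source) (v : E d) :
    chartField φ' (fderiv ℝ (trn φ φ') (φ x) v) x = chartField φ v x := by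
  have := chartD_trn hφ hφ' hx hx' (chartField φ v x)
  rw [chartD_chartField hφ hx] at this
  rw [← this, chartField_chartD hφ' hx']

/-- Transformation of the Christoffel symbols under a change of charts. -/
theorem christoffel_trn (conn : Connection d M) (hφ : φ ∈ IsManifold.maximalAtlas (𝓡 d) ∞ M)
    (hφ' : φ' ∈ IsManifold.maximalAtlas (𝓡 d) ∞ M) {x : M} (hx : x ∈ φ.source)
    (hx' : x ∈ φ'.source) (u v : E d) :
    christoffel conn φ' (φ' x) (fderiv ℝ (trn φ φ') (φ x) u) (fderiv ℝ (trn φ φ') (φ x) v) =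
      fderiv ℝ (trn φ φ') (φ x) (christoffel conn φ (φ x) u v) -
        fderiv ℝ (fderiv ℝ (trn φ φ')) (φ x) u v := by
  set τ := trn φ φ' with hτ
  set T := fderiv ℝ τ (φ x) with hT
  have hτs : ContDiffAt ℝ ∞ τ (φ x) := contDiffAt_trn hφ hφ' hx hx'
  have hDτ : ContDiffAt ℝ ∞ (fderiv ℝ τ) (φ x) := hτs.fderiv_right (by simp)
  have hinv : T.IsInvertible := trn_isInvertible hφ hφ' hx hx'
  -- `W` is the expression in the chart `φ` of the field that is constant, equal to `T v`, in the
  -- chart `φ'`.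
  let W : E d → E d := fun z => (fderiv ℝ τ z).inverse (T v)
  have hWs : ContDiffAt ℝ ∞ W (φ x) := by
    obtain ⟨e, he⟩ := hinv
    have h1 : ContDiffAt ℝ ∞ (ContinuousLinearMap.inverse : (E d →L[ℝ] E d) → _)
        (fderiv ℝ τ (φ x)) := by
      rw [← hT, ← he]; exact contDiffAt_map_inverse e
    exact (h1.comp (φ x) hDτ).clm_apply contDiffAt_const
  have hWx : W (φ x) = v := hinv.inverse_apply_self v
  have hev : ∀ᶠ y in 𝓝 x, y ∈ φ.source ∧ y ∈ φ'.source :=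
    inter_mem (φ.open_source.mem_nhds hx) (φ'.open_source.mem_nhds hx')
  have hfield : ∀ᶠ y in 𝓝 x, chartField φ' (T v) y = pullField φ W y := by
    filter_upwards [hev] with y hy
    rw [pullField, ← chartField_trn hφ hφ' hy.1 hy.2]
    congr 1
    exact ((trn_isInvertible hφ hφ' hy.1 hy.2).self_apply_inverse _).symm
  -- Differentiating `Dτ(W) = T v`, whose right side is constant, produces the second-derivative
  -- term of the law.
  have hDW : T (fderiv ℝ W (φ x) u) = - fderiv ℝ (fderiv ℝ τ) (φ x) u v := by
    have h1 : (fun z => fderiv ℝ τ z (W z)) =ᶠ[𝓝 (φ x)] fun _ => T v := by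
      have hs : Tendsto φ.symm (𝓝 (φ x)) (𝓝 x) := by
        have := φ.continuousAt_symm (φ.map_source hx)
        rwa [ContinuousAt, φ.left_inv hx] at this
      filter_upwards [hs.eventually hev, φ.open_target.mem_nhds (φ.map_source hx)] with z hz hzt
      have := (trn_isInvertible hφ hφ' hz.1 hz.2).self_apply_inverse (T v)
      rwa [φ.right_inv hzt] at this
    have h2 := ((hDτ.differentiableAt (by simp)).hasFDerivAt.clm_apply
      (hWs.differentiableAt (by simp)).hasFDerivAt)
    have h3 := h2.unique ((hasFDerivAt_const (T v) (φ x)).congr_of_eventuallyEq h1)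
    have h4 := congrArg (fun L => L u) h3
    simp only [add_apply, ContinuousLinearMap.comp_apply, ContinuousLinearMap.flip_apply,
      zero_apply, hWx] at h4
    exact eq_neg_of_add_eq_zero_left h4
  rw [christoffel_apply conn hx', chartField_trn hφ hφ' hx hx',
    conn.isCovariantDerivativeOnUniv.congr_of_eventuallyEq
      (mdifferentiableAt_chartField hφ' hx' _) (mdifferentiableAt_pullField hφ hx hWs) univ_mem
      hfield, chartD_trn hφ hφ' hx hx',
    chartD_conn_pullField conn hφ hx (hWs.differentiableAt (by simp)), chartD_chartField hφ hx,
    map_add, hWx, hDW]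
  abel

end Charts2

theorem two_le_infty : (2 : WithTop ℕ∞) ≤ ∞ := WithTop.coe_le_coe.2 le_top

/-! ### Tensoriality of the curvature -/

section CurvCoord
variable {V : Type*} [NormedAddCommGroup V] [NormedSpace ℝ V]

/-- The curvature of a field of bilinear maps, viewed as Christoffel symbols. -/
def curvCoord (G : V → V →L[ℝ] V →L[ℝ] V) (y u v w : V) : V :=
  fderiv ℝ G y u v w - fderiv ℝ G y v u w + G y u (G y v w) - G y v (G y u w)

theorem deriv_comp_curve {τ : V → V} {x x' : ℝ → V} {x'' : V} {t : ℝ}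
    (hτ : ContDiffAt ℝ ∞ τ (x t)) (hx : ∀ᶠ s in 𝓝 t, HasDerivAt x (x' s) s)
    (hx' : HasDerivAt x' x'' t) :
    deriv (fun s => τ (x s)) t = fderiv ℝ τ (x t) (x' t) ∧
    deriv (deriv fun s => τ (x s)) t =
      fderiv ℝ (fderiv ℝ τ) (x t) (x' t) (x' t) + fderiv ℝ τ (x t) x'' := by
  have hτ1 : ∀ᶠ z in 𝓝 (x t), DifferentiableAt ℝ τ z := by
    filter_upwards [(hτ.of_le (m := 1) (by simp)).eventually (by simp)] with z hz
    exact hz.differentiableAt (by simp)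
  have h1 : deriv (fun s => τ (x s)) =ᶠ[𝓝 t] fun s => fderiv ℝ τ (x s) (x' s) := by
    filter_upwards [hx, hx.self_of_nhds.continuousAt.eventually hτ1] with s hs hs'
    exact (hs'.hasFDerivAt.comp_hasDerivAt s hs).deriv
  refine ⟨h1.eq_of_nhds, ?_⟩
  have hDτ : HasFDerivAt (fderiv ℝ τ) (fderiv ℝ (fderiv ℝ τ) (x t)) (x t) :=
    ((hτ.fderiv_right (m := ∞) (by simp)).differentiableAt (by simp)).hasFDerivAt
  have h2 : HasDerivAt (fun s => fderiv ℝ τ (x s)) _ t :=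
    hDτ.comp_hasDerivAt t hx.self_of_nhds
  rw [h1.deriv_eq, (h2.clm_apply hx').deriv]

set_option synthInstance.maxHeartbeats 200000 in
/-- If two fields of bilinear maps are related by the transformation law of Christoffel symbols,
then their curvatures are related by the transformation law of tensors. -/
theorem curvCoord_transform {G G' : V → V →L[ℝ] V →L[ℝ] V} {τ : V → V} {y : V}
    (hτs : ContDiffAt ℝ ∞ τ y) (hGd : DifferentiableAt ℝ G y)
    (hGd' : DifferentiableAt ℝ G' (τ y))
    (law : ∀ v w, (fun z => G' (τ z) (fderiv ℝ τ z v) (fderiv ℝ τ z w)) =ᶠ[𝓝 y]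
      fun z => fderiv ℝ τ z (G z v w) - fderiv ℝ (fderiv ℝ τ) z v w) (u v w : V) :
    curvCoord G' (τ y) (fderiv ℝ τ y u) (fderiv ℝ τ y v) (fderiv ℝ τ y w) =
      fderiv ℝ τ y (curvCoord G y u v w) := by
  have hDτ : ContDiffAt ℝ ∞ (fderiv ℝ τ) y := hτs.fderiv_right (by simp)
  have hD2τ : ContDiffAt ℝ ∞ (fderiv ℝ (fderiv ℝ τ)) y := hDτ.fderiv_right (by simp)
  have hDτd := (hDτ.differentiableAt (by simp)).hasFDerivAt
  have hD2τd := (hD2τ.differentiableAt (by simp)).hasFDerivAt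
  -- The transformation law differentiated in the direction `u`.
  have dlaw : ∀ u v w, (fderiv ℝ G' (τ y) (fderiv ℝ τ y u)) (fderiv ℝ τ y v)
        (fderiv ℝ τ y w)
      + G' (τ y) (fderiv ℝ (fderiv ℝ τ) y u v) (fderiv ℝ τ y w)
      + G' (τ y) (fderiv ℝ τ y v) (fderiv ℝ (fderiv ℝ τ) y u w)
      = fderiv ℝ (fderiv ℝ τ) y u (G y v w)
        + fderiv ℝ τ y (fderiv ℝ G y u v w)
        - fderiv ℝ (fderiv ℝ (fderiv ℝ τ)) y u v w := by
    intro u v w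
    have hcv := hasFDerivAt_const (𝕜 := ℝ) v y
    have hcw := hasFDerivAt_const (𝕜 := ℝ) w y
    have h0 : HasFDerivAt (fun z => G' (τ z)) ((fderiv ℝ G' (τ y)).comp (fderiv ℝ τ y)) y :=
      HasFDerivAt.comp (g := G') (f := τ) y hGd'.hasFDerivAt
        (hτs.differentiableAt (by simp)).hasFDerivAt
    have h1 := (h0.clm_apply
      (hDτd.clm_apply hcv)).clm_apply (hDτd.clm_apply hcw)
    have h2 := (hDτd.clm_apply ((hGd.hasFDerivAt.clm_apply hcv).clm_apply hcw)).sub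
      ((hD2τd.clm_apply hcv).clm_apply hcw)
    have h3 := congrArg (fun L => L u) (h1.unique (h2.congr_of_eventuallyEq (law v w)))
    simp only [add_apply, sub_apply, ContinuousLinearMap.comp_apply,
      ContinuousLinearMap.flip_apply, zero_apply, map_zero, zero_add] at h3
    have h4 : ∀ a b c a' b' c' : V, c + (b + a) = a' + b' - c' → a + b + c = b' + a' - c' := by
      intro a b c a' b' c' h
      rw [add_comm b' a', ← h]; abel
    exact h4 _ _ _ _ _ _ h3
  have law0 : ∀ v w, fderiv ℝ (fderiv ℝ τ) y v w = fderiv ℝ τ y (G y v w) -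
      G' (τ y) (fderiv ℝ τ y v) (fderiv ℝ τ y w) := by
    intro v w
    rw [(law v w).eq_of_nhds]; abel
  -- Antisymmetrising `dlaw` in `u, v` cancels the third derivatives of `τ`; the remaining second
  -- derivatives are eliminated through `law0`, which supplies the terms quadratic in the
  -- Christoffel symbols.
  have hsym2 : fderiv ℝ (fderiv ℝ τ) y u v = fderiv ℝ (fderiv ℝ τ) y v u :=
    (hτs.isSymmSndFDerivAt (by simpa using two_le_infty)) u v
  have hsym3 : fderiv ℝ (fderiv ℝ (fderiv ℝ τ)) y u v w =
      fderiv ℝ (fderiv ℝ (fderiv ℝ τ)) y v u w :=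
    congrArg (fun L => L w) ((hDτ.isSymmSndFDerivAt (by simpa using two_le_infty)) u v)
  have e1 := dlaw u v w
  have e2 := dlaw v u w
  rw [← hsym2, ← hsym3] at e2
  rw [law0 v w, law0 v (G y u w)] at e2
  rw [law0 u w, law0 u (G y v w)] at e1
  simp only [map_sub] at e1 e2
  simp only [curvCoord, map_add, map_sub]
  have e3 := congrArg₂ (· - ·) e1 e2
  rw [← sub_eq_zero] at e3 ⊢
  rw [← e3]
  abel

end CurvCoord

section CurvatureSection

variable {d : ℕ} {M : Type*} [TopologicalSpace M] [ChartedSpace (E d) M] [IsManifold (𝓡 d) ∞ M]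
variable {φ φ' : OpenPartialHomeomorph M (E d)}

theorem hasFDerivAt_christoffelMap [T2Space M] (conn : Connection d M)
    (hc : CovariantDerivative.ContMDiffCovariantDerivative conn ∞)
    (hφ : φ ∈ IsManifold.maximalAtlas (𝓡 d) ∞ M) {y : E d} (hy : y ∈ φ.target) :
    DifferentiableAt ℝ (christoffelMap conn φ) y :=
  (contDiffAt_christoffelMap conn hc hφ hy).differentiableAt (by simp)

theorem curvature_eq_curvCoord [T2Space M] (conn : Connection d M)
    (hc : CovariantDerivative.ContMDiffCovariantDerivative conn ∞)
    (hφ : φ ∈ IsManifold.maximalAtlas (𝓡 d) ∞ M) {y : E d} (hy : y ∈ φ.target) (u v w : E d) :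
    curvature conn φ y u v w = curvCoord (christoffelMap conn φ) y u v w := by
  have key : ∀ v w, fderiv ℝ (fun z => christoffel conn φ z v w) y =
      fderiv ℝ (fun z => christoffelMap conn φ z v w) y := fun v w => by
    refine Filter.EventuallyEq.fderiv_eq ?_
    filter_upwards [eventually_mem_source φ hy] with z hz
    rw [christoffelMap_apply conn hφ hz]
  have hd := hasFDerivAt_christoffelMap conn hc hφ hy
  have key2 : ∀ u v w, fderiv ℝ (fun z => christoffelMap conn φ z v w) y u =
      fderiv ℝ (christoffelMap conn φ) y u v w := fun u v w => by
    have h := (hd.hasFDerivAt.clm_apply (hasFDerivAt_const v y)).clm_apply (hasFDerivAt_const w y)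
    rw [h.fderiv]
    simp
  simp only [curvature, curvCoord, key, key2, christoffelMap_apply conn hφ hy]

theorem trn_apply {x : M} (hx : x ∈ φ.source) : trn φ φ' (φ x) = φ' x := by
  rw [trn, φ.left_inv hx]

theorem tendsto_symm {x : M} (hx : x ∈ φ.source) : Tendsto φ.symm (𝓝 (φ x)) (𝓝 x) := by
  have := φ.continuousAt_symm (φ.map_source hx)
  rwa [ContinuousAt, φ.left_inv hx] at this

/-- The curvature is a tensor. -/
theorem curvature_trn [T2Space M] (conn : Connection d M)
    (hc : CovariantDerivative.ContMDiffCovariantDerivative conn ∞)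
    (hφ : φ ∈ IsManifold.maximalAtlas (𝓡 d) ∞ M)
    (hφ' : φ' ∈ IsManifold.maximalAtlas (𝓡 d) ∞ M) {x : M} (hx : x ∈ φ.source)
    (hx' : x ∈ φ'.source) (u v w : E d) :
    curvature conn φ' (φ' x) (fderiv ℝ (trn φ φ') (φ x) u) (fderiv ℝ (trn φ φ') (φ x) v)
        (fderiv ℝ (trn φ φ') (φ x) w) =
      fderiv ℝ (trn φ φ') (φ x) (curvature conn φ (φ x) u v w) := by
  have hy := φ.map_source hx
  have hy' := φ'.map_source hx'
  rw [curvature_eq_curvCoord conn hc hφ hy, curvature_eq_curvCoord conn hc hφ' hy',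
    ← trn_apply (φ' := φ') hx]
  refine curvCoord_transform (contDiffAt_trn hφ hφ' hx hx')
    (hasFDerivAt_christoffelMap conn hc hφ hy) ?_ ?_ u v w
  · rw [trn_apply hx]; exact hasFDerivAt_christoffelMap conn hc hφ' hy'
  · intro v w
    filter_upwards [tendsto_symm hx
      (inter_mem (φ.open_source.mem_nhds hx) (φ'.open_source.mem_nhds hx')),
      φ.open_target.mem_nhds hy] with z hz hzt
    have := christoffel_trn conn hφ hφ' hz.1 hz.2 v w
    rw [φ.right_inv hzt] at this
    rw [christoffelMap_apply conn hφ hzt, trn, christoffelMap_apply conn hφ' (φ'.map_source hz.2)]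
    exact this

/-! ### Geodesics -/

theorem geodesic_contDiffAt {conn : Connection d M} {γ : ℝ → M} {J : Set ℝ}
    (hγ : IsGeodesicOn conn γ J) (hJ : IsOpen J) (hφ : φ ∈ IsManifold.maximalAtlas (𝓡 d) ∞ M)
    {t : ℝ} (ht : t ∈ J) (htx : γ t ∈ φ.source) : ContDiffAt ℝ 2 (fun s => φ (γ s)) t := by
  have h1 := hγ.1.contMDiffAt (hJ.mem_nhds ht)
  have h2 := (contMDiffAt_of_mem_maximalAtlas hφ htx).of_le two_le_infty
  exact (h2.comp t h1).contDiffAt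

/-- Picard–Lindelöf for the first-order system `(x, w)' = (w, -Γ(w, w))` in one chart. The equation
in every other chart follows from the transformation law of `Γ` and the second-order chain rule. -/
theorem exists_geodesic [T2Space M] (conn : Connection d M)
    (hc : CovariantDerivative.ContMDiffCovariantDerivative conn ∞)
    (hφ : φ ∈ IsManifold.maximalAtlas (𝓡 d) ∞ M) {y : E d} (hy : y ∈ φ.target) (u : E d) :
    ∃ (ε : ℝ) (γ : ℝ → M), 0 < ε ∧ IsGeodesicOn conn γ (Ioo (-ε) ε) ∧
      MapsTo γ (Ioo (-ε) ε) φ.source ∧ φ (γ 0) = y ∧ deriv (fun s => φ (γ s)) 0 = u := by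
  let F : E d × E d → E d × E d := fun p => (p.2, -christoffelMap conn φ p.1 p.2 p.2)
  have hFs : ∀ p : E d × E d, p.1 ∈ φ.target → ContDiffAt ℝ 1 F p := by
    intro p hp
    have h0 : ContDiffAt ℝ 1 (christoffelMap conn φ) p.1 :=
      (contDiffAt_christoffelMap conn hc hφ hp).of_le (by simp)
    have h1 : ContDiffAt ℝ 1 (fun p : E d × E d => christoffelMap conn φ p.1) p :=
      ContDiffAt.comp p h0 contDiffAt_fst
    exact contDiffAt_snd.prodMk ((h1.clm_apply contDiffAt_snd).clm_apply contDiffAt_snd).neg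
  obtain ⟨α, hα0, ε₀, hε₀, hα⟩ :=
    (hFs (y, u) hy).exists_forall_mem_closedBall_exists_eq_forall_mem_Ioo_hasDerivAt₀ 0
  have hα0c : ContinuousAt (fun t => (α t).1) 0 :=
    (hα 0 (by simp [hε₀])).continuousAt.fst
  have hev : ∀ᶠ t in 𝓝 (0 : ℝ), (α t).1 ∈ φ.target := by
    refine hα0c.eventually_mem ?_
    rw [hα0]; exact φ.open_target.mem_nhds hy
  obtain ⟨ε₁, hε₁, hball⟩ := Metric.eventually_nhds_iff.1 hev
  set ε := min ε₀ ε₁ with hε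
  set J := Ioo (-ε) ε with hJ
  have hJo : IsOpen J := isOpen_Ioo
  have hεpos : 0 < ε := lt_min hε₀ hε₁
  have htar : ∀ t ∈ J, (α t).1 ∈ φ.target := fun t ht => by
    refine hball ?_
    rw [Real.dist_eq, sub_zero, abs_lt]
    exact ⟨by linarith [ht.1, min_le_right ε₀ ε₁], by linarith [ht.2, min_le_right ε₀ ε₁]⟩
  have hder : ∀ t ∈ J, HasDerivAt α (F (α t)) t := fun t ht => hα t
    ⟨by linarith [ht.1, min_le_left ε₀ ε₁], by linarith [ht.2, min_le_left ε₀ ε₁]⟩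
  have hx : ∀ t ∈ J, HasDerivAt (fun t => (α t).1) (α t).2 t := fun t ht => (hder t ht).fst
  have hw : ∀ t ∈ J, HasDerivAt (fun t => (α t).2)
      (-christoffelMap conn φ (α t).1 (α t).2 (α t).2) t := fun t ht => (hder t ht).snd
  -- Bootstrap: the solution `(x, w)` is `C¹`, so `x' = w` is `C¹` and `x` is `C²`.
  have hα1 : ContDiffOn ℝ 1 α J := by
    rw [show (1 : WithTop ℕ∞) = 0 + 1 from rfl, contDiffOn_succ_iff_deriv_of_isOpen hJo]
    refine ⟨fun t ht => (hder t ht).differentiableAt.differentiableWithinAt, by simp, ?_⟩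
    rw [contDiffOn_zero]
    refine ContinuousOn.congr (f := fun t => F (α t)) (fun t ht => ?_)
      (fun t ht => (hder t ht).deriv)
    exact ((hFs _ (htar t ht)).continuousAt.comp
      (hder t ht).continuousAt).continuousWithinAt
  have hx2 : ContDiffOn ℝ 2 (fun t => (α t).1) J := by
    rw [show (2 : WithTop ℕ∞) = 1 + 1 from by norm_num, contDiffOn_succ_iff_deriv_of_isOpen hJo]
    refine ⟨fun t ht => (hx t ht).differentiableAt.differentiableWithinAt, by simp, ?_⟩
    exact hα1.snd.congr fun t ht => (hx t ht).deriv
  refine ⟨ε, fun t => φ.symm (α t).1, hεpos, ⟨?_, ?_⟩, fun t ht => φ.map_target (htar t ht), ?_, ?_⟩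
  · intro t ht
    have h1 : ContMDiffAt 𝓘(ℝ, ℝ) (𝓡 d) 2 (fun t => (α t).1) t :=
      (hx2.contDiffAt (hJo.mem_nhds ht)).contMDiffAt
    exact (((contMDiffAt_symm_of_mem_maximalAtlas hφ (htar t ht)).of_le two_le_infty).comp t
      h1).contMDiffWithinAt
  · intro φ' hφ' t ht htx
    have hsrc := φ.map_target (htar t ht)
    have hφx : φ (φ.symm (α t).1) = (α t).1 := φ.right_inv (htar t ht)
    have hτ := contDiffAt_trn hφ hφ' hsrc htx
    rw [hφx] at hτ
    have hxev : ∀ᶠ s in 𝓝 t, HasDerivAt (fun t => (α t).1) (α s).2 s := by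
      filter_upwards [hJo.mem_nhds ht] with s hs using hx s hs
    obtain ⟨e1, e2⟩ := deriv_comp_curve (x := fun t => (α t).1) hτ hxev (hw t ht)
    have hlaw := christoffel_trn conn hφ hφ' hsrc htx (α t).2 (α t).2
    rw [hφx] at hlaw
    show deriv (deriv fun s => trn φ φ' (α s).1) t = -christoffel conn φ' _
      (deriv (fun s => trn φ φ' (α s).1) t) (deriv (fun s => trn φ φ' (α s).1) t)
    rw [e1, e2, hlaw, christoffelMap_apply conn hφ (htar t ht), map_neg]
    abel
  · show φ (φ.symm (α 0).1) = y
    rw [hα0]; exact φ.right_inv hy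
  · have h0 : (0 : ℝ) ∈ J := ⟨by linarith, hεpos⟩
    have : (fun s => φ (φ.symm (α s).1)) =ᶠ[𝓝 0] fun s => (α s).1 := by
      filter_upwards [hJo.mem_nhds h0] with s hs using φ.right_inv (htar s hs)
    rw [this.deriv_eq, (hx 0 h0).deriv, hα0]

end CurvatureSection

set_option synthInstance.maxHeartbeats 200000

/-! ### The local potential -/

section Local
variable {d : ℕ} {p : ℕ}

/-- A linear form `a` with `Da = a ⊗ a + b q` on an open set. -/
structure IsProjData (p : ℕ) (a : E d → E d →L[ℝ] ℝ) (b : E d → ℝ) (U : Set (E d)) : Prop where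
  isOpen : IsOpen U
  smooth : ∀ y ∈ U, ContDiffAt ℝ ∞ a y
  eqn : ∀ y ∈ U, ∀ u w, fderiv ℝ a y u w = a y u * a y w + b y * sprod p u w

variable {a : E d → E d →L[ℝ] ℝ} {b : E d → ℝ} {U : Set (E d)}

/-- No regularity of `b` is assumed; solving the equation for `b` lets it inherit differentiability
from `a`. -/
theorem IsProjData.b_eq (h : IsProjData p a b U) (i : Fin d) {y : E d} (hy : y ∈ U) :
    b y = eps p i * (fderiv ℝ a y (ee i) (ee i) - a y (ee i) * a y (ee i)) := by
  rw [h.eqn y hy, sprod_ee]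
  simp only [ee_apply, if_true]
  have := eps_mul_self p i
  linear_combination (-b y) * this

theorem IsProjData.differentiableAt_b (hd : 2 ≤ d) (h : IsProjData p a b U) {y : E d}
    (hy : y ∈ U) : DifferentiableAt ℝ b y := by
  let i : Fin d := ⟨0, by omega⟩
  have hDa : DifferentiableAt ℝ (fderiv ℝ a) y :=
    ((h.smooth y hy).fderiv_right (m := ∞) (by simp)).differentiableAt (by simp)
  have ha := (h.smooth y hy).differentiableAt (by simp)
  have h1 : DifferentiableAt ℝ (fun y => eps p i *
      (fderiv ℝ a y (ee i) (ee i) - a y (ee i) * a y (ee i))) y := by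
    have hc := differentiableAt_const (𝕜 := ℝ) (x := y) (ee i)
    exact (((hDa.clm_apply hc).clm_apply hc).sub
      ((ha.clm_apply hc).mul (ha.clm_apply hc))).const_mul _
  refine h1.congr_of_eventuallyEq ?_
  filter_upwards [h.isOpen.mem_nhds hy] with z hz using h.b_eq i hz

/-- Differentiate `Da = a⊗a + b q` and use the symmetry of `D²a`: the quantity `(db - b a)(v)
q(u,w)` is symmetric in `u, v`. Taking `v = e_i` and `u = w = e_j` with `j ≠ i` kills one side,
which needs two indices. -/
theorem IsProjData.fderiv_b (hd : 2 ≤ d) (h : IsProjData p a b U) {y : E d}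
    (hy : y ∈ U) (v : E d) : fderiv ℝ b y v = b y * a y v := by
  have hDa : HasFDerivAt (fderiv ℝ a) (fderiv ℝ (fderiv ℝ a) y) y :=
    (((h.smooth y hy).fderiv_right (m := ∞) (by simp)).differentiableAt (by simp)).hasFDerivAt
  have ha := ((h.smooth y hy).differentiableAt (by simp)).hasFDerivAt
  have hb := (h.differentiableAt_b hd hy).hasFDerivAt
  have key : ∀ v u w, fderiv ℝ (fderiv ℝ a) y v u w =
      (fderiv ℝ a y v u * a y w + a y u * fderiv ℝ a y v w) + fderiv ℝ b y v * sprod p u w := by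
    intro v u w
    have hcu := hasFDerivAt_const (𝕜 := ℝ) u y
    have hcw := hasFDerivAt_const (𝕜 := ℝ) w y
    have h1 := (hDa.clm_apply hcu).clm_apply hcw
    have h2 := ((ha.clm_apply hcu).mul (ha.clm_apply hcw)).add (hb.mul_const (sprod p u w))
    have e : (fun z => fderiv ℝ a z u w) =ᶠ[𝓝 y]
        fun z => a z u * a z w + b z * sprod p u w := by
      filter_upwards [h.isOpen.mem_nhds hy] with z hz using h.eqn z hz u w
    have h3 := congrArg (fun L => L v) (h1.unique (h2.congr_of_eventuallyEq e))
    simp at h3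
    linarith
  have hsym : ∀ u v w, fderiv ℝ (fderiv ℝ a) y u v w = fderiv ℝ (fderiv ℝ a) y v u w :=
    fun u v w => congrArg (fun L => L w)
      (((h.smooth y hy).isSymmSndFDerivAt (by simpa using two_le_infty)) u v)
  have main : ∀ i j : Fin d, i ≠ j → fderiv ℝ b y (ee i) = b y * a y (ee i) := by
    intro i j hij
    have h1 := hsym (ee i) (ee j) (ee j)
    rw [key, key] at h1
    simp only [h.eqn y hy, sprod_ee, ee_apply, if_true, if_neg hij, if_neg hij.symm, mul_one,
      mul_zero, add_zero] at h1
    have h2 : (fderiv ℝ b y (ee i) - b y * a y (ee i)) * eps p j = 0 := by linear_combination h1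
    have := (mul_eq_zero.1 h2).resolve_right (eps_ne_zero p j)
    linarith
  have hne : ∀ i : Fin d, ∃ j, i ≠ j := by
    intro i
    by_cases hi : i.val = 0
    · exact ⟨⟨1, by omega⟩, fun hh => by rw [hh] at hi; simp at hi⟩
    · exact ⟨⟨0, by omega⟩, fun hh => by rw [hh] at hi; simp at hi⟩
  rw [sum_coord v]
  simp only [map_sum, map_smul, smul_eq_mul, Finset.mul_sum]
  refine Finset.sum_congr rfl fun i _ => ?_
  obtain ⟨j, hj⟩ := hne i
  rw [main i j hj]; ring

/-- The local potential with prescribed data at `y₀`. -/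
def locPot (p : ℕ) (α : E d →L[ℝ] ℝ) (β : ℝ) (y₀ y : E d) : ℝ :=
  1 - α (y - y₀) - β / 2 * q p (y - y₀)

theorem hasFDerivAt_locPot (α : E d →L[ℝ] ℝ) (β : ℝ) (y₀ y : E d) :
    HasFDerivAt (locPot p α β y₀) (-α - β • sform p (y - y₀)) y := by
  have h0 : HasFDerivAt (fun y : E d => y - y₀) (ContinuousLinearMap.id ℝ (E d)) y :=
    (hasFDerivAt_id y).sub_const y₀
  have h1 := (α.hasFDerivAt (x := y - y₀)).comp y h0
  have h2 := ((hasFDerivAt_q p (y - y₀)).comp y h0).const_mul (β / 2)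
  refine ((h1.const_sub 1).sub h2).congr_fderiv (ContinuousLinearMap.ext fun v => ?_)
  simp
  ring

theorem locPot_self (α : E d →L[ℝ] ℝ) (β : ℝ) (y₀ : E d) : locPot p α β y₀ y₀ = 1 := by
  simp [locPot, q_zero]

/-- With `ψ` the local potential, the right side of the first identity is `-dψ`. Along the segment
from `y₀` to `y` the defects of both identities solve a homogeneous linear system with zero initial
value, so they vanish by Grönwall. Nothing is divided by `ψ`, so the second identity can later be
used to show that `ψ` has no zeros. -/
theorem IsProjData.locPot_eq (hd : 2 ≤ d) (h : IsProjData p a b U) {y₀ : E d} {r : ℝ}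
    (hU : Metric.ball y₀ r ⊆ U) {y : E d} (hy : y ∈ Metric.ball y₀ r) :
    locPot p (a y₀) (b y₀) y₀ y • a y = a y₀ + b y₀ • sform p (y - y₀) ∧
      locPot p (a y₀) (b y₀) y₀ y * b y = b y₀ := by
  set ψ := locPot p (a y₀) (b y₀) y₀ with hψ
  set v := y - y₀ with hv
  let x : ℝ → E d := fun t => y₀ + t • v
  have hx : ∀ t, HasDerivAt x v t := fun t => by
    refine (((hasDerivAt_id t).smul_const v).const_add y₀).congr_deriv (one_smul ℝ v)
  have hxU : ∀ t ∈ Icc (0 : ℝ) 1, x t ∈ U := by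
    intro t ht
    refine hU ?_
    rw [Metric.mem_ball, dist_eq_norm] at hy ⊢
    simp only [x, add_sub_cancel_left, norm_smul, Real.norm_eq_abs, abs_of_nonneg ht.1]
    calc t * ‖v‖ ≤ 1 * ‖v‖ := by gcongr; exact ht.2
      _ < r := by rwa [one_mul]
  let A : ℝ → E d →L[ℝ] ℝ := fun t =>
    ψ (x t) • a (x t) - (a y₀ + b y₀ • sform p (x t - y₀))
  let c : ℝ → ℝ := fun t => ψ (x t) * b (x t) - b y₀
  have hψx : ∀ t, HasDerivAt (fun t => ψ (x t)) (-(a y₀ v) - b y₀ * sform p (x t - y₀) v) t := by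
    intro t
    exact ((hasFDerivAt_locPot (p := p) (a y₀) (b y₀) y₀ (x t)).comp_hasDerivAt t
      (hx t)).congr_deriv (by simp)
  have hax : ∀ t ∈ Icc (0 : ℝ) 1, HasDerivAt (fun t => a (x t))
      ((a (x t) v) • a (x t) + b (x t) • sform p v) t := by
    intro t ht
    have h1 : HasFDerivAt a (fderiv ℝ a (x t)) (x t) :=
      ((h.smooth _ (hxU t ht)).differentiableAt (by simp)).hasFDerivAt
    have h2 := h1.comp_hasDerivAt t (hx t)
    refine h2.congr_deriv (ContinuousLinearMap.ext fun w => ?_)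
    rw [h.eqn _ (hxU t ht)]
    simp [sform_apply]
  have hbx : ∀ t ∈ Icc (0 : ℝ) 1, HasDerivAt (fun t => b (x t)) (b (x t) * a (x t) v) t := by
    intro t ht
    have h2 := (h.differentiableAt_b hd (hxU t ht)).hasFDerivAt.comp_hasDerivAt t (hx t)
    rw [h.fderiv_b hd (hxU t ht)] at h2
    exact h2
  have hA : ∀ t ∈ Icc (0 : ℝ) 1, HasDerivAt A (c t • sform p v + A t v • a (x t)) t := by
    intro t ht
    have hs : HasDerivAt (fun t => sform p (x t - y₀)) (sform p v) t :=
      (sform p).hasFDerivAt.comp_hasDerivAt t ((hx t).sub_const y₀)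
    have h1 := ((hψx t).smul (hax t ht)).sub ((hs.const_smul (b y₀)).const_add (a y₀))
    refine h1.congr_deriv (ContinuousLinearMap.ext fun w => ?_)
    simp only [A, c, add_apply, sub_apply, smul_apply, smul_eq_mul]
    ring
  have hc : ∀ t ∈ Icc (0 : ℝ) 1, HasDerivAt c (b (x t) * A t v) t := by
    intro t ht
    refine (((hψx t).mul (hbx t ht)).sub_const (b y₀)).congr_deriv ?_
    simp only [A, add_apply, sub_apply, smul_apply, smul_eq_mul]
    ring
  have hxc : Continuous x := continuous_iff_continuousAt.2 fun t => (hx t).continuousAt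
  have hac : ContinuousOn (fun t => a (x t)) (Icc (0 : ℝ) 1) := fun t ht =>
    (hax t ht).continuousAt.continuousWithinAt
  have hbc : ContinuousOn (fun t => b (x t)) (Icc (0 : ℝ) 1) := fun t ht =>
    (hbx t ht).continuousAt.continuousWithinAt
  obtain ⟨K₁, hK₁⟩ := isCompact_Icc.exists_bound_of_continuousOn hac
  obtain ⟨K₂, hK₂⟩ := isCompact_Icc.exists_bound_of_continuousOn hbc
  let Z : ℝ → (E d →L[ℝ] ℝ) × ℝ := fun t => (A t, c t)
  have hZ : ∀ t ∈ Icc (0 : ℝ) 1,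
      HasDerivAt Z (c t • sform p v + A t v • a (x t), b (x t) * A t v) t := fun t ht =>
    (hA t ht).prodMk (hc t ht)
  have hbound : ∀ t ∈ Ico (0 : ℝ) 1,
      ‖(c t • sform p v + A t v • a (x t), b (x t) * A t v)‖ ≤
        (‖sform p v‖ + ‖v‖ * K₁ + K₂ * ‖v‖) * ‖Z t‖ := by
    intro t ht
    have ht' := Ico_subset_Icc_self ht
    have hAZ : ‖A t‖ ≤ ‖Z t‖ := norm_fst_le (Z t)
    have hcZ : ‖c t‖ ≤ ‖Z t‖ := norm_snd_le (Z t)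
    have hAv : ‖A t v‖ ≤ ‖Z t‖ * ‖v‖ :=
      ((A t).le_opNorm v).trans (by gcongr)
    have k1 := hK₁ t ht'
    have k2 := hK₂ t ht'
    have k1' : 0 ≤ K₁ := (norm_nonneg _).trans k1
    have k2' : 0 ≤ K₂ := (norm_nonneg _).trans k2
    have hZ0 := norm_nonneg (Z t)
    refine norm_prod_le_iff.2 ⟨?_, ?_⟩
    · calc ‖c t • sform p v + A t v • a (x t)‖ ≤ ‖c t‖ * ‖sform p v‖ + ‖A t v‖ * ‖a (x t)‖ := by
            refine (norm_add_le _ _).trans ?_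
            rw [norm_smul, norm_smul]
        _ ≤ ‖Z t‖ * ‖sform p v‖ + ‖Z t‖ * ‖v‖ * K₁ := by gcongr
        _ ≤ _ := by
            have : 0 ≤ K₂ * ‖v‖ * ‖Z t‖ := by positivity
            linarith
    · calc ‖b (x t) * A t v‖ = ‖b (x t)‖ * ‖A t v‖ := norm_mul _ _
        _ ≤ K₂ * (‖Z t‖ * ‖v‖) := by gcongr
        _ ≤ _ := by
            have : 0 ≤ ‖sform p v‖ * ‖Z t‖ + ‖v‖ * K₁ * ‖Z t‖ := by positivity
            linarith
  have hZ0 : Z 0 = 0 := by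
    have hx0 : x 0 = y₀ := by simp [x]
    simp only [Z, A, c, hx0, hψ, locPot_self]
    simp
  have hend := eq_zero_of_abs_deriv_le_mul_abs_self_of_eq_zero_right
    (f := Z) (a := 0) (b := 1) (fun t ht => (hZ t ht).continuousAt.continuousWithinAt)
    (fun t ht => (hZ t (Ico_subset_Icc_self ht)).hasDerivWithinAt) hZ0 hbound 1 (by simp)
  have hx1 : x 1 = y := by simp [x, hv]
  have e1 : A 1 = 0 := congrArg Prod.fst hend
  have e2 : c 1 = 0 := congrArg Prod.snd hend
  simp only [A, c, hx1] at e1 e2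
  exact ⟨sub_eq_zero.1 e1, sub_eq_zero.1 e2⟩

end Local

/-! ### Christoffel symbols and curvature in a stiff chart -/

section StiffCharts

theorem HasDerivAt.mem_of_eventually_mem {V : Type*} [NormedAddCommGroup V] [NormedSpace ℝ V]
    {L : Submodule ℝ V} (hL : IsClosed (L : Set V)) {f : ℝ → V} {f' : V} {t : ℝ}
    (hf : HasDerivAt f f' t) (h : ∀ᶠ s in 𝓝 t, f s - f t ∈ L) : f' ∈ L := by
  refine hL.mem_of_tendsto (hasDerivAt_iff_tendsto_slope.1 hf) ?_
  filter_upwards [nhdsWithin_le_nhds h] with s hs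
  exact L.smul_mem _ hs

/-- Every term is governed by `Da - a⊗a`; the last coefficient is its antisymmetric part, to which
`a⊗a` does not contribute. -/
theorem curvCoord_projBilin {V : Type*} [NormedAddCommGroup V] [NormedSpace ℝ V]
    {a : V → V →L[ℝ] ℝ} {G : V → V →L[ℝ] V →L[ℝ] V} {y : V}
    (ha : DifferentiableAt ℝ a y) (hGd : DifferentiableAt ℝ G y)
    (hG : ∀ᶠ z in 𝓝 y, G z = projBilin (a z)) (u v w : V) :
    curvCoord G y u v w =
      (fderiv ℝ a y u w - a y u * a y w) • v - (fderiv ℝ a y v w - a y v * a y w) • u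
        + (fderiv ℝ a y u v - fderiv ℝ a y v u) • w := by
  have h2 : ∀ u v w, fderiv ℝ G y u v w = fderiv ℝ a y u w • v + fderiv ℝ a y u v • w := by
    intro u v w
    have hcv := hasFDerivAt_const (𝕜 := ℝ) v y
    have hcw := hasFDerivAt_const (𝕜 := ℝ) w y
    have h3 := (hGd.hasFDerivAt.clm_apply hcv).clm_apply hcw
    have h4 := ((ha.hasFDerivAt.clm_apply hcw).smul_const v).add
      ((ha.hasFDerivAt.clm_apply hcv).smul_const w)
    have e : (fun z => G z v w) =ᶠ[𝓝 y] fun z => a z w • v + a z v • w := by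
      filter_upwards [hG] with z hz
      rw [hz, projBilin_apply]
    have h5 := congrArg (fun L => L u) (h3.unique (h4.congr_of_eventuallyEq e))
    simpa using h5
  rw [curvCoord, h2, h2, hG.self_of_nhds]
  simp only [projBilin_apply, map_add, map_smul]
  module

variable {d : ℕ} {M : Type*} [TopologicalSpace M] [ChartedSpace (E d) M] [IsManifold (𝓡 d) ∞ M]
variable {φ φ' : OpenPartialHomeomorph M (E d)} {p : ℕ}
variable {𝒜 : Set (OpenPartialHomeomorph M (E d))} {conn : Connection d M}

/-- Launch a geodesic with velocity `u ≠ 0`. It stays on a line, so its velocity `u` and its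
acceleration `-Γ(u,u)` lie in the same one-dimensional space. -/
theorem christoffel_self_of_straight [T2Space M] (hs : IsStiff p 𝒜 conn) (hφ : φ ∈ 𝒜)
    (hφm : φ ∈ IsManifold.maximalAtlas (𝓡 d) ∞ M) {y : E d} (hy : y ∈ φ.target) (u : E d) :
    ∃ c : ℝ, christoffelMap conn φ y u u = c • u := by
  by_cases hu : u = 0
  · exact ⟨0, by simp [hu]⟩
  obtain ⟨ε, γ, hε, hγ, hmaps, h0, hu0⟩ := exists_geodesic conn hs.smooth hφm hy u
  obtain ⟨a, v, hav⟩ := hs.straight φ hφ _ γ isOpen_Ioo ordConnected_Ioo hγ hmaps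
  have hJ : IsOpen (Ioo (-ε) ε) := isOpen_Ioo
  have h0J : (0 : ℝ) ∈ Ioo (-ε) ε := ⟨by linarith, hε⟩
  let L : Submodule ℝ (E d) := Submodule.span ℝ {v}
  have hL : IsClosed (L : Set (E d)) := L.closed_of_finiteDimensional
  let f : ℝ → E d := fun s => φ (γ s)
  have hf2 : ∀ t ∈ Ioo (-ε) ε, ContDiffAt ℝ 2 f t := fun t ht =>
    geodesic_contDiffAt hγ hJ hφm ht (hmaps ht)
  have hf1 : ∀ t ∈ Ioo (-ε) ε, HasDerivAt f (deriv f t) t := fun t ht =>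
    ((hf2 t ht).differentiableAt (by simp)).hasDerivAt
  have hfL : ∀ t ∈ Ioo (-ε) ε, deriv f t ∈ L := by
    intro t ht
    refine HasDerivAt.mem_of_eventually_mem hL (hf1 t ht) ?_
    filter_upwards [hJ.mem_nhds ht] with s hs
    obtain ⟨c, hc⟩ := hav s hs
    obtain ⟨c', hc'⟩ := hav t ht
    have : f s - f t = (c - c') • v := by
      simp only [f, hc, hc']; module
    rw [this]
    exact L.smul_mem _ (Submodule.mem_span_singleton_self v)
  have hdf : HasDerivAt (deriv f) (deriv (deriv f) 0) 0 := by
    have h1 : ContDiffAt ℝ 1 (deriv f) 0 := by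
      have h2 : ContDiffAt ℝ 1 (fderiv ℝ f) 0 :=
        (hf2 0 h0J).fderiv_right (by norm_num)
      exact h2.clm_apply contDiffAt_const
    exact (h1.differentiableAt (by simp)).hasDerivAt
  have hf2L : deriv (deriv f) 0 ∈ L := by
    refine HasDerivAt.mem_of_eventually_mem hL hdf ?_
    filter_upwards [hJ.mem_nhds h0J] with s hs
    exact L.sub_mem (hfL s hs) (hfL 0 h0J)
  have hgeo := hγ.2 φ hφm 0 h0J (hmaps h0J)
  change deriv (deriv f) 0 = _ at hgeo
  rw [h0, hu0, ← christoffelMap_apply conn hφm hy] at hgeo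
  have huL : u ∈ L := by rw [← hu0]; exact hfL 0 h0J
  rw [hgeo] at hf2L
  obtain ⟨k, hk⟩ := Submodule.mem_span_singleton.1 huL
  obtain ⟨k', hk'⟩ := Submodule.mem_span_singleton.1 (L.neg_mem hf2L)
  rw [neg_neg] at hk'
  have hk0 : k ≠ 0 := fun h => hu (by rw [← hk, h, zero_smul])
  exact ⟨k' / k, by rw [← hk', ← hk, smul_smul, div_mul_cancel₀ _ hk0]⟩

/-- The linear form `a` with `Γ(u, v) = a(v) u + a(u) v`. -/
@[irreducible] def aForm (conn : Connection d M) (φ : OpenPartialHomeomorph M (E d)) (y : E d) :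
    E d →L[ℝ] ℝ :=
  projForm (christoffelMap conn φ y)

/-- The coefficient `b` with `R(u, v) w = b ((u·w) v - (v·w) u)`. -/
def bCoef (p : ℕ) (conn : Connection d M) (φ : OpenPartialHomeomorph M (E d)) (y : E d) : ℝ :=
  -- In a stiff chart the `d` terms are equal; averaging them avoids choosing an index.
  (∑ i, eps p i * (fderiv ℝ (aForm conn φ) y (ee i) (ee i)
    - aForm conn φ y (ee i) * aForm conn φ y (ee i))) / d

theorem christoffelMap_eq_projBilin [T2Space M] (hs : IsStiff p 𝒜 conn) (hφ : φ ∈ 𝒜)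
    (hφm : φ ∈ IsManifold.maximalAtlas (𝓡 d) ∞ M) {y : E d} (hy : y ∈ φ.target) :
    christoffelMap conn φ y = projBilin (aForm conn φ y) := by
  unfold aForm
  refine eq_projBilin _ (fun u v => ?_) (christoffel_self_of_straight hs hφ hφm hy)
  rw [christoffelMap_apply conn hφm hy, christoffelMap_apply conn hφm hy]
  exact hs.symmetric φ hφ y hy u v

theorem contDiffAt_aForm [T2Space M]
    (hc : CovariantDerivative.ContMDiffCovariantDerivative conn ∞)
    (hφm : φ ∈ IsManifold.maximalAtlas (𝓡 d) ∞ M) {y : E d} (hy : y ∈ φ.target) :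
    ContDiffAt ℝ ∞ (aForm conn φ) y := by
  unfold aForm
  exact (contDiffAt_christoffelMap conn hc hφm hy).continuousLinearMap_comp projForm

theorem curvature_eq_of_stiff [T2Space M] (hs : IsStiff p 𝒜 conn) (hφ : φ ∈ 𝒜)
    (hφm : φ ∈ IsManifold.maximalAtlas (𝓡 d) ∞ M) {y : E d} (hy : y ∈ φ.target) (u v w : E d) :
    curvature conn φ y u v w =
      (fderiv ℝ (aForm conn φ) y u w - aForm conn φ y u * aForm conn φ y w) • v
      - (fderiv ℝ (aForm conn φ) y v w - aForm conn φ y v * aForm conn φ y w) • u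
      + (fderiv ℝ (aForm conn φ) y u v - fderiv ℝ (aForm conn φ) y v u) • w := by
  rw [curvature_eq_curvCoord conn hs.smooth hφm hy]
  refine curvCoord_projBilin ((contDiffAt_aForm hs.smooth hφm hy).differentiableAt (by simp))
    (hasFDerivAt_christoffelMap conn hs.smooth hφm hy) ?_ u v w
  filter_upwards [eventually_mem_source φ hy] with z hz
  exact christoffelMap_eq_projBilin hs hφ hφm hz

/-- Skewness of the holonomy on a repeated vector, `R(u,v)w · w = 0`, is exactly the hypothesis of
`bilin_eq_smul_sprod` for `B = Da - a⊗a`. -/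
theorem fderiv_aForm [T2Space M] (hd : 2 ≤ d) (hs : IsStiff p 𝒜 conn) (hφ : φ ∈ 𝒜)
    (hφm : φ ∈ IsManifold.maximalAtlas (𝓡 d) ∞ M) {y : E d} (hy : y ∈ φ.target) (u w : E d) :
    fderiv ℝ (aForm conn φ) y u w =
      aForm conn φ y u * aForm conn φ y w + bCoef p conn φ y * sprod p u w := by
  set a := aForm conn φ with ha
  let B : E d →L[ℝ] E d →L[ℝ] ℝ := fderiv ℝ a y - (a y).smulRight (a y)
  have hB : ∀ u w, B u w = fderiv ℝ a y u w - a y u * a y w := fun u w => by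
    simp [B]
  obtain ⟨β, hβ⟩ := bilin_eq_smul_sprod p hd B (by
    intro u v w
    have h := hs.holonomy φ hφ y hy u v w w
    rw [sprod_comm p w, curvature_eq_of_stiff hs hφ hφm hy, ← ha, ← hB, ← hB,
      sprod_add_left, sub_eq_add_neg, sprod_add_left, ← neg_smul, sprod_smul_left,
      sprod_smul_left, sprod_smul_left] at h
    have e : fderiv ℝ a y u v - fderiv ℝ a y v u = B u v - B v u := by rw [hB, hB]; ring
    rw [e] at h
    linarith)
  have hb : bCoef p conn φ y = β := by
    have : ∀ i : Fin d, eps p i * (fderiv ℝ a y (ee i) (ee i) - a y (ee i) * a y (ee i)) = β := by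
      intro i
      rw [← hB, hβ, sprod_ee]
      simp only [ee_apply, if_true]
      linear_combination β * eps_mul_self p i
    have hd0 : (d : ℝ) ≠ 0 := by positivity
    simp only [bCoef, ← ha, this, Finset.sum_const, Finset.card_univ, Fintype.card_fin,
      nsmul_eq_mul]
    field_simp
  rw [hb, ← hβ, hB]; ring

theorem isProjData_of_stiff [T2Space M] (hd : 2 ≤ d) (hs : IsStiff p 𝒜 conn) (hφ : φ ∈ 𝒜)
    (hφm : φ ∈ IsManifold.maximalAtlas (𝓡 d) ∞ M) :
    IsProjData p (aForm conn φ) (bCoef p conn φ) φ.target where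
  isOpen := φ.open_target
  smooth _ hy := contDiffAt_aForm hs.smooth hφm hy
  eqn _ hy := fderiv_aForm hd hs hφ hφm hy

theorem curvature_eq_bCoef [T2Space M] (hd : 2 ≤ d) (hs : IsStiff p 𝒜 conn) (hφ : φ ∈ 𝒜)
    (hφm : φ ∈ IsManifold.maximalAtlas (𝓡 d) ∞ M) {y : E d} (hy : y ∈ φ.target) (u v w : E d) :
    curvature conn φ y u v w = bCoef p conn φ y • (sprod p u w • v - sprod p v w • u) := by
  rw [curvature_eq_of_stiff hs hφ hφm hy]
  simp only [fderiv_aForm hd hs hφ hφm hy]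
  rw [sprod_comm p u v]
  module

end StiffCharts

/-! ### Similarity charts -/

section SimilarityCharts

theorem IsSimilarity.contDiff {p d : ℕ} {f : E d → E d} (hf : IsSimilarity p f) :
    ContDiff ℝ ∞ f := by
  obtain ⟨A, s, b, -, -, hf⟩ := hf
  rw [show f = fun x => s • A.toContinuousLinearEquiv x + b from funext hf]
  exact (A.toContinuousLinearEquiv.contDiff.const_smul s).add contDiff_const

theorem mem_similarityGroupoid_iff {p d : ℕ} {e : OpenPartialHomeomorph (E d) (E d)} :
    e ∈ similarityGroupoid p d ↔
      (∀ x ∈ e.source, ∃ g, IsSimilarity p g ∧ e =ᶠ[𝓝 x] g) ∧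
      ∀ x ∈ e.target, ∃ g, IsSimilarity p g ∧ e.symm =ᶠ[𝓝 x] g :=
  mem_groupoid_of_pregroupoid

theorem similarityGroupoid_le (p d : ℕ) :
    similarityGroupoid p d ≤ contDiffGroupoid ∞ (𝓡 d) := by
  refine groupoid_of_pregroupoid_le _ _ fun f s hf => ?_
  have h : ContDiffOn ℝ ∞ f s := by
    intro x hx
    obtain ⟨g, hg, hfg⟩ := hf x hx
    exact ((IsSimilarity.contDiff hg).contDiffAt.congr_of_eventuallyEq hfg).contDiffWithinAt
  simpa [contDiffPregroupoid] using h

/-- A negative ratio is absorbed by `-id`, a linear isometry of `q`. This allows a model chart to be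
reflected into the required half-space. -/
theorem isSimilarity_smul_add (p : ℕ) {d : ℕ} {c : ℝ} (hc : c ≠ 0) (b : E d) :
    IsSimilarity p fun y => c • y + b := by
  rcases lt_or_gt_of_ne hc with h | h
  · refine ⟨LinearEquiv.neg ℝ, -c, b, by linarith, fun v => ?_, fun x => ?_⟩
    · have := q_smul p (-1) v
      simpa using this
    · simp
  · exact ⟨LinearEquiv.refl ℝ _, c, b, h, fun _ => rfl, fun _ => rfl⟩

variable {d : ℕ} {M : Type*} [TopologicalSpace M] [ChartedSpace (E d) M] [IsManifold (𝓡 d) ∞ M]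
variable {φ φ' : OpenPartialHomeomorph M (E d)} {p : ℕ}
variable {conn : Connection d M}

theorem mem_smooth_of_mem_similarity
    (hφ : φ ∈ (similarityGroupoid p d).maximalAtlas M) :
    φ ∈ IsManifold.maximalAtlas (𝓡 d) ∞ M :=
  StructureGroupoid.maximalAtlas_mono (similarityGroupoid_le p d) hφ

/-- Near the image of `x`, the change of charts is `y ↦ s A y + b`. -/
def IsSimTrn (p : ℕ) (φ φ' : OpenPartialHomeomorph M (E d)) (x : M) (A : E d ≃ₗ[ℝ] E d) (s : ℝ)
    (b : E d) : Prop :=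
  0 < s ∧ (∀ v, q p (A v) = q p v) ∧ trn φ φ' =ᶠ[𝓝 (φ x)] fun y => s • A y + b

theorem exists_isSimTrn (_hG : HasGroupoid M (similarityGroupoid p d))
    (hφ : φ ∈ (similarityGroupoid p d).maximalAtlas M)
    (hφ' : φ' ∈ (similarityGroupoid p d).maximalAtlas M) {x : M} (hx : x ∈ φ.source)
    (hx' : x ∈ φ'.source) : ∃ A s b, IsSimTrn p φ φ' x A s b := by
  have h := StructureGroupoid.compatible_of_mem_maximalAtlas hφ hφ'
  obtain ⟨g, ⟨A, s, b, hs, hA, hg⟩, hfg⟩ := (mem_similarityGroupoid_iff.1 h).1 (φ x) (by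
    simp [hx, hx'])
  exact ⟨A, s, b, hs, hA, hfg.trans (Eventually.of_forall hg)⟩

variable {x : M} {A : E d ≃ₗ[ℝ] E d} {s : ℝ} {b : E d}

theorem IsSimTrn.hasFDerivAt (h : IsSimTrn p φ φ' x A s b) :
    fderiv ℝ (trn φ φ') =ᶠ[𝓝 (φ x)]
      fun _ => s • (A.toContinuousLinearEquiv : E d →L[ℝ] E d) := by
  filter_upwards [h.2.2.eventually_nhds] with y hy
  rw [Filter.EventuallyEq.fderiv_eq hy]
  exact (((A.toContinuousLinearEquiv : E d →L[ℝ] E d).hasFDerivAt.const_smul s).add_const b).fderiv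

theorem IsSimTrn.fderiv_apply (h : IsSimTrn p φ φ' x A s b) (v : E d) :
    fderiv ℝ (trn φ φ') (φ x) v = s • A v := by
  rw [h.hasFDerivAt.eq_of_nhds]; rfl

theorem IsSimTrn.fderiv_fderiv (h : IsSimTrn p φ φ' x A s b) :
    fderiv ℝ (fderiv ℝ (trn φ φ')) (φ x) = 0 := by
  rw [h.hasFDerivAt.fderiv_eq]
  exact (hasFDerivAt_const (𝕜 := ℝ) _ _).fderiv

theorem IsSimTrn.apply (h : IsSimTrn p φ φ' x A s b) (hx : x ∈ φ.source) :
    φ' x = s • A (φ x) + b := by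
  have := h.2.2.eq_of_nhds
  rwa [trn_apply hx] at this

theorem IsSimTrn.eventually (h : IsSimTrn p φ φ' x A s b) (hx : x ∈ φ.source)
    (hx' : x ∈ φ'.source) :
    ∀ᶠ y in 𝓝 x, y ∈ φ.source ∧ y ∈ φ'.source ∧ IsSimTrn p φ φ' y A s b := by
  filter_upwards [φ.open_source.mem_nhds hx, φ'.open_source.mem_nhds hx',
    (φ.continuousAt hx).eventually h.2.2.eventually_nhds] with y hy hy' h3
  exact ⟨hy, hy', h.1, h.2.1, h3⟩

theorem IsSimTrn.christoffel_eq (conn : Connection d M) (h : IsSimTrn p φ φ' x A s b)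
    (hφ : φ ∈ IsManifold.maximalAtlas (𝓡 d) ∞ M)
    (hφ' : φ' ∈ IsManifold.maximalAtlas (𝓡 d) ∞ M) (hx : x ∈ φ.source) (hx' : x ∈ φ'.source)
    (u v : E d) :
    christoffel conn φ' (φ' x) (s • A u) (s • A v) = s • A (christoffel conn φ (φ x) u v) := by
  have := christoffel_trn conn hφ hφ' hx hx' u v
  rw [h.fderiv_fderiv, h.fderiv_apply, h.fderiv_apply, h.fderiv_apply] at this
  simpa using this

/-- The curvature is a tensor while `q` is multiplied by `s²`. Hence `b` is only defined up to scale
in general, but becomes a function on `M` when all ratios are 1. -/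
theorem IsSimTrn.bCoef_eq [T2Space M] (hd : 2 ≤ d)
    {𝒜 : Set (OpenPartialHomeomorph M (E d))} (hs : IsStiff p 𝒜 conn)
    (h : IsSimTrn p φ φ' x A s b) (hφ : φ ∈ 𝒜) (hφ' : φ' ∈ 𝒜)
    (hφm : φ ∈ IsManifold.maximalAtlas (𝓡 d) ∞ M)
    (hφm' : φ' ∈ IsManifold.maximalAtlas (𝓡 d) ∞ M) (hx : x ∈ φ.source) (hx' : x ∈ φ'.source) :
    bCoef p conn φ (φ x) = s ^ 2 * bCoef p conn φ' (φ' x) := by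
  obtain ⟨i, j, hij⟩ := exists_two_indices hd
  have h1 := curvature_trn conn hs.smooth hφm hφm' hx hx' (ee i) (ee j) (ee i)
  rw [h.fderiv_apply, h.fderiv_apply, h.fderiv_apply,
    curvature_eq_bCoef hd hs hφ hφm (φ.map_source hx),
    curvature_eq_bCoef hd hs hφ' hφm' (φ'.map_source hx')] at h1
  simp only [sprod_smul_left, sprod_smul_right, sprod_map h.2.1, sprod_ee, ee_apply, if_true,
    if_neg hij, mul_one, mul_zero, zero_smul, sub_zero, map_smul] at h1
  have hAj : A (ee j) ≠ 0 := fun h0 => ee_ne_zero j (A.map_eq_zero_iff.1 h0)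
  have h2 : (bCoef p conn φ' (φ' x) * (s * (s * eps p i)) * s - s * bCoef p conn φ (φ x) * eps p i)
      • A (ee j) = 0 := by
    rw [sub_smul, sub_eq_zero]
    simp only [smul_smul] at h1
    convert h1 using 2 <;> ring
  have h3 := (smul_eq_zero.1 h2).resolve_right hAj
  have h4 : (s * eps p i) * (bCoef p conn φ (φ x) - s ^ 2 * bCoef p conn φ' (φ' x)) = 0 := by
    linear_combination -h3
  have h5 := (mul_eq_zero.1 h4).resolve_left (mul_ne_zero h.1.ne' (eps_ne_zero p i))
  linarith

/-- A non flat stiff connection on a connected manifold has no flat point. -/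
theorem bCoef_ne_zero [T2Space M] [ConnectedSpace M] (hd : 2 ≤ d)
    (hst : IsStiffPair p conn) (hflat : ¬ IsFlat conn)
    (hφ : φ ∈ (similarityGroupoid p d).maximalAtlas M) (hx : x ∈ φ.source) :
    bCoef p conn φ (φ x) ≠ 0 := by
  obtain ⟨hG, hs⟩ := hst
  have hm : ∀ {φ : OpenPartialHomeomorph M (E d)},
      φ ∈ (similarityGroupoid p d).maximalAtlas M → φ ∈ IsManifold.maximalAtlas (𝓡 d) ∞ M :=
    fun h => mem_smooth_of_mem_similarity h
  -- The set of flat points. It is open because `ψ b = b(y₀) = 0` with `ψ ≠ 0` near `y₀`, and closed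
  -- because `b` is continuous.
  let Z : Set M := {x | ∀ φ ∈ (similarityGroupoid p d).maximalAtlas M, x ∈ φ.source →
    bCoef p conn φ (φ x) = 0}
  have hinv : ∀ (x : M) (φ φ' : OpenPartialHomeomorph M (E d)),
      φ ∈ (similarityGroupoid p d).maximalAtlas M → φ' ∈ (similarityGroupoid p d).maximalAtlas M →
      x ∈ φ.source → x ∈ φ'.source → bCoef p conn φ (φ x) = 0 → bCoef p conn φ' (φ' x) = 0 := by
    intro x φ φ' hφ hφ' hx hx' h0
    obtain ⟨A, s, b, h⟩ := exists_isSimTrn hG hφ hφ' hx hx'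
    have := h.bCoef_eq hd hs hφ hφ' (hm hφ) (hm hφ') hx hx'
    rw [h0] at this
    exact (mul_eq_zero.1 this.symm).resolve_left (pow_ne_zero 2 h.1.ne')
  have hdata : ∀ φ ∈ (similarityGroupoid p d).maximalAtlas M,
      IsProjData p (aForm conn φ) (bCoef p conn φ) φ.target := fun φ hφ =>
    isProjData_of_stiff hd hs hφ (hm hφ)
  have hopen : IsOpen Z := by
    rw [isOpen_iff_mem_nhds]
    intro x hx
    let φ := chartAt (E d) x
    have hφ : φ ∈ (similarityGroupoid p d).maximalAtlas M :=
      StructureGroupoid.chart_mem_maximalAtlas _ x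
    have hxs : x ∈ φ.source := mem_chart_source _ x
    have h0 := hx φ hφ hxs
    obtain ⟨r, hr, hball⟩ := Metric.isOpen_iff.1 φ.open_target (φ x) (φ.map_source hxs)
    have hψ : ∀ᶠ y in 𝓝 (φ x),
        locPot p (aForm conn φ (φ x)) (bCoef p conn φ (φ x)) (φ x) y ≠ 0 := by
      refine (hasFDerivAt_locPot _ _ _ _).continuousAt.eventually_ne ?_
      rw [locPot_self]; exact one_ne_zero
    filter_upwards [φ.open_source.mem_nhds hxs, (φ.continuousAt hxs).eventually hψ,
      (φ.continuousAt hxs).eventually (Metric.ball_mem_nhds (φ x) hr)] with y hy h1 h2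
    have h3 := ((hdata φ hφ).locPot_eq hd hball h2).2
    rw [h0] at h1 h3
    exact fun φ' hφ' hy' => hinv y φ φ' hφ hφ' hy hy' ((mul_eq_zero.1 h3).resolve_left h1)
  have hclosed : IsClosed Z := by
    rw [← isOpen_compl_iff, isOpen_iff_mem_nhds]
    intro x hx
    simp only [Z, mem_compl_iff, mem_ofPred_eq, not_forall] at hx
    obtain ⟨φ, hφ, hxs, h0⟩ := hx
    have hc : ∀ᶠ z in 𝓝 (φ x), bCoef p conn φ z ≠ 0 :=
      ((hdata φ hφ).differentiableAt_b hd (φ.map_source hxs)).continuousAt.eventually_ne h0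
    filter_upwards [φ.open_source.mem_nhds hxs, (φ.continuousAt hxs).eventually hc] with y hy h1 h2
    exact h1 (h2 φ hφ hy)
  rcases isClopen_iff.1 ⟨hclosed, hopen⟩ with h | h
  · intro h0
    have : x ∈ Z := fun φ' hφ' hx' => hinv x φ φ' hφ hφ' hx hx' h0
    rw [h] at this
    exact this
  · exfalso
    -- Flatness is stated in all smooth charts, so vanishing is transported from a similarity chart
    -- by tensoriality.
    refine hflat fun ψ hψ y hy u v w => ?_
    set x := ψ.symm y
    have hxs : x ∈ ψ.source := ψ.map_target hy
    have hyx : ψ x = y := ψ.right_inv hy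
    let φ := chartAt (E d) x
    have hφ : φ ∈ (similarityGroupoid p d).maximalAtlas M :=
      StructureGroupoid.chart_mem_maximalAtlas _ x
    have hxφ : x ∈ φ.source := mem_chart_source _ x
    have hxZ : x ∈ Z := by rw [h]; trivial
    have h0 := hxZ φ hφ hxφ
    have hinvt := trn_isInvertible (hm hφ) hψ hxφ hxs
    have h1 := curvature_trn conn hs.smooth (hm hφ) hψ hxφ hxs
      ((fderiv ℝ (trn φ ψ) (φ x)).inverse u) ((fderiv ℝ (trn φ ψ) (φ x)).inverse v)
      ((fderiv ℝ (trn φ ψ) (φ x)).inverse w)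
    rw [hinvt.self_apply_inverse, hinvt.self_apply_inverse, hinvt.self_apply_inverse, hyx,
      curvature_eq_bCoef hd hs hφ (hm hφ) (φ.map_source hxφ), h0, zero_smul, map_zero] at h1
    exact h1

end SimilarityCharts

/-! ### Model charts -/

section ModelDomain
variable {p d : ℕ}

theorem hasFDerivAt_potential (l : ℝ) (x : E d) :
    HasFDerivAt (potential p l) (2 • sform p x) x :=
  (hasFDerivAt_q p x).add_const l

theorem continuous_potential (l : ℝ) : Continuous (potential p l : E d → ℝ) :=
  (continuous_q p).add continuous_const

theorem fderiv_potential (l : ℝ) (x v : E d) :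
    fderiv ℝ (potential p l) x v = 2 * sprod p x v := by
  rw [(hasFDerivAt_potential l x).fderiv]
  simp [sform_apply]

theorem potential_ne_zero {l : ℝ} {ν : ℤˣ} {x : E d} (hx : x ∈ modelDomain p d l ν) :
    potential p l x ≠ 0 := fun h => by
  have := hx.1
  rw [h, mul_zero] at this
  exact lt_irrefl _ this

theorem isOpen_modelDomain (l : ℝ) (ν : ℤˣ) : IsOpen (modelDomain p d l ν) := by
  have hcoord : ∀ i : Fin d, IsOpen {x : E d | 0 < x i} := fun i =>
    isOpen_lt continuous_const (EuclideanSpace.proj i : E d →L[ℝ] ℝ).continuous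
  refine (isOpen_lt continuous_const (continuous_const.mul (continuous_potential l))).inter
    (IsOpen.inter ?_ ?_)
  · have : {x : E d | ν = 1 → p = 1 → l ≤ 0 → ∀ i : Fin d, i.val = 0 → 0 < x i} =
        ⋂ i : Fin d, {x | ν = 1 → p = 1 → l ≤ 0 → i.val = 0 → 0 < x i} := by
      ext x; simp only [mem_ofPred_eq, mem_iInter]; tauto
    change IsOpen {x : E d | ν = 1 → p = 1 → l ≤ 0 → ∀ i : Fin d, i.val = 0 → 0 < x i}
    rw [this]
    refine isOpen_iInter_of_finite fun i => ?_
    by_cases h : ν = 1 ∧ p = 1 ∧ l ≤ 0 ∧ i.val = 0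
    · simpa [h.1, h.2.1, h.2.2.1, h.2.2.2] using hcoord i
    · convert isOpen_univ using 1
      ext x; simp only [mem_ofPred_eq, mem_univ, iff_true]; tauto
  · have : {x : E d | ν = -1 → p + 1 = d → 0 ≤ l → ∀ i : Fin d, i.val + 1 = d → 0 < x i} =
        ⋂ i : Fin d, {x | ν = -1 → p + 1 = d → 0 ≤ l → i.val + 1 = d → 0 < x i} := by
      ext x; simp only [mem_ofPred_eq, mem_iInter]; tauto
    change IsOpen {x : E d | ν = -1 → p + 1 = d → 0 ≤ l → ∀ i : Fin d, i.val + 1 = d → 0 < x i}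
    rw [this]
    refine isOpen_iInter_of_finite fun i => ?_
    by_cases h : ν = -1 ∧ p + 1 = d ∧ 0 ≤ l ∧ i.val + 1 = d
    · convert hcoord i using 1
      ext x; simp only [mem_ofPred_eq]; tauto
    · convert isOpen_univ using 1
      ext x; simp only [mem_ofPred_eq, mem_univ, iff_true]; tauto

/-- In the cases with a half-space condition, vanishing of the singled-out coordinate would give `ψ`
the wrong sign; so that coordinate is nonzero and `-id` exchanges the two sheets. -/
theorem mem_modelDomain_or_neg {l : ℝ} {ν : ℤˣ} {x : E d}
    (hx : 0 < ((ν : ℤ) : ℝ) * potential p l x) :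
    x ∈ modelDomain p d l ν ∨ -x ∈ modelDomain p d l ν := by
  have hneg : potential p l (-x) = potential p l x := by
    have := q_smul p (-1) x
    rw [potential, potential, ← neg_one_smul ℝ x, this]; ring
  rcases Int.units_eq_one_or ν with rfl | rfl
  · by_cases h : p = 1 ∧ l ≤ 0 ∧ 0 < d
    · obtain ⟨rfl, hl, hd⟩ := h
      have h0 : x ⟨0, hd⟩ ≠ 0 := by
        intro h0
        have hq : q 1 x ≤ 0 := by
          unfold q sprod
          refine Finset.sum_nonpos fun i _ => ?_
          by_cases hi : i.val = 0
          · have : i = ⟨0, hd⟩ := Fin.ext hi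
            rw [this, h0]; simp
          · have : ¬ i.val < 1 := by omega
            simp only [eps, this, if_false]
            nlinarith [mul_self_nonneg (x i)]
        have : potential 1 l x ≤ 0 := by unfold potential; linarith
        simp at hx; linarith
      rcases lt_or_gt_of_ne h0 with h | h
      · refine Or.inr ⟨by rwa [hneg], fun _ _ _ i hi => ?_, fun h => by simp at h⟩
        have : i = ⟨0, hd⟩ := Fin.ext hi
        rw [this]; simpa using h
      · refine Or.inl ⟨hx, fun _ _ _ i hi => ?_, fun h => by simp at h⟩
        have : i = ⟨0, hd⟩ := Fin.ext hi
        rw [this]; exact h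
    · refine Or.inl ⟨hx, fun _ h1 h2 i _ => ?_, fun h => by simp at h⟩
      exact absurd ⟨h1, h2, i.pos⟩ h
  · by_cases h : p + 1 = d ∧ 0 ≤ l
    · obtain ⟨rfl, hl⟩ := h
      have h0 : x (Fin.last p) ≠ 0 := by
        intro h0
        have hq : 0 ≤ q p x := by
          unfold q sprod
          refine Finset.sum_nonneg fun i _ => ?_
          by_cases hi : i.val < p
          · simp only [eps, hi, if_true]
            nlinarith [mul_self_nonneg (x i)]
          · have : i = Fin.last p := Fin.ext (by have := i.isLt; simp; omega)
            rw [this, h0]; simp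
        have : 0 ≤ potential p l x := by unfold potential; linarith
        simp at hx; linarith
      rcases lt_or_gt_of_ne h0 with h | h
      · refine Or.inr ⟨by rwa [hneg], fun h => by simp at h, fun _ _ _ i hi => ?_⟩
        have : i = Fin.last p := Fin.ext (by simp; omega)
        rw [this]; simpa using h
      · refine Or.inl ⟨hx, fun h => by simp at h, fun _ _ _ i hi => ?_⟩
        have : i = Fin.last p := Fin.ext (by simp; omega)
        rw [this]; exact h
    · refine Or.inl ⟨hx, fun h => by simp at h, fun _ h1 h2 => absurd ⟨h1, h2⟩ h⟩

/-- The homothety `y ↦ c y + b` of `E d`. -/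
def homothety {c : ℝ} (hc : c ≠ 0) (b : E d) : E d ≃ₜ E d where
  toFun y := c • y + b
  invFun y := c⁻¹ • y + (-(c⁻¹ • b))
  left_inv y := by simp [smul_smul, hc]
  right_inv y := by simp [smul_smul, hc]
  continuous_toFun := by fun_prop
  continuous_invFun := by fun_prop

theorem homothety_restr_mem {c : ℝ} (hc : c ≠ 0) (b : E d) {U : Set (E d)} (hU : IsOpen U) :
    ((homothety hc b).toOpenPartialHomeomorph.restrOpen U hU) ∈ similarityGroupoid p d := by
  rw [mem_similarityGroupoid_iff]
  exact ⟨fun _ _ => ⟨_, isSimilarity_smul_add p hc b, EventuallyEq.rfl⟩,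
    fun _ _ => ⟨_, isSimilarity_smul_add p (inv_ne_zero hc) _, EventuallyEq.rfl⟩⟩

end ModelDomain

section ModelCharts

variable {d : ℕ} {M : Type*} [TopologicalSpace M] [ChartedSpace (E d) M] [IsManifold (𝓡 d) ∞ M]
variable {φ φ' : OpenPartialHomeomorph M (E d)} {p : ℕ} {conn : Connection d M}

theorem trans_mem_maximalAtlas {G : StructureGroupoid (E d)} {e : OpenPartialHomeomorph (E d) (E d)}
    (hφ : φ ∈ G.maximalAtlas M) (he : e ∈ G) : φ ≫ₕ e ∈ G.maximalAtlas M := by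
  intro e' he'
  obtain ⟨h1, h2⟩ := hφ e' he'
  constructor
  · rw [OpenPartialHomeomorph.trans_symm_eq_symm_trans_symm, OpenPartialHomeomorph.trans_assoc]
    exact G.trans (G.symm he) h1
  · rw [← OpenPartialHomeomorph.trans_assoc]
    exact G.trans h2 he

/-- A chart of the similarity structure with values in the canonical model, which maps the
connection to the connection of the model. -/
def IsModelChart (p : ℕ) (conn : Connection d M) (l : ℝ) (ν : ℤˣ)
    (φ : OpenPartialHomeomorph M (E d)) : Prop :=
  φ ∈ (similarityGroupoid p d).maximalAtlas M ∧ φ.target ⊆ modelDomain p d l ν ∧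
    ∀ y ∈ φ.target, ∀ u v,
      christoffel conn φ y u v = potentialChristoffel (potential p l) y u v

theorem isModelledOn_iff {l : ℝ} {ν : ℤˣ} :
    IsModelledOn p conn l ν ↔ ∀ x : M, ∃ φ, IsModelChart p conn l ν φ ∧ x ∈ φ.source := by
  constructor
  · rintro ⟨𝓕, h𝓕, hcov, h⟩ x
    obtain ⟨φ, hφ, hx⟩ := hcov x
    exact ⟨φ, ⟨h𝓕 hφ, h φ hφ⟩, hx⟩
  · intro h
    refine ⟨{φ | IsModelChart p conn l ν φ}, fun φ hφ => hφ.1, fun x => ?_, fun φ hφ => hφ.2⟩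
    obtain ⟨φ, hφ, hx⟩ := h x
    exact ⟨φ, hφ, hx⟩

/-- Complete the square in the local potential, move its centre to the origin, rescale the constant
term to -1, 0 or 1, and apply `-id` if the half-space condition asks for it. -/
theorem exists_modelChart [T2Space M] [ConnectedSpace M] (hd : 2 ≤ d)
    (hst : IsStiffPair p conn) (hflat : ¬ IsFlat conn) (x : M) :
    ∃ (l : ℝ) (ν : ℤˣ) (φ : OpenPartialHomeomorph M (E d)), l ∈ ({-1, 0, 1} : Set ℝ) ∧
      IsModelChart p conn l ν φ ∧ x ∈ φ.source := by
  have hG := hst.1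
  have hs := hst.2
  let φ := chartAt (E d) x
  have hφ : φ ∈ (similarityGroupoid p d).maximalAtlas M :=
    StructureGroupoid.chart_mem_maximalAtlas _ x
  have hφm := mem_smooth_of_mem_similarity hφ
  have hx : x ∈ φ.source := mem_chart_source _ x
  have hdata := isProjData_of_stiff hd hs hφ hφm
  have hb := bCoef_ne_zero hd hst hflat hφ hx
  set y₀ := φ x with hy₀
  set β := bCoef p conn φ y₀ with hβ
  set a₀ := aForm conn φ y₀ with ha₀
  obtain ⟨r, hr, hball⟩ := Metric.isOpen_iff.1 φ.open_target y₀ (φ.map_source hx)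
  -- the vector representing `a₀`
  obtain ⟨α, hα⟩ : ∃ α : E d, ∀ v, a₀ v = sprod p α v := by
    refine ⟨∑ i, (eps p i * a₀ (ee i)) • ee i, fun v => ?_⟩
    conv_lhs => rw [sum_coord v]
    rw [sprod_comm, ← sform_apply, map_sum, map_sum]
    refine Finset.sum_congr rfl fun i _ => ?_
    rw [map_smul, map_smul, sform_apply, sprod_ee, smul_eq_mul, smul_eq_mul]
    linear_combination (-a₀ (ee i) * v i) * eps_mul_self p i
  let z : E d → E d := fun y => y - y₀ + β⁻¹ • α
  let l' : ℝ := -(q p α / β ^ 2 + 2 / β)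
  -- The shift `β⁻¹ α` absorbs the linear term; `l'` is then fixed by the value 1 of the potential
  -- at `y₀`.
  have hψ : ∀ y, locPot p a₀ β y₀ y = -(β / 2) * (q p (z y) + l') := by
    intro y
    simp only [locPot, z, l', hα]
    rw [q_add, sprod_smul_right, q_smul, sprod_comm p α]
    field_simp
    ring
  -- A zero of the potential would contradict `ψ b = β ≠ 0`.
  have hball0 : ∀ y ∈ Metric.ball y₀ r, q p (z y) + l' ≠ 0 := by
    intro y hy h0
    have := (hdata.locPot_eq hd hball hy).2
    rw [← hβ, ← ha₀, hψ, h0] at this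
    simp at this
    exact hb this.symm
  have hform : ∀ y ∈ Metric.ball y₀ r, ∀ v,
      aForm conn φ y v = -(2 * sprod p (z y) v) / (q p (z y) + l') := by
    intro y hy v
    have h1 := congrArg (fun L => L v) (hdata.locPot_eq hd hball hy).1
    simp only [smul_apply, add_apply, smul_eq_mul, ← hβ, ← ha₀, hψ, hα, sform_apply] at h1
    have h2 : sprod p (z y) v = sprod p (y - y₀) v + β⁻¹ * sprod p α v := by
      simp only [z, sprod_add_left, sprod_smul_left]
    have h0 := hball0 y hy
    rw [eq_div_iff h0, h2]
    field_simp
    linear_combination (-2) * h1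
  -- the scale
  obtain ⟨s, l, hs0, hl, hsl⟩ : ∃ s l : ℝ, 0 < s ∧ l ∈ ({-1, 0, 1} : Set ℝ) ∧ s ^ 2 * l' = l := by
    rcases lt_trichotomy l' 0 with h | h | h
    · refine ⟨(√(-l'))⁻¹, -1, inv_pos.2 (Real.sqrt_pos.2 (by linarith)), by simp, ?_⟩
      rw [inv_pow, Real.sq_sqrt (by linarith)]
      field_simp
      rw [div_self h.ne]
    · exact ⟨1, 0, one_pos, by simp, by simp [h]⟩
    · refine ⟨(√l')⁻¹, 1, inv_pos.2 (Real.sqrt_pos.2 h), by simp, ?_⟩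
      rw [inv_pow, Real.sq_sqrt h.le]
      field_simp
  have hy₀b : y₀ ∈ Metric.ball y₀ r := Metric.mem_ball_self hr
  have hpot : ∀ c : ℝ, c ^ 2 = s ^ 2 → ∀ y, potential p l (c • z y) = c ^ 2 * (q p (z y) + l') := by
    intro c hc y
    rw [potential, q_smul, ← hsl, ← hc]; ring
  obtain ⟨ν, hν⟩ : ∃ ν : ℤˣ, 0 < ((ν : ℤ) : ℝ) * potential p l (s • z y₀) := by
    have h0 : potential p l (s • z y₀) ≠ 0 := by
      rw [hpot s rfl]; exact mul_ne_zero (pow_ne_zero 2 hs0.ne') (hball0 y₀ hy₀b)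
    rcases lt_or_gt_of_ne h0 with h | h
    · exact ⟨-1, by simpa using h⟩
    · exact ⟨1, by simpa using h⟩
  obtain ⟨c, hc2, hcm⟩ : ∃ c : ℝ, c ^ 2 = s ^ 2 ∧ c • z y₀ ∈ modelDomain p d l ν := by
    rcases mem_modelDomain_or_neg hν with h | h
    · exact ⟨s, rfl, h⟩
    · exact ⟨-s, by ring, by rwa [neg_smul]⟩
  have hc : c ≠ 0 := fun h => by
    rw [h] at hc2
    have : s ^ 2 ≠ 0 := pow_ne_zero 2 hs0.ne'
    exact this (by rw [← hc2]; ring)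
  let b : E d := c • (β⁻¹ • α - y₀)
  have hz : ∀ y, c • y + b = c • z y := by
    intro y; simp only [b, z]; module
  let U : Set (E d) := Metric.ball y₀ r ∩ (fun y => c • y + b) ⁻¹' modelDomain p d l ν
  have hU : IsOpen U := Metric.isOpen_ball.inter
    ((isOpen_modelDomain l ν).preimage ((continuous_const_smul c).add continuous_const))
  let e := (homothety hc b).toOpenPartialHomeomorph.restrOpen U hU
  have he : e ∈ similarityGroupoid p d := homothety_restr_mem hc b hU
  have hφ₂ : φ ≫ₕ e ∈ (similarityGroupoid p d).maximalAtlas M := trans_mem_maximalAtlas hφ he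
  have hsrc : ∀ x', x' ∈ (φ ≫ₕ e).source ↔ x' ∈ φ.source ∧ φ x' ∈ U := by
    intro x'; simp [e]
  have happ : ∀ x', (φ ≫ₕ e) x' = c • φ x' + b := fun x' => rfl
  refine ⟨l, ν, φ ≫ₕ e, hl, ⟨hφ₂, ?_, ?_⟩, ?_⟩
  · intro y hy
    have h1 := (φ ≫ₕ e).map_target hy
    rw [← (φ ≫ₕ e).right_inv hy, happ]
    exact ((hsrc _).1 h1).2.2
  · intro y hy u v
    set x' := (φ ≫ₕ e).symm y with hx'
    have h1 : x' ∈ (φ ≫ₕ e).source := (φ ≫ₕ e).map_target hy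
    obtain ⟨hx'φ, hx'U⟩ := (hsrc _).1 h1
    have hyx : y = (φ ≫ₕ e) x' := ((φ ≫ₕ e).right_inv hy).symm
    have htrn : trn φ (φ ≫ₕ e) =ᶠ[𝓝 (φ x')] fun y => c • y + b := by
      filter_upwards [φ.open_target.mem_nhds (φ.map_source hx'φ)] with w hw
      rw [trn, happ, φ.right_inv hw]
    have hD : fderiv ℝ (trn φ (φ ≫ₕ e)) =ᶠ[𝓝 (φ x')]
        fun _ => c • ContinuousLinearMap.id ℝ (E d) := by
      filter_upwards [htrn.eventually_nhds] with w hw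
      rw [Filter.EventuallyEq.fderiv_eq hw]
      exact (((hasFDerivAt_id w).const_smul c).add_const b).fderiv
    have hD2 : fderiv ℝ (fderiv ℝ (trn φ (φ ≫ₕ e))) (φ x') = 0 := by
      rw [hD.fderiv_eq]; exact (hasFDerivAt_const (𝕜 := ℝ) _ _).fderiv
    have hlaw := christoffel_trn conn hφm (mem_smooth_of_mem_similarity hφ₂) hx'φ h1
      (c⁻¹ • u) (c⁻¹ • v)
    rw [hD2, hD.eq_of_nhds, ← hyx] at hlaw
    simp only [smul_apply, ContinuousLinearMap.id_apply, smul_smul, mul_inv_cancel₀ hc, one_smul,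
      zero_apply, sub_zero] at hlaw
    rw [hlaw, ← christoffelMap_apply conn hφm (φ.map_source hx'φ),
      christoffelMap_eq_projBilin hs hφ hφm (φ.map_source hx'φ), projBilin_apply,
      hform _ hx'U.1, hform _ hx'U.1, potentialChristoffel, fderiv_potential, fderiv_potential,
      hyx, happ, hz, hpot c hc2]
    have h0 := hball0 _ hx'U.1
    simp only [sprod_smul_left, sprod_smul_right, smul_add, smul_smul]
    congr 2 <;> field_simp
  · rw [hsrc]
    refine ⟨hx, hy₀b, ?_⟩
    show c • y₀ + b ∈ modelDomain p d l ν
    rw [hz]; exact hcm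

end ModelCharts

/-! ### Changes of model charts -/

section ModelChanges

theorem exists_notMem_span {d : ℕ} (hd : 2 ≤ d) (w y₀ : E d) {S : Set (E d)} (hS : S ∈ 𝓝 y₀) :
    ∃ y ∈ S, y ∉ Submodule.span ℝ {w} := by
  by_contra! h
  have htop : Submodule.span ℝ {w} = ⊤ :=
    Submodule.eq_top_of_nonempty_interior' _
      ⟨y₀, mem_interior_iff_mem_nhds.2 (Filter.mem_of_superset hS h)⟩
  have h1 := finrank_span_le_card (R := ℝ) ({w} : Set (E d))
  rw [htop, finrank_top, finrank_euclideanSpace_fin] at h1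
  simp at h1
  omega

variable {d : ℕ} {M : Type*} [TopologicalSpace M] [ChartedSpace (E d) M] [IsManifold (𝓡 d) ∞ M]
variable {φ φ' : OpenPartialHomeomorph M (E d)} {p : ℕ} {conn : Connection d M}
variable {l l' : ℝ} {ν ν' : ℤˣ} {x : M}

theorem IsModelChart.smooth (hφ : IsModelChart p conn l ν φ) :
    φ ∈ IsManifold.maximalAtlas (𝓡 d) ∞ M :=
  mem_smooth_of_mem_similarity hφ.1

theorem IsModelChart.potential_ne_zero (hφ : IsModelChart p conn l ν φ) (hx : x ∈ φ.source) :
    potential p l (φ x) ≠ 0 :=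
  StiffPair.potential_ne_zero (hφ.2.1 (φ.map_source hx))

theorem IsModelChart.christoffel_eq (hφ : IsModelChart p conn l ν φ) (hx : x ∈ φ.source)
    (u v : E d) :
    christoffel conn φ (φ x) u v = (-(2 * sprod p (φ x) v) / potential p l (φ x)) • u +
      (-(2 * sprod p (φ x) u) / potential p l (φ x)) • v := by
  rw [hφ.2.2 _ (φ.map_source hx), potentialChristoffel, fderiv_potential, fderiv_potential]

/-- The changes of model charts are linear. -/
theorem IsModelChart.exists_trn (hd : 2 ≤ d) (hG : HasGroupoid M (similarityGroupoid p d))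
    (hφ : IsModelChart p conn l ν φ) (hφ' : IsModelChart p conn l' ν' φ')
    (hx : x ∈ φ.source) (hx' : x ∈ φ'.source) :
    ∃ A s, IsSimTrn p φ φ' x A s 0 ∧ l' = s ^ 2 * l ∧ ν' = ν := by
  obtain ⟨A, s, b, h⟩ := exists_isSimTrn hG hφ.1 hφ'.1 hx hx'
  have hs := h.1.ne'
  obtain ⟨w, hw⟩ : ∃ w, s • A w = b := ⟨A.symm (s⁻¹ • b), by simp [smul_smul, hs]⟩
  -- the relation between the two potentials
  have hrel : ∀ z, z ∈ φ.source → z ∈ φ'.source → IsSimTrn p φ φ' z A s b →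
      (s ^ 2 * potential p l (φ z)) • (φ z + w) = potential p l' (φ' z) • φ z := by
    intro z hz hz' hzt
    have h0 := hφ.potential_ne_zero hz
    have h0' := hφ'.potential_ne_zero hz'
    refine ext_sprod (p := p) fun u => ?_
    by_cases hu : u = 0
    · rw [hu, sprod_zero_right, sprod_zero_right]
    have h1 := hzt.christoffel_eq conn hφ.smooth hφ'.smooth hz hz' u u
    rw [hφ.christoffel_eq hz, hφ'.christoffel_eq hz'] at h1
    have hy' : φ' z = s • A (φ z + w) := by rw [hzt.apply hz, map_add, smul_add, hw]
    have hAu : s • A u ≠ 0 := smul_ne_zero hs (A.map_ne_zero_iff.2 hu)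
    have h2 : (2 * (-(2 * sprod p (φ' z) (s • A u)) / potential p l' (φ' z) -
        -(2 * sprod p (φ z) u) / potential p l (φ z))) • (s • A u) = 0 := by
      simp only [map_add, map_smul] at h1
      linear_combination (norm := module) h1
    have h3 := (mul_eq_zero.1 ((smul_eq_zero.1 h2).resolve_right hAu)).resolve_left two_ne_zero
    have h4 : sprod p (φ' z) (s • A u) = s ^ 2 * sprod p (φ z + w) u := by
      rw [hy', sprod_smul_left, sprod_smul_right, sprod_map h.2.1]; ring
    rw [sub_eq_zero, div_eq_div_iff h0' h0, h4] at h3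
    rw [sprod_smul_left, sprod_smul_left]
    linear_combination (-1 / 2) * h3
  have hS : ∀ᶠ y in 𝓝 (φ x), y ∈ φ.target ∧ φ.symm y ∈ φ'.source ∧
      IsSimTrn p φ φ' (φ.symm y) A s b := by
    filter_upwards [φ.open_target.mem_nhds (φ.map_source hx),
      (tendsto_symm hx).eventually (h.eventually hx hx')] with y hy h1
    exact ⟨hy, h1.2⟩
  -- The relation makes a nonzero multiple of `w` a multiple of `y`. At a point off the line spanned
  -- by `w` both sides vanish: `w = 0` and `ψ' = s² ψ`.
  obtain ⟨y, ⟨hy, hyφ', hyt⟩, hspan⟩ := exists_notMem_span hd w (φ x) hS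
  have hyφ := φ.map_target hy
  have h1 := hrel _ hyφ hyφ' hyt
  have h0 := hφ.potential_ne_zero hyφ
  have happ := hyt.apply hyφ
  rw [φ.right_inv hy] at h1 h0 happ
  have hk : s ^ 2 * potential p l y ≠ 0 := mul_ne_zero (pow_ne_zero 2 hs) h0
  have h2 : (s ^ 2 * potential p l y) • w =
      (potential p l' (φ' (φ.symm y)) - s ^ 2 * potential p l y) • y := by
    rw [sub_smul, ← h1, smul_add]; abel
  have h3 : potential p l' (φ' (φ.symm y)) - s ^ 2 * potential p l y = 0 := by
    by_contra hne
    refine hspan (Submodule.mem_span_singleton.2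
      ⟨(potential p l' (φ' (φ.symm y)) - s ^ 2 * potential p l y)⁻¹ * (s ^ 2 * potential p l y), ?_⟩)
    rw [mul_smul, h2, smul_smul, inv_mul_cancel₀ hne, one_smul]
  have hw0 : w = 0 := by
    rw [h3, zero_smul] at h2
    exact (smul_eq_zero.1 h2).resolve_left hk
  have hb : b = 0 := by rw [← hw, hw0, map_zero, smul_zero]
  subst hb
  have hl : l' = s ^ 2 * l := by
    rw [happ, add_zero, potential, potential, q_smul, h.2.1] at h3
    linarith
  refine ⟨A, s, h, hl, ?_⟩
  have h4 := (hφ.2.1 (φ.map_source hx)).1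
  have h5 := (hφ'.2.1 (φ'.map_source hx')).1
  have h6 : potential p l' (φ' x) = s ^ 2 * potential p l (φ x) := by
    rw [h.apply hx, add_zero, potential, potential, q_smul, h.2.1, hl]; ring
  rw [h6] at h5
  have h7 := pow_pos h.1 2
  have h8 : 0 < (((ν' : ℤ) : ℝ) * potential p l (φ x)) := by
    refine pos_of_mul_pos_right (a := s ^ 2) ?_ h7.le
    linarith
  rcases Int.units_eq_one_or ν with rfl | rfl <;> rcases Int.units_eq_one_or ν' with rfl | rfl <;>
    simp at h4 h8 ⊢ <;> linarith

theorem eq_of_eq_sq_mul {s : ℝ} (hs : 0 < s) (hl : l ∈ ({-1, 0, 1} : Set ℝ))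
    (hl' : l' ∈ ({-1, 0, 1} : Set ℝ)) (h : l' = s ^ 2 * l) : l' = l := by
  have h2 := pow_pos hs 2
  simp only [mem_insert_iff, mem_singleton_iff] at hl hl'
  rcases hl with rfl | rfl | rfl <;> rcases hl' with rfl | rfl | rfl <;> linarith

/-- There is a unique associated canonical model. -/
theorem existsUnique_model [T2Space M] [ConnectedSpace M] (hd : 2 ≤ d)
    (hst : IsStiffPair p conn) (hflat : ¬ IsFlat conn) :
    ∃! m : ℝ × ℤˣ, m.1 ∈ ({-1, 0, 1} : Set ℝ) ∧ IsModelledOn p conn m.1 m.2 := by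
  -- For admissible `m` these sets are open, pairwise disjoint and cover `M`, so a nonempty one is
  -- everything.
  let S : ℝ × ℤˣ → Set M := fun m => {x | ∃ φ, IsModelChart p conn m.1 m.2 φ ∧ x ∈ φ.source}
  have hSopen : ∀ m, IsOpen (S m) := by
    intro m
    rw [isOpen_iff_mem_nhds]
    rintro x ⟨φ, hφ, hx⟩
    filter_upwards [φ.open_source.mem_nhds hx] with y hy
    exact ⟨φ, hφ, hy⟩
  have huniq : ∀ (x : M) (m m' : ℝ × ℤˣ), m.1 ∈ ({-1, 0, 1} : Set ℝ) →
      m'.1 ∈ ({-1, 0, 1} : Set ℝ) → x ∈ S m → x ∈ S m' → m' = m := by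
    rintro x m m' hm hm' ⟨φ, hφ, hx⟩ ⟨φ', hφ', hx'⟩
    obtain ⟨A, s, h, hl, hν⟩ := hφ.exists_trn hd hst.1 hφ' hx hx'
    exact Prod.ext (eq_of_eq_sq_mul h.1 hm hm' hl) hν
  obtain ⟨x₀⟩ : Nonempty M := inferInstance
  obtain ⟨l₀, ν₀, φ₀, hl₀, hφ₀, hx₀⟩ := exists_modelChart hd hst hflat x₀
  have hclosed : IsClosed (S (l₀, ν₀)) := by
    rw [← isOpen_compl_iff, isOpen_iff_mem_nhds]
    intro x hx
    obtain ⟨l, ν, φ, hl, hφ, hxφ⟩ := exists_modelChart hd hst hflat x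
    filter_upwards [φ.open_source.mem_nhds hxφ] with y hy h
    have := huniq y (l, ν) (l₀, ν₀) hl hl₀ ⟨φ, hφ, hy⟩ h
    exact hx (by rw [this]; exact ⟨φ, hφ, hxφ⟩)
  have huniv : S (l₀, ν₀) = univ :=
    IsClopen.eq_univ ⟨hclosed, hSopen _⟩ ⟨x₀, φ₀, hφ₀, hx₀⟩
  refine ⟨(l₀, ν₀), ⟨hl₀, isModelledOn_iff.2 fun x => ?_⟩, fun m ⟨hm, hmod⟩ => ?_⟩
  · have : x ∈ S (l₀, ν₀) := by rw [huniv]; trivial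
    exact this
  · exact huniq x₀ _ _ hl₀ hm ⟨φ₀, hφ₀, hx₀⟩ (isModelledOn_iff.1 hmod x₀)

end ModelChanges

/-! ### Isometric changes of charts -/

section Isometric

section Extrema
variable {p d : ℕ} {a : E d → E d →L[ℝ] ℝ} {b : E d → ℝ} {U : Set (E d)} {y₀ : E d}

/-- At an extremum `db = b a` forces `a = 0`, so the potential loses its linear term and `b` becomes
an explicit function of `q(y - y₀)`. -/
theorem IsProjData.eventually_of_isLocalExtr (hd : 2 ≤ d) (h : IsProjData p a b U)
    (hy₀ : y₀ ∈ U) (hb : b y₀ ≠ 0) (hext : IsLocalExtr b y₀) :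
    ∀ᶠ y in 𝓝 y₀, 0 < 1 - b y₀ / 2 * q p (y - y₀) ∧
      (1 - b y₀ / 2 * q p (y - y₀)) * b y = b y₀ := by
  have ha : a y₀ = 0 := by
    ext v
    have h1 := h.fderiv_b hd hy₀ v
    rw [hext.fderiv_eq_zero] at h1
    exact (mul_eq_zero.1 h1.symm).resolve_left hb
  obtain ⟨r, hr, hball⟩ := Metric.isOpen_iff.1 h.isOpen y₀ hy₀
  have hpos : ∀ᶠ y in 𝓝 y₀, 0 < locPot p (a y₀) (b y₀) y₀ y :=
    (hasFDerivAt_locPot _ _ _ _).continuousAt.eventually_const_lt (by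
      rw [locPot_self]; exact one_pos)
  filter_upwards [hpos, Metric.ball_mem_nhds y₀ hr] with y h1 h2
  have h3 := (h.locPot_eq hd hball h2).2
  have h4 : locPot p (a y₀) (b y₀) y₀ y = 1 - b y₀ / 2 * q p (y - y₀) := by
    rw [locPot, ha, zero_apply, sub_zero]
  rw [h4] at h1 h3
  exact ⟨h1, h3⟩

theorem exists_q_line {P : ℝ → Prop} (h : ∀ᶠ y in 𝓝 y₀, P (q p (y - y₀))) (i : Fin d) :
    ∃ t : ℝ, 0 < t ∧ P (t * eps p i) := by
  have hc : Tendsto (fun t : ℝ => y₀ + t • ee i) (𝓝[≠] 0) (𝓝 y₀) := by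
    have : Continuous fun t : ℝ => y₀ + t • (ee i : E d) := by fun_prop
    simpa using (this.tendsto 0).mono_left nhdsWithin_le_nhds
  obtain ⟨t, ht, ht0⟩ := ((hc.eventually h).and self_mem_nhdsWithin).exists
  refine ⟨t ^ 2, by have : t ≠ 0 := ht0; positivity, ?_⟩
  rwa [add_sub_cancel_left, q_smul, q_ee] at ht

/-- Multiplying `b ≤ b₀` by the positive potential gives `b₀² q(y - y₀) ≤ 0` near `y₀`; the
direction `e_i` then reads off `ε_i`. -/
theorem IsProjData.eps_nonpos_of_isLocalMax (hd : 2 ≤ d) (h : IsProjData p a b U)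
    (hy₀ : y₀ ∈ U) (hb : b y₀ ≠ 0) (hext : IsLocalMax b y₀) (i : Fin d) : eps p i ≤ 0 := by
  have h1 : ∀ᶠ y in 𝓝 y₀, q p (y - y₀) ≤ 0 := by
    filter_upwards [h.eventually_of_isLocalExtr hd hy₀ hb hext.isExtr, hext] with y h1 h2
    have := mul_le_mul_of_nonneg_left h2 h1.1.le
    rw [h1.2] at this
    have hb2 : 0 < b y₀ ^ 2 := by positivity
    nlinarith
  obtain ⟨t, ht, h2⟩ := exists_q_line (P := (· ≤ 0)) h1 i
  exact nonpos_of_mul_nonpos_right h2 ht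

theorem IsProjData.eps_nonneg_of_isLocalMin (hd : 2 ≤ d) (h : IsProjData p a b U)
    (hy₀ : y₀ ∈ U) (hb : b y₀ ≠ 0) (hext : IsLocalMin b y₀) (i : Fin d) : 0 ≤ eps p i := by
  have h1 : ∀ᶠ y in 𝓝 y₀, 0 ≤ q p (y - y₀) := by
    filter_upwards [h.eventually_of_isLocalExtr hd hy₀ hb hext.isExtr, hext] with y h1 h2
    have := mul_le_mul_of_nonneg_left h2 h1.1.le
    rw [h1.2] at this
    have hb2 : 0 < b y₀ ^ 2 := by positivity
    nlinarith
  obtain ⟨t, ht, h2⟩ := exists_q_line (P := (0 ≤ ·)) h1 i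
  exact nonneg_of_mul_nonneg_right h2 ht

end Extrema

variable {d : ℕ} {M : Type*} [TopologicalSpace M] [ChartedSpace (E d) M] [IsManifold (𝓡 d) ∞ M]
variable {p : ℕ} {conn : Connection d M}

/-- A non flat stiff connection on a compact connected manifold is not stiff for an atlas whose
changes of charts are isometries. -/
theorem false_of_isometric_changes [T2Space M] [ConnectedSpace M] [CompactSpace M] (hd : 2 ≤ d)
    (hst : IsStiffPair p conn) (hflat : ¬ IsFlat conn)
    {𝒜 : Set (OpenPartialHomeomorph M (E d))} (h𝒜 : 𝒜 ⊆ (similarityGroupoid p d).maximalAtlas M)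
    (hcov : ∀ x : M, ∃ φ ∈ 𝒜, x ∈ φ.source) (hs : IsStiff p 𝒜 conn)
    (hiso : ∀ φ ∈ 𝒜, ∀ φ' ∈ 𝒜, ∀ x ∈ φ.source, x ∈ φ'.source →
      ∃ A b, IsSimTrn p φ φ' x A 1 b) : False := by
  choose ch hch hmem using hcov
  have hdata : ∀ φ ∈ 𝒜, IsProjData p (aForm conn φ) (bCoef p conn φ) φ.target := fun φ hφ =>
    isProjData_of_stiff hd hs hφ (mem_smooth_of_mem_similarity (h𝒜 hφ))
  -- Independent of the chart in `𝒜`, since all ratios are 1.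
  let β : M → ℝ := fun x => bCoef p conn (ch x) (ch x x)
  have hβ : ∀ φ ∈ 𝒜, ∀ x ∈ φ.source, bCoef p conn φ (φ x) = β x := by
    intro φ hφ x hx
    obtain ⟨A, b, h⟩ := hiso φ hφ _ (hch x) x hx (hmem x)
    have := h.bCoef_eq hd hs hφ (hch x) (mem_smooth_of_mem_similarity (h𝒜 hφ))
      (mem_smooth_of_mem_similarity (h𝒜 (hch x))) hx (hmem x)
    rw [this, one_pow, one_mul]
  have hcont : Continuous β := by
    rw [continuous_iff_continuousAt]
    intro x
    have h1 : ContinuousAt (fun z => bCoef p conn (ch x) (ch x z)) x :=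
      ContinuousAt.comp (f := ch x) ((hdata _ (hch x)).differentiableAt_b hd
        ((ch x).map_source (hmem x))).continuousAt ((ch x).continuousAt (hmem x))
    refine h1.congr ?_
    filter_upwards [(ch x).open_source.mem_nhds (hmem x)] with z hz
    exact hβ _ (hch x) z hz
  have hlocal : ∀ x, ∀ᶠ y in 𝓝 (ch x x), bCoef p conn (ch x) y = β ((ch x).symm y) := by
    intro x
    filter_upwards [(ch x).open_target.mem_nhds ((ch x).map_source (hmem x))] with y hy
    rw [← hβ _ (hch x) _ ((ch x).map_target hy), (ch x).right_inv hy]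
  have hne : ∀ x, bCoef p conn (ch x) (ch x x) ≠ 0 := fun x =>
    bCoef_ne_zero hd hst hflat (h𝒜 (hch x)) (hmem x)
  obtain ⟨x₁, -, h₁⟩ := isCompact_univ.exists_isMaxOn (univ_nonempty (α := M)) hcont.continuousOn
  obtain ⟨x₂, -, h₂⟩ := isCompact_univ.exists_isMinOn (univ_nonempty (α := M)) hcont.continuousOn
  have hmax : IsLocalMax (bCoef p conn (ch x₁)) (ch x₁ x₁) := by
    filter_upwards [hlocal x₁] with y hy
    rw [hy]; exact h₁ (mem_univ _)
  have hmin : IsLocalMin (bCoef p conn (ch x₂)) (ch x₂ x₂) := by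
    filter_upwards [hlocal x₂] with y hy
    rw [hy]; exact h₂ (mem_univ _)
  obtain ⟨i, -, -⟩ := exists_two_indices hd
  have e1 := (hdata _ (hch x₁)).eps_nonpos_of_isLocalMax hd ((ch x₁).map_source (hmem x₁))
    (hne x₁) hmax i
  have e2 := (hdata _ (hch x₂)).eps_nonneg_of_isLocalMin hd ((ch x₂).map_source (hmem x₂))
    (hne x₂) hmin i
  exact eps_ne_zero p i (le_antisymm e1 e2)

theorem not_isIsometryStiffPair [T2Space M] [ConnectedSpace M] [CompactSpace M] (hd : 2 ≤ d)
    (hst : IsStiffPair p conn) (hflat : ¬ IsFlat conn) : ¬ IsIsometryStiffPair p conn := by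
  rintro ⟨𝒜, h𝒜, hcov, hiso, hs⟩
  refine false_of_isometric_changes hd hst hflat h𝒜 hcov hs fun φ hφ φ' hφ' x hx hx' => ?_
  obtain ⟨g, ⟨A, b, hA, hg⟩, hfg⟩ := (mem_groupoid_of_pregroupoid.1 (hiso φ hφ φ' hφ')).1 (φ x)
    (by simp [hx, hx'])
  exact ⟨A, b, one_pos, hA, hfg.trans (Eventually.of_forall fun y => by simp only [hg, one_smul])⟩

theorem IsStiff.mono {𝒜 ℬ : Set (OpenPartialHomeomorph M (E d))} (h : IsStiff p ℬ conn)
    (hsub : 𝒜 ⊆ ℬ) : IsStiff p 𝒜 conn :=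
  ⟨h.smooth, fun φ hφ => h.symmetric φ (hsub hφ), fun φ hφ => h.straight φ (hsub hφ),
    fun φ hφ => h.holonomy φ (hsub hφ)⟩

/-- Changes of model charts satisfy `l = s² l`. If `l ≠ 0` they are isometries, which compactness
forbids. -/
theorem IsModelledOn.eq_zero [T2Space M] [ConnectedSpace M] [CompactSpace M] (hd : 2 ≤ d)
    (hst : IsStiffPair p conn) (hflat : ¬ IsFlat conn) {l : ℝ} {ν : ℤˣ}
    (h : IsModelledOn p conn l ν) : l = 0 := by
  by_contra hl
  refine false_of_isometric_changes (𝒜 := {φ | IsModelChart p conn l ν φ}) hd hst hflat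
    (fun φ hφ => hφ.1) (isModelledOn_iff.1 h) (hst.2.mono fun φ hφ => hφ.1)
    fun φ hφ φ' hφ' x hx hx' => ?_
  obtain ⟨A, s, hA, hs, -⟩ := IsModelChart.exists_trn hd hst.1 hφ hφ' hx hx'
  have h1 : s ^ 2 = 1 := mul_right_cancel₀ hl (by rw [← hs, one_mul])
  have h2 : s = 1 := by nlinarith [hA.1]
  exact ⟨A, 0, h2 ▸ hA⟩

end Isometric

/-! ### The Euler vector field -/

section Euler

variable {d : ℕ} {M : Type*} [TopologicalSpace M] [ChartedSpace (E d) M] [IsManifold (𝓡 d) ∞ M]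
variable {φ φ' : OpenPartialHomeomorph M (E d)} {p : ℕ} {conn : Connection d M}
variable {ν : ℤˣ} {x : M}

theorem potential_zero (y : E d) : potential p 0 y = q p y := by rw [potential, add_zero]

theorem IsModelChart.q_ne_zero (hφ : IsModelChart p conn 0 ν φ) (hx : x ∈ φ.source) :
    q p (φ x) ≠ 0 := by
  rw [← potential_zero]; exact hφ.potential_ne_zero hx

theorem IsModelChart.exists_linear_trn (hd : 2 ≤ d) (hG : HasGroupoid M (similarityGroupoid p d))
    (hφ : IsModelChart p conn 0 ν φ) (hφ' : IsModelChart p conn 0 ν φ')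
    (hx : x ∈ φ.source) (hx' : x ∈ φ'.source) : ∃ A s, IsSimTrn p φ φ' x A s 0 := by
  obtain ⟨A, s, h, -⟩ := hφ.exists_trn hd hG hφ' hx hx'
  exact ⟨A, s, h⟩

/-- The Euler field `y ↦ y` is invariant under linear changes of charts, and `q ≠ 0` on the model
keeps it away from the origin. -/
theorem exists_vectorField (hd : 2 ≤ d) (hG : HasGroupoid M (similarityGroupoid p d))
    (hmod : IsModelledOn p conn 0 ν) :
    ∃ X : Π x : M, TangentSpace (𝓡 d) x,
      ContMDiff (𝓡 d) (𝓡 d).tangent ∞ (fun x => (⟨x, X x⟩ : TangentBundle (𝓡 d) M)) ∧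
      ∀ x, X x ≠ 0 := by
  choose ch hch hmem using isModelledOn_iff.1 hmod
  have hX : ∀ (φ : OpenPartialHomeomorph M (E d)) (x : M), IsModelChart p conn 0 ν φ →
      x ∈ φ.source → pullField (ch x) id x = pullField φ id x := by
    intro φ x hφ hx
    obtain ⟨A, s, h⟩ := hφ.exists_linear_trn hd hG (hch x) hx (hmem x)
    have h1 := chartField_trn hφ.smooth (hch x).smooth hx (hmem x) (φ x)
    rw [h.fderiv_apply] at h1
    rw [pullField, pullField, id, id, ← h1, h.apply hx, add_zero]
  refine ⟨fun x => pullField (ch x) id x, fun x => ?_, fun x h0 => ?_⟩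
  · refine (contMDiffAt_pullField (W := id) (hch x).smooth (hmem x)
      contDiffAt_id).congr_of_eventuallyEq ?_
    filter_upwards [(ch x).open_source.mem_nhds (hmem x)] with y hy
    rw [hX _ y (hch x) hy]
  · have h1 := chartD_chartField (hch x).smooth (hmem x) (ch x x)
    change chartD (ch x) x (pullField (ch x) id x) = ch x x at h1
    have h2 : pullField (ch x) id x = 0 := h0
    rw [h2, map_zero] at h1
    exact (hch x).q_ne_zero (hmem x) (by rw [← h1, q_zero])

end Euler

/-! ### Incompleteness -/

section Incomplete

theorem hasDerivAt_sprod {p d : ℕ} {f g : ℝ → E d} {f' g' : E d} {t : ℝ} (hf : HasDerivAt f f' t)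
    (hg : HasDerivAt g g' t) :
    HasDerivAt (fun s => sprod p (f s) (g s)) (sprod p f' (g t) + sprod p (f t) g') t := by
  have hc : ∀ {f : ℝ → E d} {f' : E d}, HasDerivAt f f' t → ∀ i : Fin d,
      HasDerivAt (fun s => f s i) (f' i) t := fun h i =>
    (EuclideanSpace.proj i : E d →L[ℝ] ℝ).hasFDerivAt.comp_hasDerivAt t h
  have := HasDerivAt.fun_sum (u := Finset.univ) fun i _ =>
    ((hc hf i).mul (hc hg i)).const_mul (eps p i)
  refine this.congr_deriv ?_
  simp only [sprod, ← Finset.sum_add_distrib, mul_add]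

/-- A solution on `ℝ` of `c' = 3 c² + δ`, `δ' = 4 c δ` with `δ 0 = 0` has `c 0 ≤ 0`. -/
theorem not_pos_of_riccati {c δ : ℝ → ℝ} (hc : ∀ t, HasDerivAt c (3 * c t ^ 2 + δ t) t)
    (hδ : ∀ t, HasDerivAt δ (4 * c t * δ t) t) (h0 : δ 0 = 0) : ¬ 0 < c 0 := by
  intro hpos
  have hcc : Continuous c := continuous_iff_continuousAt.2 fun t => (hc t).continuousAt
  -- Integrating factor for the linear equation of `δ`, showing `δ = 0`.
  let C : ℝ → ℝ := fun t => ∫ s in (0 : ℝ)..t, 4 * c s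
  have hC : ∀ t, HasDerivAt C (4 * c t) t := fun t =>
    (hcc.const_mul 4).integral_hasStrictDerivAt 0 t |>.hasDerivAt
  have hδ0 : ∀ t, δ t = 0 := by
    intro t
    have h1 : ∀ s, HasDerivAt (fun s => δ s * Real.exp (-C s)) 0 s := fun s => by
      refine ((hδ s).mul (hC s).neg.exp).congr_deriv ?_
      ring
    have h2 := is_const_of_deriv_eq_zero (fun s => (h1 s).differentiableAt)
      (fun s => (h1 s).deriv) t 0
    simp only [h0, zero_mul] at h2
    exact (mul_eq_zero.1 h2).resolve_right (Real.exp_pos _).ne'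
  have hc' : ∀ t, HasDerivAt c (3 * c t ^ 2) t := fun t => by
    have := hc t; rwa [hδ0, add_zero] at this
  have hmono : Monotone c := monotone_of_deriv_nonneg (fun t => (hc' t).differentiableAt)
    fun t => by rw [(hc' t).deriv]; positivity
  have hinv : ∀ t, 0 < t → HasDerivAt (fun s => (c s)⁻¹) (-3) t := fun t ht => by
    have : c t ≠ 0 := (hpos.trans_le (hmono ht.le)).ne'
    refine ((hc' t).inv this).congr_deriv ?_
    field_simp
  have hT : 0 < (c 0)⁻¹ := inv_pos.2 hpos
  have hcont : ContinuousOn (fun s => (c s)⁻¹) (Icc 0 (c 0)⁻¹) := fun t ht =>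
    (hcc.continuousAt.inv₀ (hpos.trans_le (hmono ht.1)).ne').continuousWithinAt
  -- `1/c` has slope -3, so at time `1/c(0)` it would equal `-2/c(0)`, although `c` stays positive.
  obtain ⟨t, ht, h⟩ := exists_hasDerivAt_eq_slope (fun s => (c s)⁻¹) (fun _ => -3) hT hcont
    fun t ht => hinv t ht.1
  have h1 : 0 < (c (c 0)⁻¹)⁻¹ := inv_pos.2 (hpos.trans_le (hmono hT.le))
  rw [sub_zero, eq_div_iff hT.ne'] at h
  linarith

variable {d : ℕ} {M : Type*} [TopologicalSpace M] [ChartedSpace (E d) M] [IsManifold (𝓡 d) ∞ M]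
variable {φ φ' : OpenPartialHomeomorph M (E d)} {p : ℕ} {conn : Connection d M}
variable {ν : ℤˣ} {γ : ℝ → M} {t : ℝ}

/-- The logarithmic radial velocity `x·x' / q(x)` of a curve in a chart. -/
def radVel (p : ℕ) (φ : OpenPartialHomeomorph M (E d)) (γ : ℝ → M) (t : ℝ) : ℝ :=
  sprod p (φ (γ t)) (deriv (fun s => φ (γ s)) t) / q p (φ (γ t))

/-- The quotient `q(x') / q(x)` along a curve in a chart. -/
def energy (p : ℕ) (φ : OpenPartialHomeomorph M (E d)) (γ : ℝ → M) (t : ℝ) : ℝ :=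
  q p (deriv (fun s => φ (γ s)) t) / q p (φ (γ t))

theorem eventually_curve_mem_source (hγ : IsGeodesicOn conn γ univ) (ht : γ t ∈ φ.source) :
    ∀ᶠ s in 𝓝 t, γ s ∈ φ.source :=
  ((hγ.1.contMDiffAt univ_mem).continuousAt (x := t)).eventually (φ.open_source.mem_nhds ht)

theorem hasDerivAt_chart_curve (hγ : IsGeodesicOn conn γ univ)
    (hφ : φ ∈ IsManifold.maximalAtlas (𝓡 d) ∞ M) (ht : γ t ∈ φ.source) :
    HasDerivAt (fun s => φ (γ s)) (deriv (fun s => φ (γ s)) t) t :=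
  ((geodesic_contDiffAt hγ isOpen_univ hφ (mem_univ t) ht).differentiableAt
    (by norm_num)).hasDerivAt

/-- Both quotients are homogeneous of degree 0 under `x ↦ s A x`, so they are functions of time
along the whole geodesic, whatever charts it crosses. -/
theorem radVel_energy_eq (hd : 2 ≤ d) (hG : HasGroupoid M (similarityGroupoid p d))
    (hγ : IsGeodesicOn conn γ univ)
    (hφ : IsModelChart p conn 0 ν φ) (hφ' : IsModelChart p conn 0 ν φ')
    (ht : γ t ∈ φ.source) (ht' : γ t ∈ φ'.source) :
    radVel p φ' γ t = radVel p φ γ t ∧ energy p φ' γ t = energy p φ γ t := by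
  obtain ⟨A, s, h⟩ := hφ.exists_linear_trn hd hG hφ' ht ht'
  have hs := h.1.ne'
  have h1 : (fun r => φ' (γ r)) =ᶠ[𝓝 t] fun r => s • A (φ (γ r)) := by
    have hc : ContinuousAt γ t := (hγ.1.contMDiffAt univ_mem).continuousAt
    filter_upwards [hc.eventually (h.eventually ht ht')] with r hr
    rw [hr.2.2.apply hr.1, add_zero]
  have h2 : deriv (fun r => φ' (γ r)) t = s • A (deriv (fun r => φ (γ r)) t) := by
    rw [h1.deriv_eq]
    exact (((A.toContinuousLinearEquiv : E d →L[ℝ] E d).hasFDerivAt.comp_hasDerivAt t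
      (hasDerivAt_chart_curve hγ hφ.smooth ht)).const_smul s).deriv
  have h3 : φ' (γ t) = s • A (φ (γ t)) := h1.eq_of_nhds
  have h0 := hφ.q_ne_zero ht
  constructor
  · rw [radVel, radVel, h2, h3, sprod_smul_left, sprod_smul_right, sprod_map h.2.1, q_smul, h.2.1]
    field_simp
  · rw [energy, energy, h2, h3, q_smul, q_smul, h.2.1, h.2.1]
    field_simp

/-- In the model, `a(x') = -2 x·x'/q(x)`, so the geodesic equation reads `x'' = 4 c x'` with `c` the
radial velocity; the quotient rule does the rest. -/
theorem hasDerivAt_radVel_energy (hγ : IsGeodesicOn conn γ univ)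
    (hφ : IsModelChart p conn 0 ν φ) (ht : γ t ∈ φ.source) :
    HasDerivAt (radVel p φ γ) (energy p φ γ t + 2 * radVel p φ γ t ^ 2) t ∧
    HasDerivAt (energy p φ γ) (6 * radVel p φ γ t * energy p φ γ t) t := by
  have h1 := hasDerivAt_chart_curve hγ hφ.smooth ht
  have h2 : HasDerivAt (deriv fun s => φ (γ s))
      ((4 * radVel p φ γ t) • deriv (fun s => φ (γ s)) t) t := by
    have hC := geodesic_contDiffAt hγ isOpen_univ hφ.smooth (mem_univ t) ht
    have h3 : DifferentiableAt ℝ (deriv fun s => φ (γ s)) t := by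
      have h4 : ContDiffAt ℝ 1 (fderiv ℝ fun s => φ (γ s)) t :=
        hC.fderiv_right (m := 1) (by norm_num)
      exact (h4.differentiableAt (by norm_num)).clm_apply (differentiableAt_const 1)
    refine h3.hasDerivAt.congr_deriv ?_
    rw [hγ.2 φ hφ.smooth t (mem_univ t) ht, hφ.christoffel_eq ht, potential_zero, radVel]
    module
  have h0 := hφ.q_ne_zero ht
  have hq := hasDerivAt_sprod (p := p) h1 h1
  have hq' := hasDerivAt_sprod (p := p) h2 h2
  have hc := hasDerivAt_sprod (p := p) h1 h2
  have h0' : sprod p (φ (γ t)) (φ (γ t)) ≠ 0 := h0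
  constructor
  · refine (hc.div hq h0').congr_deriv ?_
    simp only [radVel, energy, q, sprod_smul_right,
      sprod_comm p (deriv (fun s => φ (γ s)) t) (φ (γ t))]
    field_simp
    ring
  · refine (hq'.div hq h0').congr_deriv ?_
    simp only [radVel, energy, q, sprod_smul_right, sprod_smul_left,
      sprod_comm p (deriv (fun s => φ (γ s)) t) (φ (γ t))]
    field_simp
    ring

theorem not_isGeodesicallyComplete [T2Space M] [Nonempty M] (hd : 2 ≤ d)
    (hst : IsStiffPair p conn) (hmod : IsModelledOn p conn 0 ν) :
    ¬ IsGeodesicallyComplete conn := by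
  intro hcomp
  choose ch hch hmem using isModelledOn_iff.1 hmod
  obtain ⟨x₀⟩ : Nonempty M := inferInstance
  obtain ⟨ε, γ₀, hε, hγ₀, hmaps, h00, hd0⟩ := exists_geodesic conn hst.2.smooth (hch x₀).smooth
    ((ch x₀).map_source (hmem x₀)) (ch x₀ x₀)
  obtain ⟨γ, hγ, heq⟩ := hcomp (Ioo (-ε) ε) γ₀ isOpen_Ioo ordConnected_Ioo
    ⟨0, by simpa using hε⟩ hγ₀
  have h0mem : (0 : ℝ) ∈ Ioo (-ε) ε := by simpa using hε
  let c : ℝ → ℝ := fun t => radVel p (ch (γ t)) γ t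
  let e : ℝ → ℝ := fun t => energy p (ch (γ t)) γ t
  have hloc : ∀ (φ : OpenPartialHomeomorph M (E d)) (t : ℝ), IsModelChart p conn 0 ν φ →
      γ t ∈ φ.source → c t = radVel p φ γ t ∧ e t = energy p φ γ t := fun φ t hφ ht =>
    radVel_energy_eq hd hst.1 hγ hφ (hch _) ht (hmem _)
  have hder : ∀ t, HasDerivAt c (e t + 2 * c t ^ 2) t ∧ HasDerivAt e (6 * c t * e t) t := by
    intro t
    obtain ⟨h1, h2⟩ := hasDerivAt_radVel_energy hγ (hch (γ t)) (hmem (γ t))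
    have hev : ∀ᶠ s in 𝓝 t, c s = radVel p (ch (γ t)) γ s ∧ e s = energy p (ch (γ t)) γ s := by
      filter_upwards [eventually_curve_mem_source hγ (hmem (γ t))] with s hs
      exact hloc _ s (hch _) hs
    exact ⟨h1.congr_of_eventuallyEq (hev.mono fun _ h => h.1),
      h2.congr_of_eventuallyEq (hev.mono fun _ h => h.2)⟩
  have hx0 : γ 0 ∈ (ch x₀).source := by rw [← heq h0mem]; exact hmaps h0mem
  have hchart : (fun s => ch x₀ (γ s)) =ᶠ[𝓝 0] fun s => ch x₀ (γ₀ s) := by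
    filter_upwards [isOpen_Ioo.mem_nhds h0mem] with s hs
    rw [heq hs]
  have hderiv : deriv (fun s => ch x₀ (γ s)) 0 = ch x₀ x₀ := by rw [hchart.deriv_eq, hd0]
  have hval : ch x₀ (γ 0) = ch x₀ x₀ := by rw [hchart.eq_of_nhds, h00]
  have hq := (hch x₀).q_ne_zero (hmem x₀)
  have hc0 : c 0 = 1 := by
    rw [(hloc _ 0 (hch x₀) hx0).1, radVel, hderiv, hval]; exact div_self hq
  have he0 : e 0 = 1 := by
    rw [(hloc _ 0 (hch x₀) hx0).2, energy, hderiv, hval]; exact div_self hq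
  -- The initial velocity is the Euler vector, so `c(0) = e(0) = 1`; `e - c²` measures the deviation
  -- from radial motion and starts at 0.
  refine not_pos_of_riccati (c := c) (δ := fun t => e t - c t ^ 2) (fun t => ?_) (fun t => ?_)
    (by simp [hc0, he0]) (by rw [hc0]; exact one_pos)
  · exact (hder t).1.congr_deriv (by ring)
  · refine ((hder t).2.sub ((hder t).1.pow 2)).congr_deriv ?_
    push_cast
    ring

end Incomplete

/-! ### Volume forms -/

section Volume

section AlternatingForms
variable {d : ℕ} (G : E d [⋀^Fin d]→ₗ[ℝ] ℝ)

theorem alternating_eq_smul_det :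
    G = G (fun i => ee i) • (EuclideanSpace.basisFun (Fin d) ℝ).toBasis.det := by
  have h := G.eq_smul_basis_det (EuclideanSpace.basisFun (Fin d) ℝ).toBasis
  have e : ⇑(EuclideanSpace.basisFun (Fin d) ℝ).toBasis = fun i => (ee i : E d) := by
    ext1 i
    rw [OrthonormalBasis.coe_toBasis, EuclideanSpace.basisFun_apply, ee]
  rwa [e] at h

theorem alternating_map (B : E d →ₗ[ℝ] E d) :
    G (fun i => B (ee i)) = LinearMap.det B * G fun i => ee i := by
  have h1 : ∀ v : Fin d → E d, G v =
      G (fun i => ee i) * (EuclideanSpace.basisFun (Fin d) ℝ).toBasis.det v := fun v =>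
    congrArg (fun F : E d [⋀^Fin d]→ₗ[ℝ] ℝ => F v) (alternating_eq_smul_det G)
  rw [h1 fun i => B (ee i)]
  have h2 := (EuclideanSpace.basisFun (Fin d) ℝ).toBasis.det_comp B fun i => ee i
  have h3 := h1 fun i => ee i
  change (EuclideanSpace.basisFun (Fin d) ℝ).toBasis.det (fun i => B (ee i)) = _ at h2
  rw [h2]
  linear_combination (-LinearMap.det B) * h3

/-- Applied to `v = B e_i` and summed over `i`, this produces the trace of `B`. -/
theorem alternating_update (i : Fin d) (v : E d) :
    G (Function.update (fun j => ee j) i v) = v i * G fun j => ee j := by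
  classical
  conv_lhs => rw [sum_coord v]
  rw [G.map_update_sum, Finset.sum_eq_single i]
  · rw [G.map_update_smul, smul_eq_mul]
    congr 2
    exact Function.update_eq_self i _
  · intro j _ hj
    rw [G.map_update_smul, G.map_update_self (fun j => ee j) hj.symm, smul_zero]
  · simp

end AlternatingForms

variable {d : ℕ} {M : Type*} [TopologicalSpace M] [ChartedSpace (E d) M] [IsManifold (𝓡 d) ∞ M]
variable {φ φ' : OpenPartialHomeomorph M (E d)} {p : ℕ} {conn : Connection d M}
variable {ν : ℤˣ} {x : M} {vol : Π x : M, TangentSpace (𝓡 d) x [⋀^Fin d]→L[ℝ] ℝ}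

/-- The value at `x` of a form of top degree, read in a chart. -/
def chartForm (vol : Π x : M, TangentSpace (𝓡 d) x [⋀^Fin d]→L[ℝ] ℝ)
    (φ : OpenPartialHomeomorph M (E d)) (x : M) : E d [⋀^Fin d]→ₗ[ℝ] ℝ :=
  (vol x).toAlternatingMap.compLinearMap ((chartD φ x).inverse : E d →ₗ[ℝ] TangentSpace (𝓡 d) x)

theorem chartForm_apply (w : Fin d → E d) :
    chartForm vol φ x w = vol x fun i => chartField φ (w i) x := rfl

/-- The coefficient of a form of top degree in a chart. -/
def chartCoef (vol : Π x : M, TangentSpace (𝓡 d) x [⋀^Fin d]→L[ℝ] ℝ)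
    (φ : OpenPartialHomeomorph M (E d)) (x : M) : ℝ :=
  vol x fun i => chartField φ (ee i) x

theorem chartCoef_ne_zero (hφ : φ ∈ IsManifold.maximalAtlas (𝓡 d) ∞ M) (hx : x ∈ φ.source)
    (h : vol x ≠ 0) : chartCoef vol φ x ≠ 0 := by
  intro h0
  refine h ?_
  ext v
  have h1 : chartForm vol φ x (fun i => chartD φ x (v i)) = vol x v := by
    rw [chartForm_apply]
    simp only [chartField_chartD hφ hx]
  have h2 : chartForm vol φ x (fun i => ee i) = 0 := h0
  rw [← h1, alternating_eq_smul_det (chartForm vol φ x), h2, zero_smul]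
  rfl

theorem chartCoef_trn (hφ : φ ∈ IsManifold.maximalAtlas (𝓡 d) ∞ M)
    (hφ' : φ' ∈ IsManifold.maximalAtlas (𝓡 d) ∞ M) (hx : x ∈ φ.source) (hx' : x ∈ φ'.source)
    {A : E d ≃ₗ[ℝ] E d} {s : ℝ} {b : E d} (h : IsSimTrn p φ φ' x A s b) :
    chartCoef vol φ x =
      s ^ d * LinearMap.det (A : E d →ₗ[ℝ] E d) * chartCoef vol φ' x := by
  have h1 : ∀ v, chartField φ v x = chartField φ' ((s • (A : E d →ₗ[ℝ] E d)) v) x := fun v => by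
    rw [← chartField_trn hφ hφ' hx hx', h.fderiv_apply]; rfl
  have h2 := alternating_map (chartForm vol φ' x) (s • (A : E d →ₗ[ℝ] E d))
  rw [LinearMap.det_smul, finrank_euclideanSpace_fin, chartForm_apply, chartForm_apply] at h2
  simp only [chartCoef, h1 (ee _)]
  exact h2

/-- Parallelism is applied to global extensions of the coordinate fields; near `x` they give the
same coefficient and the same covariant derivatives. -/
theorem hasMFDerivAt_chartCoef [T2Space M] (hvol : IsVolumeForm vol) (hpres : Preserves conn vol)
    (hφ : φ ∈ IsManifold.maximalAtlas (𝓡 d) ∞ M) (hx : x ∈ φ.source) :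
    MDifferentiableAt (𝓡 d) 𝓘(ℝ, ℝ) (chartCoef vol φ) x ∧
    ∀ w, mfderiv (𝓡 d) 𝓘(ℝ, ℝ) (chartCoef vol φ) x w = ∑ i, chartForm vol φ x
      (Function.update (fun j => ee j) i (christoffel conn φ (φ x) (chartD φ x w) (ee i))) := by
  choose X hX hXe using fun i : Fin d =>
    exists_smooth_extension hφ (W := fun _ => (ee i : E d)) contDiff_const hx
  have heq : (fun y => vol y fun i => X i y) =ᶠ[𝓝 x] chartCoef vol φ := by
    filter_upwards [eventually_all.2 hXe] with y hy
    simp only [hy]; rfl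
  have hsm := (hvol.2 X hX x).mdifferentiableAt (by simp)
  refine ⟨hsm.congr_of_eventuallyEq heq.symm, fun w => ?_⟩
  have h1 := hpres X hX x w
  rw [heq.mfderiv_eq] at h1
  refine h1.trans (Finset.sum_congr rfl fun i _ => ?_)
  have h2 : conn (X i) x = conn (chartField φ (ee i)) x :=
    conn.isCovariantDerivativeOnUniv.congr_of_eventuallyEq
      ((hX i).contMDiffAt.mdifferentiableAt (by simp))
      (mdifferentiableAt_chartField hφ hx _) univ_mem (hXe i)
  rw [chartForm_apply, christoffel_apply conn hx, chartField_chartD hφ hx, h2]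
  congr 1
  ext1 j
  by_cases hj : j = i
  · subst hj
    rw [Function.update_self, Function.update_self, chartField_chartD hφ hx]
  · rw [Function.update_of_ne hj, Function.update_of_ne hj]
    exact (hXe j).self_of_nhds

/-- The radial derivative of the coefficient of a parallel volume form in a model chart. -/
theorem radial_chartCoef [T2Space M] (hvol : IsVolumeForm vol) (hpres : Preserves conn vol)
    (hφ : IsModelChart p conn 0 ν φ) {y : E d} (hy : y ∈ φ.target) :
    DifferentiableAt ℝ (fun z => chartCoef vol φ (φ.symm z)) y ∧
    fderiv ℝ (fun z => chartCoef vol φ (φ.symm z)) y y =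
      -(2 * d + 2) * chartCoef vol φ (φ.symm y) := by
  have hx := φ.map_target hy
  obtain ⟨h1, h2⟩ := hasMFDerivAt_chartCoef hvol hpres hφ.smooth hx
  have hsym := (chart_mdifferentiable hφ.smooth).symm.mdifferentiableAt hy
  have h3 : HasMFDerivAt (𝓡 d) 𝓘(ℝ, ℝ) (fun z => chartCoef vol φ (φ.symm z)) y
      ((mfderiv (𝓡 d) 𝓘(ℝ, ℝ) (chartCoef vol φ) (φ.symm y)).comp
        (mfderiv (𝓡 d) (𝓡 d) φ.symm y)) :=
    h1.hasMFDerivAt.comp y hsym.hasMFDerivAt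
  let L : E d →L[ℝ] ℝ := (mfderiv (𝓡 d) 𝓘(ℝ, ℝ) (chartCoef vol φ) (φ.symm y)).comp
    (mfderiv (𝓡 d) (𝓡 d) φ.symm y)
  have h4 : HasFDerivAt (fun z => chartCoef vol φ (φ.symm z)) L y := h3.hasFDerivAt
  refine ⟨h4.differentiableAt, ?_⟩
  rw [h4.fderiv]
  refine (h2 (mfderiv (𝓡 d) (𝓡 d) φ.symm y y)).trans ?_
  have h5 : chartD φ (φ.symm y) (mfderiv (𝓡 d) (𝓡 d) φ.symm y y) = y :=
    congrArg (fun L => L y) ((chart_mdifferentiable hφ.smooth).comp_symm_deriv hy)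
  have hq : q p (φ (φ.symm y)) ≠ 0 := hφ.q_ne_zero hx
  -- The factor is the `i`-th diagonal entry of `Γ(y, ·)`, namely `a(e_i) y_i + a(y)` with `a(y) =
  -- -2`; these entries sum to `-2 - 2d`.
  have h6 : ∀ i, chartForm vol φ (φ.symm y) (Function.update (fun j => ee j) i
      (christoffel conn φ (φ (φ.symm y)) y (ee i))) =
      (-(2 * (eps p i * (y i * y i)) / q p y) - 2) * chartCoef vol φ (φ.symm y) := by
    intro i
    rw [alternating_update, hφ.christoffel_eq hx, potential_zero]
    rw [φ.right_inv hy] at hq ⊢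
    have h7 : sprod p y y = q p y := rfl
    have h8 : chartForm vol φ (φ.symm y) (fun j => ee j) = chartCoef vol φ (φ.symm y) := rfl
    rw [h7, h8, sprod_ee]
    simp only [PiLp.add_apply, PiLp.smul_apply, smul_eq_mul, ee_apply, if_true]
    field_simp
    ring
  rw [h5, Finset.sum_congr rfl fun i _ => h6 i, ← Finset.sum_mul, Finset.sum_sub_distrib,
    Finset.sum_const, Finset.card_univ, Fintype.card_fin, nsmul_eq_mul]
  congr 1
  rw [φ.right_inv hy] at hq
  have h9 : ∑ i, -(2 * (eps p i * (y i * y i)) / q p y) = -2 := by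
    rw [Finset.sum_neg_distrib, ← Finset.sum_div, ← Finset.mul_sum]
    change -(2 * q p y / q p y) = -2
    field_simp
  rw [h9]; ring

theorem not_exists_parallel_volumeForm [T2Space M] [Nonempty M] [CompactSpace M] (hd : 2 ≤ d)
    (hG : HasGroupoid M (similarityGroupoid p d)) (hmod : IsModelledOn p conn 0 ν) :
    ¬ ∃ vol : (Π x : M, TangentSpace (𝓡 d) x [⋀^Fin d]→L[ℝ] ℝ),
      IsVolumeForm vol ∧ Preserves conn vol := by
  rintro ⟨vol, hvol, hpres⟩
  choose ch hch hmem using isModelledOn_iff.1 hmod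
  -- Under `x ↦ s A x` the factors scale by `s^(-4d)` and `s^(4d)`, and the even power removes the
  -- sign of `det A`; so the product does not depend on the chart.
  let H : OpenPartialHomeomorph M (E d) → M → ℝ := fun φ x =>
    chartCoef vol φ x ^ 4 * q p (φ x) ^ (2 * d)
  let h : OpenPartialHomeomorph M (E d) → E d → ℝ := fun φ z =>
    chartCoef vol φ (φ.symm z) ^ 4 * q p z ^ (2 * d)
  have hHh : ∀ φ x, x ∈ φ.source → H φ x = h φ (φ x) := fun φ x hx => by
    simp only [H, h, φ.left_inv hx]
  have hinv : ∀ (φ : OpenPartialHomeomorph M (E d)) (x : M), IsModelChart p conn 0 ν φ →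
      x ∈ φ.source → H φ x = H (ch x) x := by
    intro φ x hφ hx
    obtain ⟨A, s, hA⟩ := hφ.exists_linear_trn hd hG (hch x) hx (hmem x)
    have h1 := det_sq_of_isometry hA.2.1
    have h2 := chartCoef_trn (vol := vol) hφ.smooth (hch x).smooth hx (hmem x) hA
    have h3 : q p (ch x x) = s ^ 2 * q p (φ x) := by
      rw [hA.apply hx, add_zero, q_smul, hA.2.1]
    have h4 : LinearMap.det (A : E d →ₗ[ℝ] E d) ^ 4 = 1 := by
      rw [show 4 = 2 * 2 from rfl, pow_mul, h1, one_pow]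
    simp only [H, h2, h3, mul_pow, h4, mul_one, ← pow_mul]
    ring
  -- The constant is `-4(2d + 2) + 4d`: the fourth power of the coefficient contributes the first
  -- term and `q^(2d)`, of degree `4d`, the second. It is nonzero, which a maximum does not allow.
  have hdiff : ∀ (φ : OpenPartialHomeomorph M (E d)), IsModelChart p conn 0 ν φ →
      ∀ y ∈ φ.target, DifferentiableAt ℝ (h φ) y ∧
        fderiv ℝ (h φ) y y = -(4 * d + 8) * h φ y := by
    intro φ hφ y hy
    obtain ⟨h1, h2⟩ := radial_chartCoef hvol hpres hφ hy
    have h3 := (h1.hasFDerivAt.pow 4).mul ((hasFDerivAt_q p y).pow (2 * d))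
    refine ⟨h3.differentiableAt, ?_⟩
    have h4 : fderiv ℝ (h φ) y = _ := h3.fderiv
    have h5 : sprod p y y = q p y := rfl
    have h6 : q p y ^ (2 * d) = q p y ^ (2 * d - 1) * q p y := by
      rw [← pow_succ]; congr 1; omega
    rw [h4]
    simp only [add_apply, smul_apply, smul_eq_mul, nsmul_eq_mul, h2, sform_apply, h5, h, h6]
    push_cast
    ring
  have hcont : Continuous fun x => H (ch x) x := by
    rw [continuous_iff_continuousAt]
    intro x
    have h1 : ContinuousAt (fun z => h (ch x) (ch x z)) x :=
      ContinuousAt.comp (f := ch x) (hdiff _ (hch x) _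
        ((ch x).map_source (hmem x))).1.continuousAt ((ch x).continuousAt (hmem x))
    refine h1.congr ?_
    filter_upwards [(ch x).open_source.mem_nhds (hmem x)] with z hz
    rw [← hHh _ _ hz, hinv _ _ (hch x) hz]
  obtain ⟨x, -, hx⟩ := isCompact_univ.exists_isMaxOn (univ_nonempty (α := M)) hcont.continuousOn
  have hxt := (ch x).map_source (hmem x)
  have hmax : IsLocalMax (h (ch x)) (ch x x) := by
    filter_upwards [(ch x).open_target.mem_nhds hxt] with y hy
    have hys := (ch x).map_target hy
    have h1 := hHh (ch x) _ hys
    rw [(ch x).right_inv hy, hinv _ _ (hch x) hys] at h1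
    rw [← h1, ← hHh _ _ (hmem x)]
    exact hx (mem_univ _)
  have h1 := (hdiff _ (hch x) _ hxt).2
  rw [hmax.fderiv_eq_zero, zero_apply, ← hHh _ _ (hmem x)] at h1
  have h2 : H (ch x) x ≠ 0 := mul_ne_zero
    (pow_ne_zero _ (chartCoef_ne_zero (hch x).smooth (hmem x) (hvol.1 x)))
    (pow_ne_zero _ ((hch x).q_ne_zero (hmem x)))
  have h3 : (-(4 * d + 8) : ℝ) ≠ 0 := neg_ne_zero.2 (by positivity)
  exact mul_ne_zero h3 h2 h1.symm

end Volume
end StiffPair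
end


/-! ### The main theorem -/

theorem mainTheorem8 (p d : ℕ) (hp : p ≤ d) (hd : 2 ≤ d)
    (M : Type*) [TopologicalSpace M] [T2Space M] [ConnectedSpace M] [CompactSpace M]
    [ChartedSpace (StiffPair.E d) M] [IsManifold (𝓡 d) ∞ M]
    (conn : StiffPair.Connection d M)
    (hstiff : StiffPair.IsStiffPair p conn)
    (hflat : ¬ StiffPair.IsFlat conn) :
    -- it is not an isometry stiff pair
    ¬ StiffPair.IsIsometryStiffPair p conn ∧
    -- there is a unique associated canonical model, and it has parameter zero
    (∃! m : ℝ × ℤˣ, m.1 ∈ ({-1, 0, 1} : Set ℝ) ∧ StiffPair.IsModelledOn p conn m.1 m.2) ∧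
    (∀ (l : ℝ) (ν : ℤˣ), l ∈ ({-1, 0, 1} : Set ℝ) → StiffPair.IsModelledOn p conn l ν → l = 0) ∧
    -- there is a smooth vector field without zeros
    (∃ X : Π x : M, TangentSpace (𝓡 d) x,
      ContMDiff (𝓡 d) (𝓡 d).tangent ∞ (fun x => (⟨x, X x⟩ : TangentBundle (𝓡 d) M)) ∧
      ∀ x, X x ≠ 0) ∧
    -- it is not geodesically complete
    ¬ StiffPair.IsGeodesicallyComplete conn ∧
    -- no global volume form is preserved by the connection
    ¬ ∃ vol : (Π x : M, TangentSpace (𝓡 d) x [⋀^Fin d]→L[ℝ] ℝ),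
      StiffPair.IsVolumeForm vol ∧ StiffPair.Preserves conn vol := by
  have huniq := StiffPair.existsUnique_model hd hstiff hflat
  obtain ⟨⟨l, ν⟩, -, hmod⟩ := huniq.exists
  obtain rfl : l = 0 := hmod.eq_zero hd hstiff hflat
  exact ⟨StiffPair.not_isIsometryStiffPair hd hstiff hflat, huniq,
    fun l ν _ h => h.eq_zero hd hstiff hflat, StiffPair.exists_vectorField hd hstiff.1 hmod,
    StiffPair.not_isGeodesicallyComplete hd hstiff hmod,
    StiffPair.not_exists_parallel_volumeForm hd hstiff.1 hmod⟩
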